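/- Let $0<T\le\infty$ and put $J_T=\{t\ge 0: t\le T\}$ (so $J_T=[0,T]$ if $T<\infty$ and $J_T=[0,\infty)$ if $T=\infty$). Let $u_0,u_1:[0,\infty)\to\mathbb R$ (initial data, $u_0=u(\cdot,0)$, $u_1=u_t(\cdot,0)$) and $g_0,g_1:J_T\to\mathbb R$ (boundary data, $g_0=u(0,\cdot)$, $g_1=u_x(0,\cdot)$) be such that $u_0,g_0$ are $C^2$ and $u_1,g_1$ are $C^1$; for some integer $n$ the functions $u_0-2\pi n,\ u_0',\ u_0'',\ u_1,\ u_1'$ are integrable on $[0,\infty)$; and, if $T=\infty$, for some integer $n'$ the functions $g_0-2\pi n',\ g_0',\ g_0'',\ g_1,\ g_1'$ are integrable on $[0,\infty)$. Assume $\cos g_0(t)\ne-1$ for all $t\in J_T$. Let $\sigma_1=\begin{pmatrix}0&1\\1&0\end{pmatrix}$, $\sigma_2=\begin{pmatrix}0&-i\\i&0\end{pmatrix}$, $\sigma_3=\begin{pmatrix}1&0\\0&-1\end{pmatrix}$, let $e^{c\hat\sigma_3}M=e^{c\sigma_3}Me^{-c\sigma_3}$, and, with $q=u_x+u_t$ and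 $w=\sin u-u_t(1-\cos u)+u_x(1+\cos u)$, let $$V_1=i\sin^2\tfrac u2(\cos u-q\sin u)\lambda\sigma_3-i\sin^2\tfrac u2(q\cos u+\sin u)\lambda\sigma_2-\tfrac i4 w\,\sigma_1,$$ $$V_2=\tfrac i4\bigl(-3+2\cos u+\cos 2u-q(2\sin u+\sin 2u)\bigr)\lambda\sigma_3-i\cos^2\tfrac u2(q\cos u+\sin u)\lambda\sigma_2+\tfrac i4 w\,\sigma_1 .$$ $V_1(x,0,\lambda)$ is $V_1$ at $(u,u_x,u_t)=(u_0,u_0',u_1)(x)$, and $V_2(0,t,\lambda)$ is $V_2$ at $(u,u_x,u_t)=(g_0,g_1,g_0')(t)$. For $\lambda\ne0$ let the columns of $\mu_3(\cdot,0,\lambda)$ and $\mu_1(0,\cdot,\lambda)$ be the bounded continuous solutions of the corresponding columns of the Volterra equations $$\mu_3(x,0,\lambda)=I-\int_x^\infty e^{\frac{i(x'-x)}{8\lambda}\hat\sigma_3}(V_1\mu_3)(x',0,\lambda)\,dx',\qquad \mu_1(0,t,\lambda)=I-\int_t^T e^{i(\lambda+\frac1{8\lambda})(t-t')\hat\sigma_3}(V_2\mu_1)(0,t',\lambda)\,dt'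 .$$ Put $s(\lambda)=\mu_3(0,0,\lambda)$ and $S(\lambda)=\mu_1(0,0,\lambda)$ for $\lambda\neq0$, with the convention $s(0)=S(0)=I$. Let $a=s_{22}$, $b=s_{12}$, $A=S_{22}$, $B=S_{12}$. Let $$D_1=\{\operatorname{Im}\tfrac1{8\lambda}>0,\ \operatorname{Im}(\lambda+\tfrac1{8\lambda})<0\},\quad D_2=\{\operatorname{Im}\tfrac1{8\lambda}>0,\ \operatorname{Im}(\lambda+\tfrac1{8\lambda})>0\},\quad D_3=\{\operatorname{Im}\tfrac1{8\lambda}<0,\ \operatorname{Im}(\lambda+\tfrac1{8\lambda})<0\}$$ (subsets of $\mathbb C\setminus\{0\}$), let $R\geq 0$, $$R^2=\sup_{t',t\in J_T,\ t'<t}\frac{t-t'}{4\int_{t'}^t(1+\cos g_0(\tau))\sqrt{1+(g_1(\tau)+g_0'(\tau))^2}\,d\tau},$$ $D_6=\{\operatorname{Im}\lambda<0,\ |\lambda|>R\}$ and $D_1'=D_1\setminus\overline{D_6}$. Closures are taken in $\mathbb C$. Then $R<\infty$, and the following hold. **Initial data.** For $\lambda\neq0$ the second column of $\mu_3(\cdot,0,\lambda)$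 exists and is unique if $\operatorname{Im}\lambda\le0$, and the first if $\operatorname{Im}\lambda\ge0$; moreover $s_{11}(\lambda)=\overline{a(\bar\lambda)}$ and $s_{21}(\lambda)=-\overline{b(\bar\lambda)}$ for $\operatorname{Im}\lambda\ge0$. (i) $a,b$ are analytic on $D_1\cup D_2$, and continuous and bounded on $\overline{D_1'}\cup\overline{D_2}$. (ii) $a(\lambda)=1+O(\lambda)$ and $b(\lambda)=O(\lambda)$ as $\lambda\to0$, $\lambda\in D_2$. (iii) $|a(\lambda)|^2+|b(\lambda)|^2=1$ for $\lambda\in\mathbb R$. **Boundary data.** For $\lambda\neq0$ the second column of $\mu_1(0,\cdot,\lambda)$ exists and is unique if $T<\infty$ or $\operatorname{Im}(\lambda+\frac1{8\lambda})\le0$, and the first if $T<\infty$ or $\operatorname{Im}(\lambda+\frac1{8\lambda})\ge0$; in the latter case (and at $\lambda=0$) $S_{11}(\lambda)=\overline{A(\bar\lambda)}$ and $S_{21}(\lambda)=-\overline{B(\bar\lambda)}$. (i) $A,B$ are analytic on $D_1\cup D_3$, and continuous and bounded on $\overline{D_1'}\cup\overline{D_3}$. If $T<\infty$, then $A,B$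 are analytic on $\mathbb C\setminus\{0\}$. (ii) $A(\lambda)=1+O(\lambda)$ and $B(\lambda)=O(\lambda)$ as $\lambda\to0$, $\lambda\in D_1\cup D_3$. (iii) $A(\lambda)\overline{A(\bar\lambda)}+B(\lambda)\overline{B(\bar\lambda)}=1$ for $\lambda\in\mathbb R\cup\{|\lambda|^2=1/8\}$, and for all $\lambda\in\mathbb C$ if $T<\infty$. -/

import Mathlib

open Set Filter Topology Asymptotics MeasureTheory
open scoped Matrix ComplexConjugate

noncomputable section

namespace GSG

/-- Pauli matrices. -/
def sigma1 : Matrix (Fin 2) (Fin 2) ℂ := !![0, 1; 1, 0]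

def sigma2 : Matrix (Fin 2) (Fin 2) ℂ := !![0, -Complex.I; Complex.I, 0]

def sigma3 : Matrix (Fin 2) (Fin 2) ℂ := !![1, 0; 0, -1]

/-- The potential `V₁` of the `x`-part of the Lax pair, as a function of the values of
`u`, `u_x`, `u_t` at a point and of the spectral parameter `k`. -/
def V1 (u ux ut : ℝ) (k : ℂ) : Matrix (Fin 2) (Fin 2) ℂ :=
  (Complex.I * ((Real.sin (u / 2) ^ 2 * (Real.cos u - (ut + ux) * Real.sin u) : ℝ) : ℂ) * k)
      • sigma3
    - (Complex.I * ((Real.sin (u / 2) ^ 2 * ((ut + ux) * Real.cos u + Real.sin u) : ℝ) : ℂ) * k)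
      • sigma2
    - (Complex.I / 4 *
        ((Real.sin u - ut * (1 - Real.cos u) + ux * (1 + Real.cos u) : ℝ) : ℂ)) • sigma1

/-- The potential `V₂` of the `t`-part of the Lax pair. -/
def V2 (u ux ut : ℝ) (k : ℂ) : Matrix (Fin 2) (Fin 2) ℂ :=
  (Complex.I / 4 * ((-3 + 2 * Real.cos u + Real.cos (2 * u)
        - (ut + ux) * (2 * Real.sin u + Real.sin (2 * u)) : ℝ) : ℂ) * k) • sigma3
    - (Complex.I * ((Real.cos (u / 2) ^ 2 * ((ut + ux) * Real.cos u + Real.sin u) : ℝ) : ℂ) * k)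
      • sigma2
    + (Complex.I / 4 *
        ((Real.sin u - ut * (1 - Real.cos u) + ux * (1 + Real.cos u) : ℝ) : ℂ)) • sigma1

/-- The time interval: `[0, T]` for `T < ∞` and `[0, ∞)` for `T = ∞`. -/
def timeInterval (T : EReal) : Set ℝ := {t : ℝ | 0 ≤ t ∧ (t : EReal) ≤ T}

/-- Smoothness and decay of a pair of data `(f, h)` on an interval `J`, where `f` stands for the
values of `u` and `h` for the values of the normal derivative of `u`: `f` is `C²`, `h` is `C¹`, and
`f - 2πn` (for some integer `n`), `f'`, `f''`, `h`, `h'` are integrable over `J`.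
On a compact `J` the integrability follows from the smoothness. -/
structure AdmissibleData (J : Set ℝ) (f h : ℝ → ℝ) : Prop where
  smooth_value : ContDiffOn ℝ 2 f J
  smooth_normal : ContDiffOn ℝ 1 h J
  decay_value : ∃ n : ℤ, IntegrableOn (fun y => f y - 2 * Real.pi * n) J
  decay_deriv : IntegrableOn (derivWithin f J) J
  decay_deriv2 : IntegrableOn (derivWithin (derivWithin f J) J) J
  decay_normal : IntegrableOn h J
  decay_normal_deriv : IntegrableOn (derivWithin h J) J

/-- The diagonal entries `1, -1` of `σ₃`. -/
def sgn : Fin 2 → ℂ := ![1, -1]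

/-- `ψ` is a bounded continuous solution on the interval `J` of the `j`-th column of the
matrix Volterra equation
`μ(y) = I - ∫_{y' ∈ J, y' ≥ y} e^{iκ(y' - y) σ̂₃} (V(y') μ(y')) dy'`.
Here `e^{iφ σ̂₃} A = e^{iφ σ₃} A e^{-iφ σ₃}`, whose `(i, j)` entry is
`e^{iφ (sgn i - sgn j)} A i j`. -/
structure IsVolterraColumn (V : ℝ → Matrix (Fin 2) (Fin 2) ℂ) (κ : ℂ) (J : Set ℝ) (j : Fin 2)
    (ψ : ℝ → Fin 2 → ℂ) : Prop where
  continuousOn : ContinuousOn ψ J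
  bounded : ∃ C : ℝ, ∀ y ∈ J, ∀ i, ‖ψ y i‖ ≤ C
  eqn : ∀ y ∈ J, ∀ i, ψ y i = (1 : Matrix (Fin 2) (Fin 2) ℂ) i j -
    ∫ y' in J ∩ Ici y,
      Complex.exp (Complex.I * (κ * ((y' - y : ℝ) : ℂ)) * (sgn i - sgn j)) * (V y' *ᵥ ψ y') i

/-- The `j`-th column of the Volterra equation has exactly one bounded continuous solution on `J`
(two solutions are identified if they agree on `J`). -/
def HasUniqueColumn (V : ℝ → Matrix (Fin 2) (Fin 2) ℂ) (κ : ℂ) (J : Set ℝ) (j : Fin 2) : Prop :=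
  ∃ ψ, IsVolterraColumn V κ J j ψ ∧ ∀ φ, IsVolterraColumn V κ J j φ → EqOn φ ψ J

/-- A bounded continuous solution of the `j`-th column of the Volterra equation (meaningful where
`HasUniqueColumn` holds). -/
def volterraColumn (V : ℝ → Matrix (Fin 2) (Fin 2) ℂ) (κ : ℂ) (J : Set ℝ) (j : Fin 2) :
    ℝ → Fin 2 → ℂ :=
  Classical.epsilon (IsVolterraColumn V κ J j)

/-- The potential `V₁(x, 0, k)` built from the initial data `u₀ = u(·, 0)`, `u₁ = u_t(·, 0)`. -/
def initialPotential (u₀ u₁ : ℝ → ℝ) (k : ℂ) (x : ℝ) : Matrix (Fin 2) (Fin 2) ℂ :=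
  V1 (u₀ x) (derivWithin u₀ (Ici 0) x) (u₁ x) k

/-- The potential `V₂(0, t, k)` built from the boundary data `g₀ = u(0, ·)`, `g₁ = u_x(0, ·)`. -/
def boundaryPotential (T : EReal) (g₀ g₁ : ℝ → ℝ) (k : ℂ) (t : ℝ) : Matrix (Fin 2) (Fin 2) ℂ :=
  V2 (g₀ t) (g₁ t) (derivWithin g₀ (timeInterval T) t) k

/-- The phases: `θ(x, t, k) = xPhase k * x + tPhase k * t`. -/
def xPhase (k : ℂ) : ℂ := 1 / (8 * k)

def tPhase (k : ℂ) : ℂ := -(k + 1 / (8 * k))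

/-- The eigenfunction `μ₃(x, 0, k)`, normalized at `x = ∞`. -/
def mu3 (u₀ u₁ : ℝ → ℝ) (x : ℝ) (k : ℂ) : Matrix (Fin 2) (Fin 2) ℂ :=
  Matrix.of fun i j => volterraColumn (initialPotential u₀ u₁ k) (xPhase k) (Ici 0) j x i

/-- The eigenfunction `μ₁(0, t, k)`, normalized at `t = T`. -/
def mu1 (T : EReal) (g₀ g₁ : ℝ → ℝ) (t : ℝ) (k : ℂ) : Matrix (Fin 2) (Fin 2) ℂ :=
  Matrix.of fun i j =>
    volterraColumn (boundaryPotential T g₀ g₁ k) (tPhase k) (timeInterval T) j t i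

/-- The spectral function `s(k) = μ₃(0, 0, k)`. The Volterra equation is singular at `k = 0`, where
`s` is given the value `I`. -/
def s (u₀ u₁ : ℝ → ℝ) (k : ℂ) : Matrix (Fin 2) (Fin 2) ℂ :=
  if k = 0 then 1 else mu3 u₀ u₁ 0 k

/-- The spectral function `S(k) = μ₁(0, 0, k)`, with `S(0) = I`. -/
def S (T : EReal) (g₀ g₁ : ℝ → ℝ) (k : ℂ) : Matrix (Fin 2) (Fin 2) ℂ :=
  if k = 0 then 1 else mu1 T g₀ g₁ 0 k

/-- `a` and `b` form the second column of `s`. -/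
def a (u₀ u₁ : ℝ → ℝ) (k : ℂ) : ℂ := s u₀ u₁ k 1 1

def b (u₀ u₁ : ℝ → ℝ) (k : ℂ) : ℂ := s u₀ u₁ k 0 1

/-- `A` and `B` form the second column of `S`. -/
def A (T : EReal) (g₀ g₁ : ℝ → ℝ) (k : ℂ) : ℂ := S T g₀ g₁ k 1 1

def B (T : EReal) (g₀ g₁ : ℝ → ℝ) (k : ℂ) : ℂ := S T g₀ g₁ k 0 1

/-- The domains of the spectral plane (none of them contains `0` or `∞`). -/
def D1 : Set ℂ := {k | k ≠ 0 ∧ 0 < (1 / (8 * k)).im ∧ (k + 1 / (8 * k)).im < 0}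

def D2 : Set ℂ := {k | k ≠ 0 ∧ 0 < (1 / (8 * k)).im ∧ 0 < (k + 1 / (8 * k)).im}

def D3 : Set ℂ := {k | k ≠ 0 ∧ (1 / (8 * k)).im < 0 ∧ (k + 1 / (8 * k)).im < 0}

/-- The quotients whose supremum is `R²`; here `m(0, τ) = 1 + (g₁(τ) + g₀'(τ))²`. -/
def ratioSet (T : EReal) (g₀ g₁ : ℝ → ℝ) : Set ℝ :=
  {r | ∃ t' ∈ timeInterval T, ∃ t ∈ timeInterval T, t' < t ∧
    r = (t - t') / (4 * ∫ τ in t'..t, (1 + Real.cos (g₀ τ)) *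
      Real.sqrt (1 + (g₁ τ + derivWithin g₀ (timeInterval T) τ) ^ 2))}

def R (T : EReal) (g₀ g₁ : ℝ → ℝ) : ℝ := Real.sqrt (sSup (ratioSet T g₀ g₁))

def D6 (T : EReal) (g₀ g₁ : ℝ → ℝ) : Set ℂ := {k | k.im < 0 ∧ R T g₀ g₁ < ‖k‖}

/-- `D₁' = D₁ \ closure D₆`. -/
def D1' (T : EReal) (g₀ g₁ : ℝ → ℝ) : Set ℂ := D1 \ closure (D6 T g₀ g₁)

end GSG

end

noncomputable section

namespace GSG

section

/-! ### The interval `timeInterval T` -/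

/-! Both Lax potentials have the form `i α k σ₃ - i β k σ₂ + i w σ₁` with real `α`, `β`, `w`, and
after conjugation by the exponentials the second column of either Volterra equation reads `ψ(y) =
(0,1) - ∫_y^T G(y,x) ψ(x) dx`, where `G` carries the factor `exp(2iκ(x-y))` on its first row only.
Here `κ = 1/(8k)` on the `x`-axis and `κ = -(k + 1/(8k))` on the `t`-axis. If `Im κ ≥ 0` or `T < ∞`,
then `G` is dominated by an integrable function `m(x)`. So one theory of Volterra equations with
dominated kernel serves both axes and both cases of `T`.

The theory rests on the weight `exp(2N)` with `N' = m`: it makes the Volterra operator a contraction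
(`exists_volterraSol`) and gives the a priori bound `IsVolterraSol.norm_le`, with a constant
depending only on `∫ m`. Applied to differences of solutions for different parameters, this bound
gives uniqueness, continuity up to the boundary `Im κ = 0` (`IsLaxData.continuousOn_column`) and
holomorphy inside (`IsLaxData.differentiableAt_column`).

Near `k = 0` the coefficients `α k` and `β k` are already `O(k)`, and `w` meets an exponential of
frequency `|κ| ≥ 1/(16|k|)`; one integration by parts turns this into `O(k)` as well
(`IsLaxData.exists_small_bound`). This is the asymptotic statement, and also continuity at `0` with
the value `I`.

The symmetry `σ₂ conj(V(conj k)) σ₂ = V(k)` produces the first column from the second and makes the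
pairing of the columns at `k` and `conj k` independent of `y`; its value at the right end is `1`
(`IsLaxData.column_mul_conj`).

For the data, `α`, `β`, `w` vanish when `u` is a multiple of `2π` and `u_x = u_t = 0`, so the decay
hypotheses make them integrable. In the spectral plane everything reduces to the signs of `Im k` and
of `|k|² - 1/8`. The closure of `D1'` lies in `|k| ≤ R`, hence boundedness follows from continuity
on a compact set; `R` is finite because `1 + cos g₀` is bounded away from zero. -/

theorem timeInterval_top : timeInterval ⊤ = Ici 0 := by
  ext t; simp [timeInterval]

theorem timeInterval_coe (r : ℝ) : timeInterval (r : EReal) = Icc 0 r := by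
  ext t; simp [timeInterval]

theorem timeInterval_cases {T : EReal} (hT : 0 < T) :
    (T = ⊤ ∧ timeInterval T = Ici 0) ∨ ∃ r : ℝ, 0 < r ∧ T = r ∧ timeInterval T = Icc 0 r := by
  induction T using EReal.rec with
  | bot => simp at hT
  | coe r => exact Or.inr ⟨r, by exact_mod_cast hT, rfl, timeInterval_coe r⟩
  | top => exact Or.inl ⟨rfl, timeInterval_top⟩

variable {T : EReal}

theorem nonneg_of_mem_timeInterval {t : ℝ} (ht : t ∈ timeInterval T) : 0 ≤ t := ht.1

theorem zero_mem_timeInterval (hT : 0 < T) : (0 : ℝ) ∈ timeInterval T :=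
  ⟨le_rfl, by exact_mod_cast hT.le⟩

theorem mem_timeInterval_of_le {s t : ℝ} (ht : t ∈ timeInterval T) (h0 : 0 ≤ s) (hst : s ≤ t) :
    s ∈ timeInterval T :=
  ⟨h0, le_trans (by exact_mod_cast hst) ht.2⟩

theorem Icc_subset_timeInterval {s t : ℝ} (hs : s ∈ timeInterval T) (ht : t ∈ timeInterval T) :
    Icc s t ⊆ timeInterval T := fun _ hx =>
  mem_timeInterval_of_le ht (hs.1.trans hx.1) hx.2

theorem timeInterval_inter_Ici_zero : timeInterval T ∩ Ici 0 = timeInterval T :=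
  inter_eq_left.2 fun _ hx => hx.1

theorem convex_timeInterval : Convex ℝ (timeInterval T) := by
  refine OrdConnected.convex ⟨fun x hx y hy => Icc_subset_timeInterval hx hy⟩

theorem measurableSet_timeInterval (hT : 0 < T) : MeasurableSet (timeInterval T) := by
  rcases timeInterval_cases hT with ⟨-, h⟩ | ⟨r, -, -, h⟩ <;> rw [h]
  exacts [measurableSet_Ici, measurableSet_Icc]

theorem uniqueDiffOn_timeInterval (hT : 0 < T) : UniqueDiffOn ℝ (timeInterval T) := by
  rcases timeInterval_cases hT with ⟨-, h⟩ | ⟨r, hr, -, h⟩ <;> rw [h]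
  exacts [uniqueDiffOn_Ici 0, uniqueDiffOn_Icc hr]

/-- Composition with the retraction extends a function continuous on the interval to a continuous
function on `ℝ`, so that primitives and bounded continuous functions can be used on the whole line.
-/
theorem exists_retraction_timeInterval (hT : 0 < T) :
    ∃ p : ℝ → ℝ, Continuous p ∧ (∀ y, p y ∈ timeInterval T) ∧ ∀ y ∈ timeInterval T, p y = y := by
  rcases timeInterval_cases hT with ⟨-, h⟩ | ⟨r, hr, -, h⟩ <;> rw [h]
  · exact ⟨fun y => max 0 y, by fun_prop, fun y => mem_Ici.2 (le_max_left _ _), fun y hy => max_eq_right hy⟩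
  · refine ⟨fun y => max 0 (min y r), by fun_prop, fun y => ⟨le_max_left _ _, ?_⟩, fun y hy => ?_⟩
    · exact max_le hr.le (min_le_right _ _)
    · simp [hy.1, hy.2]

/-! ### Tail integrals over `timeInterval T ∩ Ici y`. -/

section Integrals

variable {F : Type*} [NormedAddCommGroup F] [NormedSpace ℝ F]

theorem setIntegral_tail_split (hT : 0 < T) {f : ℝ → F} (hf : IntegrableOn f (timeInterval T))
    {y z : ℝ} (hy : y ∈ timeInterval T) (hz : z ∈ timeInterval T) (hyz : y ≤ z) :
    ∫ x in timeInterval T ∩ Ici y, f x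
      = (∫ x in y..z, f x) + ∫ x in timeInterval T ∩ Ici z, f x := by
  have h : timeInterval T ∩ Ici y = Ico y z ∪ (timeInterval T ∩ Ici z) := by
    ext x
    simp only [mem_inter_iff, mem_Ici, mem_union, mem_Ico]
    constructor
    · rintro ⟨h1, h2⟩
      rcases lt_or_ge x z with h | h
      exacts [Or.inl ⟨h2, h⟩, Or.inr ⟨h1, h⟩]
    · rintro (⟨h1, h2⟩ | ⟨h1, h2⟩)
      exacts [⟨Icc_subset_timeInterval hy hz ⟨h1, h2.le⟩, h1⟩, ⟨h1, hyz.trans h2⟩]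
  have hm := (measurableSet_timeInterval hT).inter (measurableSet_Ici (a := z))
  rw [h, setIntegral_union _ hm (hf.mono_set _) (hf.mono_set inter_subset_left),
    intervalIntegral.integral_of_le hyz, integral_Ico_eq_integral_Ioo, integral_Ioc_eq_integral_Ioo]
  · rw [Set.disjoint_left]; exact fun x hx hx' => not_lt.2 hx'.2 hx.2
  · exact fun x hx => Icc_subset_timeInterval hy hz ⟨hx.1, hx.2.le⟩

/-- For `T = ∞` the tails of an integrable function tend to zero; for finite `T` the point `z = T`
works, since its tail is a null set. This is how the normalization at the right end is reached
without separating the two cases later. -/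
theorem exists_tail_lt (hT : 0 < T) {m : ℝ → ℝ} (hm : IntegrableOn m (timeInterval T))
    {ε : ℝ} (hε : 0 < ε) (y : ℝ) (hy : y ∈ timeInterval T) :
    ∃ z ∈ timeInterval T, y ≤ z ∧ ∫ x in timeInterval T ∩ Ici z, m x < ε := by
  rcases timeInterval_cases hT with ⟨-, h⟩ | ⟨r, hr, -, h⟩
  · have hlim : Tendsto (fun z => (∫ x in timeInterval T ∩ Ici (0 : ℝ), m x) - ∫ x in (0 : ℝ)..z, m x)
        atTop (𝓝 0) := by
      have := intervalIntegral_tendsto_integral_Ioi (f := m) (μ := volume) 0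
        (by rw [h] at hm; exact hm.mono_set Ioi_subset_Ici_self) tendsto_id
      rw [h, inter_self, integral_Ici_eq_integral_Ioi]
      simpa using this.const_sub (∫ x in Ioi (0 : ℝ), m x)
    obtain ⟨z, hz, hz1⟩ := ((hlim.eventually (gt_mem_nhds hε)).and (eventually_ge_atTop y)).exists
    have hzJ : z ∈ timeInterval T := by rw [h]; exact (nonneg_of_mem_timeInterval hy).trans hz1
    refine ⟨z, hzJ, hz1, ?_⟩
    rw [setIntegral_tail_split hT hm (zero_mem_timeInterval hT) hzJ hzJ.1] at hz
    simpa using hz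
  · have hrJ : r ∈ timeInterval T := by rw [h]; exact ⟨hr.le, le_rfl⟩
    refine ⟨r, hrJ, by rw [h] at hy; exact hy.2, ?_⟩
    have : timeInterval T ∩ Ici r = {r} := by
      rw [h]; ext x; simp only [mem_inter_iff, mem_Icc, mem_Ici, mem_singleton_iff]
      constructor
      · rintro ⟨⟨_, h1⟩, h2⟩; exact le_antisymm h1 h2
      · rintro rfl; exact ⟨⟨hr.le, le_rfl⟩, le_rfl⟩
    rw [this]; simpa using hε

/-- Reduces a bound on a possibly infinite range to uniform bounds on compact ranges, where
integration by parts is available. -/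
theorem norm_setIntegral_tail_le (hT : 0 < T) {f : ℝ → F} (hf : IntegrableOn f (timeInterval T))
    {y B : ℝ} (hy : y ∈ timeInterval T)
    (hB : ∀ z ∈ timeInterval T, y ≤ z → ‖∫ x in y..z, f x‖ ≤ B) :
    ‖∫ x in timeInterval T ∩ Ici y, f x‖ ≤ B := by
  refine le_of_forall_pos_le_add fun ε hε => ?_
  obtain ⟨z, hz, hyz, h⟩ := exists_tail_lt hT hf.norm hε y hy
  rw [setIntegral_tail_split hT hf hy hz hyz]
  refine (norm_add_le _ _).trans (add_le_add (hB z hz hyz) ?_)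
  exact (norm_integral_le_integral_norm _).trans h.le

theorem hasDerivWithinAt_tail [CompleteSpace F] (hT : 0 < T) {f : ℝ → F}
    (hf : IntegrableOn f (timeInterval T))
    (hc : ContinuousOn f (timeInterval T)) {y : ℝ} (hy : y ∈ timeInterval T) :
    HasDerivWithinAt (fun y => ∫ x in timeInterval T ∩ Ici y, f x) (-f y) (timeInterval T) y := by
  obtain ⟨p, hp, hpJ, hpid⟩ := exists_retraction_timeInterval hT
  have hcp : Continuous (fun x => f (p x)) := hc.comp_continuous hp hpJ
  have h0 := zero_mem_timeInterval hT
  have key : ∀ z ∈ timeInterval T, (∫ x in timeInterval T ∩ Ici z, f x)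
      = (∫ x in timeInterval T ∩ Ici 0, f x) - ∫ x in (0:ℝ)..z, f (p x) := by
    intro z hz
    rw [setIntegral_tail_split hT hf h0 hz hz.1]
    have : ∫ x in (0:ℝ)..z, f (p x) = ∫ x in (0:ℝ)..z, f x := by
      refine intervalIntegral.integral_congr fun x hx => ?_
      rw [uIcc_of_le hz.1] at hx
      simp only [hpid x (Icc_subset_timeInterval h0 hz hx)]
    rw [this]; abel
  have hd : HasDerivAt (fun z => ∫ x in (0:ℝ)..z, f (p x)) (f (p y)) y :=
    intervalIntegral.integral_hasDerivAt_right (hcp.intervalIntegrable _ _)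
      (hcp.stronglyMeasurableAtFilter _ _) hcp.continuousAt
  rw [hpid y hy] at hd
  exact ((hd.const_sub _).hasDerivWithinAt).congr key (key y hy)

end Integrals

/-! ### Gronwall's inequality for Volterra inequalities normalized at the right end -/

/-- With `N' = m`, the integrand is the derivative of `-exp(-2N)/2`, a monotone function bounded
above by `0`. Its limit at infinity exists and gives both integrability and the bound. -/
theorem integral_mul_exp_neg_le {m : ℝ → ℝ} (hm : Continuous m) (h0 : ∀ y, 0 ≤ m y) (y : ℝ) :
    IntegrableOn (fun x => m x * Real.exp (-2 * ∫ t in (0:ℝ)..x, m t)) (Ici y) ∧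
    ∫ x in Ici y, m x * Real.exp (-2 * ∫ t in (0:ℝ)..x, m t)
      ≤ Real.exp (-2 * ∫ t in (0:ℝ)..y, m t) / 2 := by
  set N : ℝ → ℝ := fun x => ∫ t in (0:ℝ)..x, m t with hN
  have hd : ∀ x, HasDerivAt N (m x) x := fun x =>
    intervalIntegral.integral_hasDerivAt_right (hm.intervalIntegrable _ _)
      (hm.stronglyMeasurableAtFilter _ _) hm.continuousAt
  have hd2 : ∀ x, HasDerivAt (fun x => -(Real.exp (-2 * N x) / 2)) (m x * Real.exp (-2 * N x)) x := by
    intro x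
    have := ((((hd x).const_mul (-2)).exp).div_const 2).neg
    exact this.congr_deriv (by ring)
  have hmono : Monotone (fun x => -(Real.exp (-2 * N x) / 2)) := by
    refine monotone_of_deriv_nonneg (fun x => (hd2 x).differentiableAt) fun x => ?_
    rw [(hd2 x).deriv]; exact mul_nonneg (h0 x) (Real.exp_pos _).le
  have hbdd : BddAbove (range (fun x => -(Real.exp (-2 * N x) / 2))) :=
    ⟨0, by rintro _ ⟨x, rfl⟩; have := Real.exp_pos (-2 * N x); simp only; linarith⟩
  have hlim := tendsto_atTop_ciSup hmono hbdd
  have hle : (⨆ x, -(Real.exp (-2 * N x) / 2)) ≤ 0 :=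
    ciSup_le fun x => by have := Real.exp_pos (-2 * N x); linarith
  have hint := integrableOn_Ioi_deriv_of_nonneg' (a := y) (fun x _ => hd2 x)
    (fun x _ => mul_nonneg (h0 x) (Real.exp_pos _).le) hlim
  refine ⟨(integrableOn_Ici_iff_integrableOn_Ioi).2 hint, ?_⟩
  rw [integral_Ici_eq_integral_Ioi,
    integral_Ioi_of_hasDerivAt_of_tendsto' (fun x _ => hd2 x) hint hlim]
  simp only [hN] at hle ⊢
  linarith

/-- A weight adapted to the integrable majorant `m` on `timeInterval T`. -/
theorem exists_weight (hT : 0 < T) {m : ℝ → ℝ} (hc : ContinuousOn m (timeInterval T))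
    (h0 : ∀ y ∈ timeInterval T, 0 ≤ m y) (hi : IntegrableOn m (timeInterval T)) :
    ∃ N : ℝ → ℝ, Continuous N ∧ (∀ y ∈ timeInterval T, 0 ≤ N y) ∧
      (∀ y ∈ timeInterval T, N y ≤ ∫ x in timeInterval T, m x) ∧
      (∀ y ∈ timeInterval T, ∀ z ∈ timeInterval T, y ≤ z → N y ≤ N z) ∧
      (∀ y ∈ timeInterval T,
        IntegrableOn (fun x => m x * Real.exp (-2 * N x)) (timeInterval T ∩ Ici y)) ∧
      ∀ y ∈ timeInterval T, ∫ x in timeInterval T ∩ Ici y, m x * Real.exp (-2 * N x)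
        ≤ Real.exp (-2 * N y) / 2 := by
  obtain ⟨p, hp, hpJ, hpid⟩ := exists_retraction_timeInterval hT
  have hJ := measurableSet_timeInterval hT
  have hcp : Continuous (fun x => m (p x)) := hc.comp_continuous hp hpJ
  have hnn : ∀ x, 0 ≤ m (p x) := fun x => h0 _ (hpJ x)
  have hJ0 := zero_mem_timeInterval hT
  have hsub : ∀ y, timeInterval T ∩ Ici y ⊆ Ici y := fun y => inter_subset_right
  have hmeas : ∀ y, MeasurableSet (timeInterval T ∩ Ici y) := fun y => hJ.inter measurableSet_Ici
  have heq : ∀ y, EqOn (fun x => m (p x) * Real.exp (-2 * ∫ t in (0:ℝ)..x, m (p t)))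
      (fun x => m x * Real.exp (-2 * ∫ t in (0:ℝ)..x, m (p t))) (timeInterval T ∩ Ici y) :=
    fun y x hx => by simp only [hpid x hx.1]
  -- The weight is the primitive of the extension `m ∘ p`; on the interval it agrees with the
  -- primitive of `m`.
  refine ⟨fun y => ∫ x in (0:ℝ)..y, m (p x), ?_, ?_, ?_, ?_, ?_, ?_⟩
  · exact intervalIntegral.continuous_primitive (fun a b => hcp.intervalIntegrable a b) 0
  · exact fun y hy => intervalIntegral.integral_nonneg hy.1 fun x _ => hnn x
  · intro y hy
    beta_reduce
    rw [intervalIntegral.integral_of_le hy.1]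
    have hs : Ioc 0 y ⊆ timeInterval T := fun x hx => mem_timeInterval_of_le hy hx.1.le hx.2
    rw [setIntegral_congr_fun measurableSet_Ioc (g := m) fun x hx => by simp only [hpid x (hs hx)]]
    exact setIntegral_mono_set hi ((ae_restrict_iff' hJ).2 (ae_of_all _ h0))
      (LE.le.eventuallyLE hs)
  · intro y _ z _ hyz
    beta_reduce
    rw [← intervalIntegral.integral_add_adjacent_intervals (hcp.intervalIntegrable 0 y)
      (hcp.intervalIntegrable y z)]
    have := intervalIntegral.integral_nonneg (μ := volume) hyz fun x _ => hnn x
    linarith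
  · intro y _
    exact ((integral_mul_exp_neg_le hcp hnn y).1.mono_set (hsub y)).congr_fun (heq y) (hmeas y)
  · intro y _
    rw [← setIntegral_congr_fun (hmeas y) (heq y)]
    refine le_trans (setIntegral_mono_set (integral_mul_exp_neg_le hcp hnn y).1 ?_
      (LE.le.eventuallyLE (hsub y))) (integral_mul_exp_neg_le hcp hnn y).2
    exact ae_of_all _ fun x => mul_nonneg (hnn x) (Real.exp_pos _).le

/-- Let `D` be the supremum of `d exp(2N)`, finite because `d` is bounded. Inserting `d ≤ D
exp(-2N)` in the integral costs only `D exp(-2N)/2`, so `D ≤ ε exp(2M) + D/2`, and the last term is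
absorbed. -/
theorem volterra_gronwall (hT : 0 < T) {m : ℝ → ℝ} (hc : ContinuousOn m (timeInterval T))
    (h0 : ∀ y ∈ timeInterval T, 0 ≤ m y) (hi : IntegrableOn m (timeInterval T))
    {d : ℝ → ℝ} (hd0 : ∀ y ∈ timeInterval T, 0 ≤ d y)
    {C : ℝ} (hdC : ∀ y ∈ timeInterval T, d y ≤ C) {ε : ℝ} (hε : 0 ≤ ε)
    (h : ∀ y ∈ timeInterval T, d y ≤ ε + ∫ x in timeInterval T ∩ Ici y, m x * d x) :
    ∀ y ∈ timeInterval T, d y ≤ 2 * ε * Real.exp (2 * ∫ x in timeInterval T, m x) := by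
  obtain ⟨N, -, hN0, hNM, -, hNi, hNint⟩ := exists_weight hT hc h0 hi
  set M := ∫ x in timeInterval T, m x
  have hJ := measurableSet_timeInterval hT
  set A : Set ℝ := (fun y => d y * Real.exp (2 * N y)) '' timeInterval T
  have hA : BddAbove A := by
    refine ⟨C * Real.exp (2 * M), ?_⟩
    rintro _ ⟨y, hy, rfl⟩
    have := hNM y hy
    have h1 := hd0 y hy
    have h2 := hdC y hy
    exact mul_le_mul h2 (Real.exp_le_exp.2 (by linarith)) (Real.exp_pos _).le (h1.trans h2)
  have hne : A.Nonempty := ⟨_, 0, zero_mem_timeInterval hT, rfl⟩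
  set D := sSup A
  have hD : ∀ y ∈ timeInterval T, d y ≤ D * Real.exp (-2 * N y) := by
    intro y hy
    have h1 : d y * Real.exp (2 * N y) ≤ D := le_csSup hA ⟨y, hy, rfl⟩
    have h2 : d y = d y * Real.exp (2 * N y) * Real.exp (-2 * N y) := by
      rw [mul_assoc, ← Real.exp_add]; simp
    rw [h2]; gcongr
  have hD0 : 0 ≤ D := by
    have h1 := hD 0 (zero_mem_timeInterval hT)
    have h2 := hd0 0 (zero_mem_timeInterval hT)
    exact nonneg_of_mul_nonneg_left (h2.trans h1) (Real.exp_pos _)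
  have key : D ≤ ε * Real.exp (2 * M) + D / 2 := by
    refine csSup_le hne ?_
    rintro _ ⟨y, hy, rfl⟩
    have h1 : ∫ x in timeInterval T ∩ Ici y, m x * d x ≤ D * (Real.exp (-2 * N y) / 2) := by
      calc ∫ x in timeInterval T ∩ Ici y, m x * d x
          ≤ ∫ x in timeInterval T ∩ Ici y, D * (m x * Real.exp (-2 * N x)) := by
            refine integral_mono_of_nonneg ?_ ((hNi y hy).const_mul D) ?_
            · exact (ae_restrict_iff' (hJ.inter measurableSet_Ici)).2
                (ae_of_all _ fun x hx => mul_nonneg (h0 x hx.1) (hd0 x hx.1))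
            · refine (ae_restrict_iff' (hJ.inter measurableSet_Ici)).2
                (ae_of_all _ fun x hx => ?_)
              have := mul_le_mul_of_nonneg_left (hD x hx.1) (h0 x hx.1)
              simp only; linarith
        _ = D * ∫ x in timeInterval T ∩ Ici y, m x * Real.exp (-2 * N x) :=
            integral_const_mul _ _
        _ ≤ _ := mul_le_mul_of_nonneg_left (hNint y hy) hD0
    have h2 := h y hy
    have h3 : Real.exp (-2 * N y) * Real.exp (2 * N y) = 1 := by rw [← Real.exp_add]; simp
    have h4 : Real.exp (2 * N y) ≤ Real.exp (2 * M) := by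
      have := hNM y hy
      exact Real.exp_le_exp.2 (by linarith)
    calc d y * Real.exp (2 * N y)
        ≤ (ε + D * (Real.exp (-2 * N y) / 2)) * Real.exp (2 * N y) := by gcongr; linarith
      _ = ε * Real.exp (2 * N y) + D / 2 * (Real.exp (-2 * N y) * Real.exp (2 * N y)) := by ring
      _ ≤ _ := by rw [h3, mul_one]; gcongr
  intro y hy
  have h1 := hD y hy
  have h2 : Real.exp (-2 * N y) ≤ 1 := Real.exp_le_one_iff.2 (by linarith [hN0 y hy])
  calc d y ≤ D * Real.exp (-2 * N y) := h1
    _ ≤ D := mul_le_of_le_one_right hD0 h2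
    _ ≤ _ := by linarith

end

section

/-! ### Abstract Volterra equations -/

variable {T : EReal} {E : Type*} [NormedAddCommGroup E] [NormedSpace ℂ E]

/-- A continuous integrable majorant on `timeInterval T`. -/
structure IsMajorant (T : EReal) (m : ℝ → ℝ) : Prop where
  continuousOn : ContinuousOn m (timeInterval T)
  nonneg : ∀ y ∈ timeInterval T, 0 ≤ m y
  integrableOn : IntegrableOn m (timeInterval T)

theorem IsMajorant.const_mul {m : ℝ → ℝ} (hm : IsMajorant T m) {c : ℝ} (hc : 0 ≤ c) :
    IsMajorant T fun y => c * m y :=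
  ⟨continuousOn_const.mul hm.continuousOn, fun y hy => mul_nonneg hc (hm.nonneg y hy),
    hm.integrableOn.const_mul c⟩

/-- A continuous Volterra kernel dominated by `m`. -/
structure IsVolterraKernel (T : EReal) (m : ℝ → ℝ) (G : ℝ → ℝ → E →L[ℂ] E) : Prop where
  continuousOn : ContinuousOn (fun q : ℝ × ℝ => G q.1 q.2) (timeInterval T ×ˢ timeInterval T)
  bound : ∀ y ∈ timeInterval T, ∀ x ∈ timeInterval T, y ≤ x → ‖G y x‖ ≤ m x

/-- The Volterra operator with kernel `G`. -/
def volterraOp (T : EReal) (G : ℝ → ℝ → E →L[ℂ] E) (ψ : ℝ → E) (y : ℝ) : E :=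
  ∫ x in timeInterval T ∩ Ici y, G y x (ψ x)

/-- `ψ` is a bounded continuous solution of `ψ = f - ∫ G ψ`. -/
structure IsVolterraSol (T : EReal) (G : ℝ → ℝ → E →L[ℂ] E) (f ψ : ℝ → E) : Prop where
  continuousOn : ContinuousOn ψ (timeInterval T)
  bounded : ∃ C, ∀ y ∈ timeInterval T, ‖ψ y‖ ≤ C
  eqn : ∀ y ∈ timeInterval T, ψ y = f y - volterraOp T G ψ y

variable {m : ℝ → ℝ} {G : ℝ → ℝ → E →L[ℂ] E}

theorem IsVolterraKernel.continuousOn_right (hG : IsVolterraKernel T m G) {y : ℝ}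
    (hy : y ∈ timeInterval T) : ContinuousOn (G y) (timeInterval T) :=
  hG.continuousOn.comp (f := fun x => (y, x)) (by fun_prop) fun _ hx => ⟨hy, hx⟩

theorem IsVolterraKernel.continuousOn_left (hG : IsVolterraKernel T m G) {x : ℝ}
    (hx : x ∈ timeInterval T) : ContinuousOn (fun y => G y x) (timeInterval T) :=
  hG.continuousOn.comp (f := fun y => (y, x)) (by fun_prop) fun _ hy => ⟨hy, hx⟩

theorem IsVolterraKernel.aestronglyMeasurable (hT : 0 < T) (hG : IsVolterraKernel T m G)
    {ψ : ℝ → E} (hψ : ContinuousOn ψ (timeInterval T)) {y : ℝ} (hy : y ∈ timeInterval T) :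
    AEStronglyMeasurable (fun x => G y x (ψ x)) (volume.restrict (timeInterval T)) :=
  ((hG.continuousOn_right hy).clm_apply hψ).aestronglyMeasurable (measurableSet_timeInterval hT)

theorem norm_apply_le_of_bound (hG : IsVolterraKernel T m G)
    {ψ : ℝ → E} {C : ℝ} (hC : ∀ x ∈ timeInterval T, ‖ψ x‖ ≤ C)
    {y x : ℝ} (hy : y ∈ timeInterval T) (hx : x ∈ timeInterval T) (hyx : y ≤ x) :
    ‖G y x (ψ x)‖ ≤ m x * C :=
  ((G y x).le_opNorm _).trans (mul_le_mul (hG.bound y hy x hx hyx) (hC x hx) (norm_nonneg _)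
    ((norm_nonneg _).trans (hG.bound y hy x hx hyx)))

theorem IsVolterraKernel.integrableOn (hT : 0 < T) (hm : IsMajorant T m)
    (hG : IsVolterraKernel T m G) {ψ : ℝ → E} (hψ : ContinuousOn ψ (timeInterval T))
    (hb : ∃ C, ∀ x ∈ timeInterval T, ‖ψ x‖ ≤ C) {y : ℝ} (hy : y ∈ timeInterval T) :
    IntegrableOn (fun x => G y x (ψ x)) (timeInterval T ∩ Ici y) := by
  obtain ⟨C, hC⟩ := hb
  refine Integrable.mono' ((hm.integrableOn.mono_set inter_subset_left).mul_const C)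
    ((hG.aestronglyMeasurable hT hψ hy).mono_set inter_subset_left) ?_
  exact (ae_restrict_iff' ((measurableSet_timeInterval hT).inter measurableSet_Ici)).2
    (ae_of_all _ fun x hx => norm_apply_le_of_bound hG hC hy hx.1 hx.2)

theorem IsMajorant.tail_le (hT : 0 < T) (hm : IsMajorant T m) (y : ℝ) :
    ∫ x in timeInterval T ∩ Ici y, m x ≤ ∫ x in timeInterval T, m x :=
  setIntegral_mono_set hm.integrableOn ((ae_restrict_iff' (measurableSet_timeInterval hT)).2
    (ae_of_all _ hm.nonneg)) (LE.le.eventuallyLE inter_subset_left)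

theorem norm_setIntegral_inter_le (hT : 0 < T) {y : ℝ} {g : ℝ → ℝ}
    (hg : IntegrableOn g (timeInterval T)) {f : ℝ → E}
    (h : ∀ x ∈ timeInterval T, y ≤ x → ‖f x‖ ≤ g x) :
    ‖∫ x in timeInterval T ∩ Ici y, f x‖ ≤ ∫ x in timeInterval T ∩ Ici y, g x :=
  norm_integral_le_of_norm_le (hg.mono_set inter_subset_left)
    ((ae_restrict_iff' ((measurableSet_timeInterval hT).inter measurableSet_Ici)).2
      (ae_of_all _ fun x hx => h x hx.1 hx.2))

theorem norm_volterraOp_le (hT : 0 < T) (hm : IsMajorant T m) (hG : IsVolterraKernel T m G)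
    {ψ : ℝ → E} {C : ℝ} (hC : ∀ x ∈ timeInterval T, ‖ψ x‖ ≤ C)
    {y : ℝ} (hy : y ∈ timeInterval T) :
    ‖volterraOp T G ψ y‖ ≤ (∫ x in timeInterval T ∩ Ici y, m x) * C := by
  rw [← integral_mul_const]
  exact norm_setIntegral_inter_le hT (hm.integrableOn.mul_const C)
    fun x hx hyx => norm_apply_le_of_bound hG hC hy hx hyx

theorem norm_volterraOp_le' (hT : 0 < T) (hm : IsMajorant T m) (hG : IsVolterraKernel T m G)
    {ψ : ℝ → E} {C : ℝ} (hC : ∀ x ∈ timeInterval T, ‖ψ x‖ ≤ C)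
    {y : ℝ} (hy : y ∈ timeInterval T) :
    ‖volterraOp T G ψ y‖ ≤ (∫ x in timeInterval T, m x) * C :=
  (norm_volterraOp_le hT hm hG hC hy).trans (mul_le_mul_of_nonneg_right (hm.tail_le hT y)
    ((norm_nonneg _).trans (hC y hy)))

/-- Dominated convergence after writing the tail with the indicator of `Ici y`: for fixed `x ≠ y₀`
the integrand is continuous at `y₀`, and the jump at `x = y₀` concerns a null set. -/
theorem continuousOn_volterraOp (hT : 0 < T) (hm : IsMajorant T m) (hG : IsVolterraKernel T m G)
    {ψ : ℝ → E} (hψ : ContinuousOn ψ (timeInterval T))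
    (hb : ∃ C, ∀ x ∈ timeInterval T, ‖ψ x‖ ≤ C) :
    ContinuousOn (volterraOp T G ψ) (timeInterval T) := by
  obtain ⟨C, hC⟩ := hb
  have hJ := measurableSet_timeInterval hT
  intro y₀ hy₀
  have hrw : ∀ y, volterraOp T G ψ y
      = ∫ x in timeInterval T, (Ici y).indicator (fun x => G y x (ψ x)) x := fun y => by
    rw [setIntegral_indicator measurableSet_Ici]; rfl
  refine ContinuousWithinAt.congr ?_ (fun y _ => hrw y) (hrw y₀)
  refine continuousWithinAt_of_dominated (bound := fun x => m x * C) ?_ ?_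
    (hm.integrableOn.mul_const C) ?_
  · filter_upwards [self_mem_nhdsWithin] with y hy
    exact (hG.aestronglyMeasurable hT hψ hy).indicator measurableSet_Ici
  · filter_upwards [self_mem_nhdsWithin] with y hy
    refine (ae_restrict_iff' hJ).2 (ae_of_all _ fun x hx => ?_)
    by_cases hyx : y ≤ x
    · rw [indicator_of_mem (mem_Ici.2 hyx)]
      exact norm_apply_le_of_bound hG hC hy hx hyx
    · rw [indicator_of_notMem (by simpa using hyx), norm_zero]
      exact mul_nonneg (hm.nonneg x hx) ((norm_nonneg _).trans (hC x hx))
  · refine (ae_restrict_iff' hJ).2 ?_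
    filter_upwards [compl_mem_ae_iff.2 (measure_singleton y₀)] with x hx hxJ
    rcases lt_or_gt_of_ne (show x ≠ y₀ from hx) with h | h
    · refine (continuousWithinAt_const (b := (0 : E))).congr_of_eventuallyEq ?_ ?_
      · filter_upwards [mem_nhdsWithin_of_mem_nhds (lt_mem_nhds h)] with y hy
        exact indicator_of_notMem (by simpa using hy) _
      · exact indicator_of_notMem (by simpa using h) _
    · refine (((hG.continuousOn_left hxJ) y₀ hy₀).clm_apply
        (continuousWithinAt_const (b := ψ x))).congr_of_eventuallyEq ?_ ?_
      · filter_upwards [mem_nhdsWithin_of_mem_nhds (gt_mem_nhds h)] with y hy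
        exact indicator_of_mem (mem_Ici.2 hy.le) _
      · exact indicator_of_mem (mem_Ici.2 h.le) _

/-- The basic a priori estimate. Its constant depends on the kernel only through `∫ m`, hence is
uniform over a family of kernels with a common majorant. -/
theorem IsVolterraSol.norm_le (hT : 0 < T) (hm : IsMajorant T m) (hG : IsVolterraKernel T m G)
    {f ψ : ℝ → E} (h : IsVolterraSol T G f ψ) {ε : ℝ} (hf : ∀ y ∈ timeInterval T, ‖f y‖ ≤ ε) :
    ∀ y ∈ timeInterval T, ‖ψ y‖ ≤ 2 * ε * Real.exp (2 * ∫ x in timeInterval T, m x) := by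
  obtain ⟨C, hC⟩ := h.bounded
  have hJ0 := zero_mem_timeInterval hT
  refine volterra_gronwall hT hm.continuousOn hm.nonneg hm.integrableOn
    (d := fun y => ‖ψ y‖) (fun _ _ => norm_nonneg _) hC
    ((norm_nonneg _).trans (hf 0 hJ0)) fun y hy => ?_
  have hi : IntegrableOn (fun x => m x * ‖ψ x‖) (timeInterval T) := by
    refine Integrable.mono' (hm.integrableOn.mul_const C)
      ((hm.continuousOn.mul h.continuousOn.norm).aestronglyMeasurable
        (measurableSet_timeInterval hT)) ?_
    refine (ae_restrict_iff' (measurableSet_timeInterval hT)).2 (ae_of_all _ fun x hx => ?_)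
    rw [norm_mul, norm_norm, Real.norm_of_nonneg (hm.nonneg x hx)]
    exact mul_le_mul_of_nonneg_left (hC x hx) (hm.nonneg x hx)
  rw [h.eqn y hy]
  refine (norm_sub_le _ _).trans (add_le_add (hf y hy) ?_)
  exact norm_setIntegral_inter_le hT hi fun x hx hyx =>
    ((G y x).le_opNorm _).trans (mul_le_mul_of_nonneg_right (hG.bound y hy x hx hyx)
      (norm_nonneg _))

theorem volterraOp_sub (hT : 0 < T) (hm : IsMajorant T m) (hG : IsVolterraKernel T m G)
    {ψ φ : ℝ → E} (hψ : ContinuousOn ψ (timeInterval T))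
    (hbψ : ∃ C, ∀ x ∈ timeInterval T, ‖ψ x‖ ≤ C) (hφ : ContinuousOn φ (timeInterval T))
    (hbφ : ∃ C, ∀ x ∈ timeInterval T, ‖φ x‖ ≤ C) {y : ℝ} (hy : y ∈ timeInterval T) :
    volterraOp T G (ψ - φ) y = volterraOp T G ψ y - volterraOp T G φ y := by
  rw [volterraOp, volterraOp, volterraOp, ← integral_sub (hG.integrableOn hT hm hψ hbψ hy)
    (hG.integrableOn hT hm hφ hbφ hy)]
  simp

theorem IsVolterraSol.sub (hT : 0 < T) (hm : IsMajorant T m) (hG : IsVolterraKernel T m G)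
    {f g ψ φ : ℝ → E} (h : IsVolterraSol T G f ψ) (h' : IsVolterraSol T G g φ) :
    IsVolterraSol T G (f - g) (ψ - φ) := by
  refine ⟨h.continuousOn.sub h'.continuousOn, ?_, fun y hy => ?_⟩
  · obtain ⟨C, hC⟩ := h.bounded
    obtain ⟨C', hC'⟩ := h'.bounded
    exact ⟨C + C', fun y hy => (norm_sub_le _ _).trans (add_le_add (hC y hy) (hC' y hy))⟩
  · rw [volterraOp_sub hT hm hG h.continuousOn h.bounded h'.continuousOn h'.bounded hy,
      Pi.sub_apply, Pi.sub_apply, h.eqn y hy, h'.eqn y hy]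
    abel

theorem IsVolterraSol.const_smul {f ψ : ℝ → E} (h : IsVolterraSol T G f ψ) (c : ℂ) :
    IsVolterraSol T G (c • f) (c • ψ) := by
  refine ⟨h.continuousOn.const_smul c, ?_, fun y hy => ?_⟩
  · obtain ⟨C, hC⟩ := h.bounded
    exact ⟨‖c‖ * C, fun y hy => by
      rw [Pi.smul_apply, norm_smul]; exact mul_le_mul_of_nonneg_left (hC y hy) (norm_nonneg _)⟩
  · simp only [volterraOp, Pi.smul_apply, map_smul]
    rw [integral_smul, h.eqn y hy, smul_sub]; rfl

/-- A solution for one kernel solves the equation for another kernel, with a different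
inhomogeneity. -/
theorem IsVolterraSol.change_kernel {f ψ : ℝ → E} (h : IsVolterraSol T G f ψ)
    (G' : ℝ → ℝ → E →L[ℂ] E) :
    IsVolterraSol T G' (fun y => f y - volterraOp T G ψ y + volterraOp T G' ψ y) ψ :=
  ⟨h.continuousOn, h.bounded, fun y hy => by rw [h.eqn y hy]; abel⟩

theorem IsVolterraSol.unique (hT : 0 < T) (hm : IsMajorant T m) (hG : IsVolterraKernel T m G)
    {f ψ φ : ℝ → E} (h : IsVolterraSol T G f ψ) (h' : IsVolterraSol T G f φ) :
    EqOn ψ φ (timeInterval T) := fun y hy => by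
  have := (h.sub hT hm hG h').norm_le hT hm hG (ε := 0) (by simp) y hy
  simpa [sub_eq_zero] using this

/-- Conjugation by `exp(2N)` replaces `G` by `K(y,x) = exp(2N(y) - 2N(x)) G(y,x)`, whose Volterra
operator has norm at most `1/2` on bounded functions whatever the size of `∫ m`. Banach's fixed
point theorem applies, and the fixed point is multiplied back by `exp(-2N)`. -/
theorem exists_volterraSol [CompleteSpace E] (hT : 0 < T) (hm : IsMajorant T m)
    (hG : IsVolterraKernel T m G)
    {f : ℝ → E} (hf : ContinuousOn f (timeInterval T))
    (hb : ∃ C, ∀ y ∈ timeInterval T, ‖f y‖ ≤ C) : ∃ ψ, IsVolterraSol T G f ψ := by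
  obtain ⟨N, hNc, hN0, hNM, hNmono, hNi, hNint⟩ :=
    exists_weight hT hm.continuousOn hm.nonneg hm.integrableOn
  obtain ⟨p, hp, hpJ, hpid⟩ := exists_retraction_timeInterval hT
  obtain ⟨C, hC⟩ := hb
  have hJ := measurableSet_timeInterval hT
  set M := ∫ x in timeInterval T, m x
  set K : ℝ → ℝ → E →L[ℂ] E := fun y x => Real.exp (2 * N y - 2 * N x) • G y x with hKdef
  have hK : IsVolterraKernel T m K := by
    have hce : Continuous fun q : ℝ × ℝ => Real.exp (2 * N q.1 - 2 * N q.2) := by fun_prop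
    refine ⟨hce.continuousOn.smul hG.continuousOn, fun y hy x hx hyx => ?_⟩
    rw [norm_smul, Real.norm_of_nonneg (Real.exp_pos _).le]
    refine le_trans (mul_le_of_le_one_left (norm_nonneg _) ?_) (hG.bound y hy x hx hyx)
    exact Real.exp_le_one_iff.2 (by linarith [hNmono y hy x hx hyx])
  have hcf : Continuous fun y => Real.exp (2 * N (p y)) • f (p y) :=
    (show Continuous fun y => Real.exp (2 * N (p y)) by fun_prop).smul (hf.comp_continuous hp hpJ)
  have hbd : ∀ φ : BoundedContinuousFunction ℝ E, ∃ C, ∀ x ∈ timeInterval T, ‖φ x‖ ≤ C :=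
    fun φ => ⟨‖φ‖, fun x _ => φ.norm_coe_le_norm x⟩
  -- Evaluating at `p y` makes the image a bounded continuous function on all of `ℝ`; at the points
  -- of the interval `p y = y`.
  let Φ : BoundedContinuousFunction ℝ E → BoundedContinuousFunction ℝ E := fun φ =>
    BoundedContinuousFunction.ofNormedAddCommGroup
      (fun y => Real.exp (2 * N (p y)) • f (p y) - volterraOp T K φ (p y))
      (hcf.sub ((continuousOn_volterraOp hT hm hK φ.continuous.continuousOn
        (hbd φ)).comp_continuous hp hpJ))
      (Real.exp (2 * M) * C + M * ‖φ‖) (fun y => by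
        refine (norm_sub_le _ _).trans (add_le_add ?_ ?_)
        · rw [norm_smul, Real.norm_of_nonneg (Real.exp_pos _).le]
          have h1 := hC _ (hpJ y)
          have h2 := hNM _ (hpJ y)
          exact mul_le_mul (Real.exp_le_exp.2 (by linarith)) h1 (norm_nonneg _) (Real.exp_pos _).le
        · exact norm_volterraOp_le' hT hm hK (fun x _ => φ.norm_coe_le_norm x) (hpJ y))
  have hΦ : ContractingWith (1 / 2) Φ := by
    refine ⟨by norm_num, LipschitzWith.of_dist_le_mul fun φ χ => ?_⟩
    rw [BoundedContinuousFunction.dist_le (by positivity)]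
    intro y
    set z := p y
    have hz : z ∈ timeInterval T := hpJ y
    have h1 : Φ φ y - Φ χ y = -volterraOp T K (φ - χ : BoundedContinuousFunction ℝ E) z := by
      rw [BoundedContinuousFunction.coe_sub, volterraOp_sub hT hm hK φ.continuous.continuousOn
        (hbd φ) χ.continuous.continuousOn (hbd χ) hz]
      change (Real.exp (2 * N z) • f z - volterraOp T K φ z)
        - (Real.exp (2 * N z) • f z - volterraOp T K χ z) = _
      abel
    rw [dist_eq_norm, h1, norm_neg]
    have hi2 : IntegrableOn (fun x => Real.exp (2 * N z) * (m x * Real.exp (-2 * N x)) * ‖φ - χ‖)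
        (timeInterval T ∩ Ici z) := ((hNi z hz).const_mul _).mul_const _
    calc ‖volterraOp T K (φ - χ : BoundedContinuousFunction ℝ E) z‖
        ≤ ∫ x in timeInterval T ∩ Ici z,
            Real.exp (2 * N z) * (m x * Real.exp (-2 * N x)) * ‖φ - χ‖ := by
          refine norm_integral_le_of_norm_le hi2
            ((ae_restrict_iff' (hJ.inter measurableSet_Ici)).2 (ae_of_all _ fun x hx => ?_))
          have h2 : Real.exp (2 * N z) * (m x * Real.exp (-2 * N x))
              = Real.exp (2 * N z - 2 * N x) * m x := by
            rw [sub_eq_add_neg, Real.exp_add]; ring_nf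
          rw [h2]
          refine ((K z x).le_opNorm _).trans (mul_le_mul ?_
            (BoundedContinuousFunction.norm_coe_le_norm _ x) (norm_nonneg _)
            (mul_nonneg (Real.exp_pos _).le (hm.nonneg x hx.1)))
          rw [hKdef]
          simp only [norm_smul, Real.norm_of_nonneg (Real.exp_pos _).le]
          exact mul_le_mul_of_nonneg_left (hG.bound z hz x hx.1 hx.2) (Real.exp_pos _).le
      _ = Real.exp (2 * N z) * (∫ x in timeInterval T ∩ Ici z, m x * Real.exp (-2 * N x))
            * ‖φ - χ‖ := by rw [integral_mul_const, integral_const_mul]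
      _ ≤ Real.exp (2 * N z) * (Real.exp (-2 * N z) / 2) * ‖φ - χ‖ := by
          gcongr; exact hNint z hz
      _ = ((1 / 2 : NNReal) : ℝ) * dist φ χ := by
          rw [dist_eq_norm, ← mul_div_assoc, ← Real.exp_add]; simp
  set φ := hΦ.fixedPoint
  have hfix : Φ φ = φ := hΦ.fixedPoint_isFixedPt
  refine ⟨fun y => Real.exp (-(2 * N y)) • φ y, ?_, ⟨‖φ‖, fun y hy => ?_⟩, fun y hy => ?_⟩
  · exact ((show Continuous fun y => Real.exp (-(2 * N y)) by fun_prop).smul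
      φ.continuous).continuousOn
  · rw [norm_smul, Real.norm_of_nonneg (Real.exp_pos _).le]
    exact (mul_le_of_le_one_left (norm_nonneg _)
      (Real.exp_le_one_iff.2 (by linarith [hN0 y hy]))).trans (φ.norm_coe_le_norm y)
  · have h1 : φ y = Real.exp (2 * N y) • f y - volterraOp T K φ y := by
      conv_lhs => rw [← hfix]
      change Real.exp (2 * N (p y)) • f (p y) - volterraOp T K φ (p y) = _
      rw [hpid y hy]
    have h2 : volterraOp T G (fun y => Real.exp (-(2 * N y)) • φ y) y
        = Real.exp (-(2 * N y)) • volterraOp T K φ y := by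
      rw [volterraOp, volterraOp, ← integral_smul]
      congr 1
      ext x
      simp only [hKdef, smul_apply]
      rw [smul_smul, ← Real.exp_add, ContinuousLinearMap.map_smul_of_tower]
      congr 2; ring
    rw [h1, h2, smul_sub, smul_smul, ← Real.exp_add]
    simp

end

section

/-! ### Dependence on a parameter -/

/-- The Schwarz lemma, for a map into the ball of radius `2B` about `f c`. -/
theorem norm_dslope_le {F : Type*} [NormedAddCommGroup F] [NormedSpace ℂ F]
    {f : ℂ → F} {c : ℂ} {r B : ℝ} (hd : DifferentiableOn ℂ f (Metric.ball c r)) (hr : 0 < r)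
    (hB : ∀ z ∈ Metric.ball c r, ‖f z‖ ≤ B) {z : ℂ} (hz : z ∈ Metric.ball c r) :
    ‖dslope f c z‖ ≤ 2 * B / r := by
  refine Complex.norm_dslope_le_div_of_mapsTo_ball hd (fun w hw => ?_) hz
  rw [Metric.mem_closedBall, dist_eq_norm]
  refine (norm_sub_le _ _).trans ?_
  linarith [hB w hw, hB c (Metric.mem_ball_self hr)]

/-- The second-order remainder is `(z - c)²` times an iterated difference quotient, so the Schwarz
bound is applied twice. -/
theorem norm_sub_sub_smul_deriv_le {F : Type*} [NormedAddCommGroup F] [NormedSpace ℂ F]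
    [CompleteSpace F] {f : ℂ → F} {c : ℂ} {r B : ℝ}
    (hd : DifferentiableOn ℂ f (Metric.ball c r)) (hr : 0 < r)
    (hB : ∀ z ∈ Metric.ball c r, ‖f z‖ ≤ B) {z : ℂ} (hz : z ∈ Metric.ball c r) :
    ‖f z - f c - (z - c) • deriv f c‖ ≤ ‖z - c‖ ^ 2 * (2 * (2 * B / r) / r) := by
  have hd' : DifferentiableOn ℂ (dslope f c) (Metric.ball c r) :=
    (Complex.differentiableOn_dslope (Metric.ball_mem_nhds c hr)).2 hd
  have h1 := norm_dslope_le hd' hr (fun w hw => norm_dslope_le hd hr hB hw) hz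
  have h2 : f z - f c - (z - c) • deriv f c
      = (z - c) • (z - c) • dslope (dslope f c) c z := by
    rw [sub_smul_dslope, smul_sub, sub_smul_dslope, dslope_same]
  rw [h2, smul_smul, norm_smul, norm_mul, ← sq]
  gcongr

/-- Mean value inequality on the convex half-plane `Re z ≤ 0`, where `|exp| ≤ 1`. -/
theorem norm_exp_sub_exp_le {a b : ℂ} (ha : a.re ≤ 0) (hb : b.re ≤ 0) :
    ‖Complex.exp a - Complex.exp b‖ ≤ ‖a - b‖ := by
  have hconv : Convex ℝ {z : ℂ | z.re ≤ 0} := convex_halfSpace_re_le 0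
  have := hconv.norm_image_sub_le_of_norm_hasDerivWithin_le (f := Complex.exp) (f' := Complex.exp)
    (C := 1) (fun z _ => (Complex.hasDerivAt_exp z).hasDerivWithinAt)
    (fun z hz => by rw [Complex.norm_exp]; exact Real.exp_le_one_iff.2 hz) hb ha
  simpa using this

variable {T : EReal} {E : Type*} [NormedAddCommGroup E] [NormedSpace ℂ E]
  {m : ℝ → ℝ} {G : ℂ → ℝ → ℝ → E →L[ℂ] E} {W : Set ℂ} {f : ℝ → E} {ψ : ℂ → ℝ → E}

theorem volterraOp_sub_kernel (hT : 0 < T) (hm : IsMajorant T m) {G G' : ℝ → ℝ → E →L[ℂ] E}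
    (hG : IsVolterraKernel T m G) (hG' : IsVolterraKernel T m G')
    {ψ : ℝ → E} (hψ : ContinuousOn ψ (timeInterval T))
    (hbψ : ∃ C, ∀ x ∈ timeInterval T, ‖ψ x‖ ≤ C) {y : ℝ} (hy : y ∈ timeInterval T) :
    volterraOp T G ψ y - volterraOp T G' ψ y
      = ∫ x in timeInterval T ∩ Ici y, (G y x - G' y x) (ψ x) := by
  rw [volterraOp, volterraOp, ← integral_sub (hG.integrableOn hT hm hψ hbψ hy)
    (hG'.integrableOn hT hm hψ hbψ hy)]
  simp

/-- The solution at `k₀` also solves the equation with kernel `G k`, up to an inhomogeneity of size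
`∫ δ k`. The difference of the two solutions is then controlled by the a priori bound, uniformly in
`k`. -/
theorem continuousWithinAt_volterraSol (hT : 0 < T) (hm : IsMajorant T m)
    (hG : ∀ k ∈ W, IsVolterraKernel T m (G k)) (hψ : ∀ k ∈ W, IsVolterraSol T (G k) f (ψ k))
    {k₀ : ℂ} (hk₀ : k₀ ∈ W) {δ : ℂ → ℝ → ℝ}
    (hδi : ∀ k ∈ W, IntegrableOn (δ k) (timeInterval T))
    (hδ0 : ∀ k ∈ W, ∀ x ∈ timeInterval T, 0 ≤ δ k x)
    (hδ : ∀ k ∈ W, ∀ y ∈ timeInterval T, ∀ x ∈ timeInterval T, y ≤ x →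
      ‖G k₀ y x - G k y x‖ ≤ δ k x)
    (hlim : Tendsto (fun k => ∫ x in timeInterval T, δ k x) (𝓝[W] k₀) (𝓝 0))
    {y : ℝ} (hy : y ∈ timeInterval T) : ContinuousWithinAt (fun k => ψ k y) W k₀ := by
  have hJ := measurableSet_timeInterval hT
  obtain ⟨C, hC⟩ := (hψ k₀ hk₀).bounded
  have hC0 : 0 ≤ C := (norm_nonneg _).trans (hC y hy)
  have key : ∀ k ∈ W, ‖ψ k y - ψ k₀ y‖
      ≤ 2 * ((∫ x in timeInterval T, δ k x) * C) * Real.exp (2 * ∫ x in timeInterval T, m x) := by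
    intro k hk
    have hs := (hψ k hk).sub hT hm (hG k hk) ((hψ k₀ hk₀).change_kernel (G k))
    refine hs.norm_le hT hm (hG k hk) (fun z hz => ?_) y hy
    have h1 : (f - fun z => f z - volterraOp T (G k₀) (ψ k₀) z + volterraOp T (G k) (ψ k₀) z) z
        = volterraOp T (G k₀) (ψ k₀) z - volterraOp T (G k) (ψ k₀) z := by
      simp only [Pi.sub_apply]; abel
    rw [h1, volterraOp_sub_kernel hT hm (hG k₀ hk₀) (hG k hk) (hψ k₀ hk₀).continuousOn
      (hψ k₀ hk₀).bounded hz]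
    refine (norm_setIntegral_inter_le hT ((hδi k hk).mul_const C) fun x hx hzx =>
      ((G k₀ z x - G k z x).le_opNorm _).trans (mul_le_mul (hδ k hk z hz x hx hzx) (hC x hx)
        (norm_nonneg _) (hδ0 k hk x hx))).trans ?_
    rw [integral_mul_const]
    refine mul_le_mul_of_nonneg_right (setIntegral_mono_set (hδi k hk) ?_
      (LE.le.eventuallyLE inter_subset_left)) hC0
    exact (ae_restrict_iff' hJ).2 (ae_of_all _ (hδ0 k hk))
  rw [ContinuousWithinAt, tendsto_iff_norm_sub_tendsto_zero]
  refine squeeze_zero' (Eventually.of_forall fun _ => norm_nonneg _)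
    (eventually_nhdsWithin_of_forall key) ?_
  simpa using ((hlim.mul_const C).const_mul 2).mul_const
    (Real.exp (2 * ∫ x in timeInterval T, m x))

/-- Formal differentiation of the equation gives a Volterra equation for the candidate derivative
`χ`, with inhomogeneity `-∫ G' ψ₀`. Then `ψ_k - ψ_{k₀} - (k - k₀) χ` solves an equation with
inhomogeneity `O(|k - k₀|²)`. The bound of `G'` comes from the bound of `G` on a disc; hence no
moment condition on `m` is needed, although the derivative of the exponential produces the factor `x
- y`. -/
theorem differentiableAt_volterraSol [CompleteSpace E] (hT : 0 < T) (hm : IsMajorant T m)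
    {k₀ : ℂ} {r : ℝ} (hr : 0 < r)
    (hG : ∀ k ∈ Metric.ball k₀ r, IsVolterraKernel T m (G k))
    (hψ : ∀ k ∈ Metric.ball k₀ r, IsVolterraSol T (G k) f (ψ k))
    (hd : ∀ y x, DifferentiableOn ℂ (fun k => G k y x) (Metric.ball k₀ r))
    (hdc : ContinuousOn (fun q : ℝ × ℝ => deriv (fun k => G k q.1 q.2) k₀)
      (timeInterval T ×ˢ timeInterval T))
    {y : ℝ} (hy : y ∈ timeInterval T) : DifferentiableAt ℂ (fun k => ψ k y) k₀ := by
  have hJ := measurableSet_timeInterval hT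
  have hk₀ : k₀ ∈ Metric.ball k₀ r := Metric.mem_ball_self hr
  set G' : ℝ → ℝ → E →L[ℂ] E := fun y x => deriv (fun k => G k y x) k₀ with hG'def
  have hm' : IsMajorant T (fun x => 2 / r * m x) := hm.const_mul (by positivity)
  have hG' : IsVolterraKernel T (fun x => 2 / r * m x) G' := by
    refine ⟨hdc, fun z hz x hx hzx => ?_⟩
    have := norm_dslope_le (hd z x) hr (fun k hk => (hG k hk).bound z hz x hx hzx) hk₀
    rw [dslope_same] at this
    exact this.trans_eq (by ring)
  set ψ₀ := ψ k₀
  have hψ₀ : IsVolterraSol T (G k₀) f ψ₀ := hψ k₀ hk₀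
  obtain ⟨C, hC⟩ := hψ₀.bounded
  have hC0 : 0 ≤ C := (norm_nonneg _).trans (hC y hy)
  obtain ⟨χ, hχ⟩ := exists_volterraSol hT hm (hG k₀ hk₀)
    (f := fun z => -volterraOp T G' ψ₀ z)
    (continuousOn_volterraOp hT hm' hG' hψ₀.continuousOn hψ₀.bounded).neg
    ⟨_, fun z hz => by rw [norm_neg]; exact norm_volterraOp_le' hT hm' hG' hC hz⟩
  obtain ⟨C', hC'⟩ := hχ.bounded
  have hC'0 : 0 ≤ C' := (norm_nonneg _).trans (hC' y hy)
  set M := ∫ x in timeInterval T, m x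
  have hM : 0 ≤ M := setIntegral_nonneg hJ hm.nonneg
  -- `c₁` bounds the quadratic remainder of the kernel acting on `ψ₀`; `c₂` bounds the first
  -- difference of the kernel acting on `χ`, which has another factor `k - k₀` in front.
  set c₁ : ℝ := 2 * (2 / r) / r * M * C
  set c₂ : ℝ := 2 / r * M * C'
  have key : ∀ k ∈ Metric.ball k₀ r, ‖ψ k y - ψ k₀ y - (k - k₀) • χ y‖
      ≤ 2 * (c₁ + c₂) * Real.exp (2 * M) * ‖k - k₀‖ ^ 2 := by
    intro k hk
    have hs := ((hψ k hk).sub hT hm (hG k hk) (hψ₀.change_kernel (G k))).sub hT hm (hG k hk)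
      ((hχ.change_kernel (G k)).const_smul (k - k₀))
    have hbound : ∀ z ∈ timeInterval T, ‖(f - (fun z => f z - volterraOp T (G k₀) ψ₀ z
        + volterraOp T (G k) ψ₀ z) - (k - k₀) • fun z => -volterraOp T G' ψ₀ z
        - volterraOp T (G k₀) χ z + volterraOp T (G k) χ z) z‖
        ≤ (c₁ + c₂) * ‖k - k₀‖ ^ 2 := by
      intro z hz
      have h1 : (f - (fun z => f z - volterraOp T (G k₀) ψ₀ z
        + volterraOp T (G k) ψ₀ z) - (k - k₀) • fun z => -volterraOp T G' ψ₀ z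
        - volterraOp T (G k₀) χ z + volterraOp T (G k) χ z) z
          = (k - k₀) • (volterraOp T (G k₀) χ z - volterraOp T (G k) χ z)
            - (volterraOp T (G k) ψ₀ z - volterraOp T (G k₀) ψ₀ z
              - (k - k₀) • volterraOp T G' ψ₀ z) := by
        simp only [Pi.sub_apply, Pi.smul_apply, smul_sub, smul_add, smul_neg]; abel
      have h2 : volterraOp T (G k) ψ₀ z - volterraOp T (G k₀) ψ₀ z
              - (k - k₀) • volterraOp T G' ψ₀ z
          = ∫ x in timeInterval T ∩ Ici z, (G k z x - G k₀ z x - (k - k₀) • G' z x) (ψ₀ x) := by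
        rw [volterraOp, volterraOp, volterraOp, ← integral_sub, ← integral_smul, ← integral_sub]
        · simp
        · exact ((hG k hk).integrableOn hT hm hψ₀.continuousOn hψ₀.bounded hz).sub
            ((hG k₀ hk₀).integrableOn hT hm hψ₀.continuousOn hψ₀.bounded hz)
        · exact (hG'.integrableOn hT hm' hψ₀.continuousOn hψ₀.bounded hz).smul (k - k₀)
        · exact (hG k hk).integrableOn hT hm hψ₀.continuousOn hψ₀.bounded hz
        · exact (hG k₀ hk₀).integrableOn hT hm hψ₀.continuousOn hψ₀.bounded hz
      have hbd : ∀ x ∈ timeInterval T, z ≤ x → ∀ w ∈ Metric.ball k₀ r, ‖G w z x‖ ≤ m x :=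
        fun x hx hzx w hw => (hG w hw).bound z hz x hx hzx
      have h3 : ‖volterraOp T (G k₀) χ z - volterraOp T (G k) χ z‖ ≤ ‖k - k₀‖ * c₂ := by
        rw [volterraOp_sub_kernel hT hm (hG k₀ hk₀) (hG k hk) hχ.continuousOn hχ.bounded hz]
        refine (norm_setIntegral_inter_le hT
          (hm.integrableOn.const_mul (‖k - k₀‖ * (2 / r) * C')) fun x hx hzx => ?_).trans ?_
        · have h4 : ‖G k₀ z x - G k z x‖ ≤ ‖k - k₀‖ * (2 * m x / r) := by
            rw [norm_sub_rev]
            have := sub_smul_dslope (fun k => G k z x) k₀ k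
            rw [← this, norm_smul]
            exact mul_le_mul_of_nonneg_left (norm_dslope_le (hd z x) hr (hbd x hx hzx) hk)
              (norm_nonneg _)
          refine ((G k₀ z x - G k z x).le_opNorm _).trans ((mul_le_mul h4 (hC' x hx)
            (norm_nonneg _) ((norm_nonneg _).trans h4)).trans_eq (by ring))
        · rw [integral_const_mul]
          refine (mul_le_mul_of_nonneg_left (hm.tail_le hT z) (by positivity)).trans_eq ?_
          simp only [c₂]; ring
      have h5 : ‖volterraOp T (G k) ψ₀ z - volterraOp T (G k₀) ψ₀ z
              - (k - k₀) • volterraOp T G' ψ₀ z‖ ≤ ‖k - k₀‖ ^ 2 * c₁ := by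
        rw [h2]
        refine (norm_setIntegral_inter_le hT
          (hm.integrableOn.const_mul (‖k - k₀‖ ^ 2 * (2 * (2 / r) / r) * C))
          fun x hx hzx => ?_).trans ?_
        · have h4 := norm_sub_sub_smul_deriv_le (hd z x) hr (hbd x hx hzx) hk
          refine (ContinuousLinearMap.le_opNorm _ _).trans ((mul_le_mul h4 (hC x hx)
            (norm_nonneg _) ((norm_nonneg _).trans h4)).trans_eq (by ring))
        · rw [integral_const_mul]
          refine (mul_le_mul_of_nonneg_left (hm.tail_le hT z) (by positivity)).trans_eq ?_
          simp only [c₁]; ring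
      rw [h1]
      refine (norm_sub_le _ _).trans ((add_le_add ?_ h5).trans_eq (?_ :
        ‖k - k₀‖ * (‖k - k₀‖ * c₂) + ‖k - k₀‖ ^ 2 * c₁ = _))
      · rw [norm_smul]; exact mul_le_mul_of_nonneg_left h3 (norm_nonneg _)
      · ring
    have := hs.norm_le hT hm (hG k hk) hbound y hy
    exact this.trans_eq (by ring)
  have hderiv : HasDerivAt (fun k => ψ k y) (χ y) k₀ := by
    rw [hasDerivAt_iff_isLittleO]
    refine IsBigO.trans_isLittleO (g := fun k => ‖k - k₀‖ ^ 2) ?_ ?_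
    · refine IsBigO.of_bound (2 * (c₁ + c₂) * Real.exp (2 * M)) ?_
      filter_upwards [Metric.ball_mem_nhds k₀ hr] with k hk
      simpa using key k hk
    · have h0 : Tendsto (fun k => ‖k - k₀‖) (𝓝 k₀) (𝓝 0) :=
        tendsto_iff_norm_sub_tendsto_zero.1 tendsto_id
      have := (isLittleO_pow_id (𝕜 := ℝ) (n := 2) (by norm_num)).comp_tendsto h0
      simpa [Function.comp_def] using this.norm_right
  exact hderiv.differentiableAt

end

section

/-! ### The Volterra equation of a column with a potential of Lax type -/

variable {T : EReal} {α β w w' : ℝ → ℝ}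

/-- The common form of the two potentials of the Lax pair. -/
def laxPotential (α β w : ℝ → ℝ) (k : ℂ) (y : ℝ) : Matrix (Fin 2) (Fin 2) ℂ :=
  (Complex.I * (α y : ℂ) * k) • sigma3 - (Complex.I * (β y : ℂ) * k) • sigma2
    + (Complex.I * (w y : ℂ)) • sigma1

@[simp] theorem laxPotential_zero_zero (k : ℂ) (y : ℝ) :
    laxPotential α β w k y 0 0 = Complex.I * α y * k := by
  simp [laxPotential, sigma1, sigma2, sigma3]

@[simp] theorem laxPotential_zero_one (k : ℂ) (y : ℝ) :
    laxPotential α β w k y 0 1 = Complex.I * w y - β y * k := by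
  simp [laxPotential, sigma1, sigma2, sigma3]
  linear_combination (β y * k) * Complex.I_sq

@[simp] theorem laxPotential_one_zero (k : ℂ) (y : ℝ) :
    laxPotential α β w k y 1 0 = Complex.I * w y + β y * k := by
  simp [laxPotential, sigma1, sigma2, sigma3]
  linear_combination -(β y * k) * Complex.I_sq

@[simp] theorem laxPotential_one_one (k : ℂ) (y : ℝ) :
    laxPotential α β w k y 1 1 = -(Complex.I * α y * k) := by
  simp [laxPotential, sigma1, sigma2, sigma3]

/-- Continuity and integrability of the coefficients of a potential of Lax type. -/
structure IsLaxData (T : EReal) (α β w w' : ℝ → ℝ) : Prop where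
  cont_diag : ContinuousOn α (timeInterval T)
  cont_off : ContinuousOn β (timeInterval T)
  cont_free : ContinuousOn w (timeInterval T)
  cont_deriv : ContinuousOn w' (timeInterval T)
  int_diag : IntegrableOn α (timeInterval T)
  int_off : IntegrableOn β (timeInterval T)
  int_free : IntegrableOn w (timeInterval T)
  int_deriv : IntegrableOn w' (timeInterval T)
  hasDeriv : ∀ y ∈ timeInterval T, HasDerivWithinAt w (w' y) (timeInterval T) y

/-- The matrix unit `e_{il}` as a continuous linear map. -/
def matUnit (i l : Fin 2) : (Fin 2 → ℂ) →L[ℂ] (Fin 2 → ℂ) :=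
  (ContinuousLinearMap.single ℂ (fun _ : Fin 2 => ℂ) i).comp (ContinuousLinearMap.proj l)

theorem matUnit_apply (i l : Fin 2) (v : Fin 2 → ℂ) : matUnit i l v = Pi.single i (v l) := rfl

theorem norm_matUnit_le (i l : Fin 2) : ‖matUnit i l‖ ≤ 1 := by
  refine ContinuousLinearMap.opNorm_le_bound _ zero_le_one fun v => ?_
  rw [matUnit_apply, Pi.norm_single, one_mul]
  exact norm_le_pi_norm v l

theorem norm_smul_matUnit_le (c : ℂ) (i l : Fin 2) : ‖c • matUnit i l‖ ≤ ‖c‖ := by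
  rw [norm_smul]; exact mul_le_of_le_one_right (norm_nonneg _) (norm_matUnit_le i l)

/-- The first row of the potential, as an operator. -/
def rowOp₀ (α β w : ℝ → ℝ) (k : ℂ) (x : ℝ) : (Fin 2 → ℂ) →L[ℂ] (Fin 2 → ℂ) :=
  (Complex.I * α x * k) • matUnit 0 0 + (Complex.I * w x - β x * k) • matUnit 0 1

/-- The second row of the potential, as an operator. -/
def rowOp₁ (α β w : ℝ → ℝ) (k : ℂ) (x : ℝ) : (Fin 2 → ℂ) →L[ℂ] (Fin 2 → ℂ) :=
  (Complex.I * w x + β x * k) • matUnit 1 0 + (-(Complex.I * α x * k)) • matUnit 1 1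

/-- The kernel of the Volterra equation of the second column. -/
def laxKernel (α β w : ℝ → ℝ) (κ k : ℂ) (y x : ℝ) : (Fin 2 → ℂ) →L[ℂ] (Fin 2 → ℂ) :=
  Complex.exp (2 * Complex.I * κ * ((x - y : ℝ) : ℂ)) • rowOp₀ α β w k x + rowOp₁ α β w k x

theorem laxKernel_apply_zero (κ k : ℂ) (y x : ℝ) (v : Fin 2 → ℂ) :
    laxKernel α β w κ k y x v 0 = Complex.exp (2 * Complex.I * κ * ((x - y : ℝ) : ℂ)) *
      (Complex.I * α x * k * v 0 + (Complex.I * w x - β x * k) * v 1) := by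
  simp [laxKernel, rowOp₀, rowOp₁, matUnit_apply]; ring

theorem laxKernel_apply_one (κ k : ℂ) (y x : ℝ) (v : Fin 2 → ℂ) :
    laxKernel α β w κ k y x v 1 =
      (Complex.I * w x + β x * k) * v 0 - Complex.I * α x * k * v 1 := by
  simp [laxKernel, rowOp₀, rowOp₁, matUnit_apply]; ring

/-- The majorant of the potential for `‖k‖ ≤ K`. -/
def laxMajorant (α β w : ℝ → ℝ) (K : ℝ) (x : ℝ) : ℝ := K * (|α x| + |β x|) + |w x|

theorem norm_rowOp₀_le {k : ℂ} {K : ℝ} (hk : ‖k‖ ≤ K) (x : ℝ) :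
    ‖rowOp₀ α β w k x‖ ≤ laxMajorant α β w K x := by
  refine (norm_add_le _ _).trans ((add_le_add (norm_smul_matUnit_le _ _ _)
    ((norm_smul_matUnit_le _ _ _).trans (norm_sub_le _ _))).trans ?_)
  simp only [norm_mul, Complex.norm_I, Complex.norm_real, Real.norm_eq_abs, one_mul, laxMajorant]
  nlinarith [mul_le_mul_of_nonneg_left hk (abs_nonneg (α x)),
    mul_le_mul_of_nonneg_left hk (abs_nonneg (β x))]

theorem norm_rowOp₁_le {k : ℂ} {K : ℝ} (hk : ‖k‖ ≤ K) (x : ℝ) :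
    ‖rowOp₁ α β w k x‖ ≤ laxMajorant α β w K x := by
  refine (norm_add_le _ _).trans ((add_le_add ((norm_smul_matUnit_le _ _ _).trans
    (norm_add_le _ _)) (norm_smul_matUnit_le _ _ _)).trans ?_)
  simp only [norm_neg, norm_mul, Complex.norm_I, Complex.norm_real, Real.norm_eq_abs, one_mul,
    laxMajorant]
  nlinarith [mul_le_mul_of_nonneg_left hk (abs_nonneg (α x)),
    mul_le_mul_of_nonneg_left hk (abs_nonneg (β x))]

theorem IsLaxData.isMajorant (h : IsLaxData T α β w w') {K : ℝ} (hK : 0 ≤ K) :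
    IsMajorant T (laxMajorant α β w K) := by
  refine ⟨?_, fun y _ => by unfold laxMajorant; positivity, ?_⟩
  · exact (continuousOn_const.mul (h.cont_diag.abs.add h.cont_off.abs)).add h.cont_free.abs
  · exact ((h.int_diag.abs.add h.int_off.abs).const_mul K).add h.int_free.abs

theorem IsLaxData.cont_snd (h : IsLaxData T α β w w') :
    ContinuousOn (fun q : ℝ × ℝ => (α q.2 : ℂ)) (timeInterval T ×ˢ timeInterval T) ∧
    ContinuousOn (fun q : ℝ × ℝ => (β q.2 : ℂ)) (timeInterval T ×ˢ timeInterval T) ∧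
    ContinuousOn (fun q : ℝ × ℝ => (w q.2 : ℂ)) (timeInterval T ×ˢ timeInterval T) :=
  have aux : ∀ g : ℝ → ℝ, ContinuousOn g (timeInterval T) →
      ContinuousOn (fun q : ℝ × ℝ => (g q.2 : ℂ)) (timeInterval T ×ˢ timeInterval T) := fun _ hg =>
    Complex.continuous_ofReal.comp_continuousOn
      (hg.comp continuousOn_snd fun _ hq => hq.2)
  ⟨aux α h.cont_diag, aux β h.cont_off, aux w h.cont_free⟩

theorem IsLaxData.isVolterraKernel (h : IsLaxData T α β w w') {κ k : ℂ} {K : ℝ}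
    (hk : ‖k‖ ≤ K) {c : ℝ} (hc : 1 ≤ c)
    (hexp : ∀ y ∈ timeInterval T, ∀ x ∈ timeInterval T, y ≤ x →
      ‖Complex.exp (2 * Complex.I * κ * ((x - y : ℝ) : ℂ))‖ ≤ c) :
    IsVolterraKernel T (fun x => 2 * c * laxMajorant α β w K x) (laxKernel α β w κ k) := by
  obtain ⟨hα, hβ, hw⟩ := h.cont_snd
  constructor
  · unfold laxKernel rowOp₀ rowOp₁
    fun_prop
  · intro y hy x hx hyx
    have h0 := norm_rowOp₀_le (α := α) (β := β) (w := w) hk x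
    have h1 := norm_rowOp₁_le (α := α) (β := β) (w := w) hk x
    have h2 : ‖Complex.exp (2 * Complex.I * κ * ((x - y : ℝ) : ℂ)) • rowOp₀ α β w k x‖
        ≤ c * laxMajorant α β w K x := by
      rw [norm_smul]
      exact mul_le_mul (hexp y hy x hx hyx) h0 (norm_nonneg _) (by linarith)
    refine (norm_add_le _ _).trans ?_
    have h3 : 0 ≤ laxMajorant α β w K x := (norm_nonneg _).trans h0
    nlinarith

/-- The oscillating factor is bounded, uniformly for bounded phases. -/
theorem exists_exp_bound (hT : 0 < T) (L : ℝ) : ∃ c : ℝ, 1 ≤ c ∧ ∀ κ : ℂ, ‖κ‖ ≤ L →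
    (T < ⊤ ∨ 0 ≤ κ.im) → ∀ y ∈ timeInterval T, ∀ x ∈ timeInterval T, y ≤ x →
      ‖Complex.exp (2 * Complex.I * κ * ((x - y : ℝ) : ℂ))‖ ≤ c := by
  have hre : ∀ (κ : ℂ) (s : ℝ), (2 * Complex.I * κ * (s : ℂ)).re = -(2 * κ.im * s) := by
    intro κ s; simp
  rcases timeInterval_cases hT with ⟨h1, -⟩ | ⟨r, hr, -, h⟩
  · refine ⟨1, le_rfl, fun κ _ hκ y _ x _ hyx => ?_⟩
    have hκ' : 0 ≤ κ.im := hκ.resolve_left (by simp [h1])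
    rw [Complex.norm_exp, hre]
    refine Real.exp_le_one_iff.2 ?_
    have := mul_nonneg (mul_nonneg zero_le_two hκ') (sub_nonneg.2 hyx)
    linarith
  · refine ⟨Real.exp (2 * |L| * r), Real.one_le_exp (by positivity),
      fun κ hL _ y hy x hx hyx => ?_⟩
    rw [h] at hx hy
    rw [Complex.norm_exp, hre]
    refine Real.exp_le_exp.2 ?_
    have h1 : -κ.im ≤ |L| := (neg_le_abs _).trans ((Complex.abs_im_le_norm κ).trans
      (hL.trans (le_abs_self L)))
    have h2 : x - y ≤ r := by linarith [hx.2, hy.1]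
    have h3 : -κ.im * (x - y) ≤ |L| * r :=
      mul_le_mul h1 h2 (sub_nonneg.2 hyx) (abs_nonneg _)
    linarith

/-- The second column of the identity matrix. -/
def unitCol : Fin 2 → ℂ := ![0, 1]

theorem norm_unitCol_le : ‖unitCol‖ ≤ 1 := by
  rw [pi_norm_le_iff_of_nonneg zero_le_one]
  intro i; fin_cases i <;> simp [unitCol]

/-- In column `1` the exponents `sgn i - sgn 1` are `2` and `0`, so only the first row oscillates.
Continuity and boundedness of `ψ` make the kernel integrable, which allows a coordinate to be taken
inside the vector-valued integral. -/
theorem isVolterraColumn_iff (hT : 0 < T) {m : ℝ → ℝ} {κ k : ℂ} (hm : IsMajorant T m)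
    (hG : IsVolterraKernel T m (laxKernel α β w κ k)) {ψ : ℝ → Fin 2 → ℂ} :
    IsVolterraColumn (laxPotential α β w k) κ (timeInterval T) 1 ψ ↔
      IsVolterraSol T (laxKernel α β w κ k) (fun _ => unitCol) ψ := by
  have hb : (∃ C : ℝ, ∀ y ∈ timeInterval T, ∀ i, ‖ψ y i‖ ≤ C) ↔
      ∃ C : ℝ, ∀ y ∈ timeInterval T, ‖ψ y‖ ≤ C := by
    constructor
    · rintro ⟨C, hC⟩
      exact ⟨C, fun y hy => (pi_norm_le_iff_of_nonneg ((norm_nonneg _).trans (hC y hy 0))).2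
        (hC y hy)⟩
    · rintro ⟨C, hC⟩
      exact ⟨C, fun y hy i => (norm_le_pi_norm _ i).trans (hC y hy)⟩
  have key : ContinuousOn ψ (timeInterval T) → (∃ C : ℝ, ∀ y ∈ timeInterval T, ‖ψ y‖ ≤ C) →
      ∀ y ∈ timeInterval T, ∀ i, (1 : Matrix (Fin 2) (Fin 2) ℂ) i 1 -
        ∫ x in timeInterval T ∩ Ici y,
          Complex.exp (Complex.I * (κ * ((x - y : ℝ) : ℂ)) * (sgn i - sgn 1)) *
            (laxPotential α β w k x *ᵥ ψ x) i
        = (unitCol - volterraOp T (laxKernel α β w κ k) ψ y) i := by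
    intro hc hbd y hy i
    have hint := hG.integrableOn hT hm hc hbd hy
    have hi : (volterraOp T (laxKernel α β w κ k) ψ y) i
        = ∫ x in timeInterval T ∩ Ici y, laxKernel α β w κ k y x (ψ x) i :=
      ((ContinuousLinearMap.proj (R := ℂ) (φ := fun _ : Fin 2 => ℂ) i).integral_comp_comm hint).symm
    rw [Pi.sub_apply, hi]
    congr 1
    · fin_cases i
      · simp [unitCol]
      · exact Matrix.one_apply_eq 1
    · congr 1
      ext x
      fin_cases i
      · simp only [Fin.zero_eta, laxKernel_apply_zero, Matrix.mulVec, dotProduct, Fin.sum_univ_two,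
          laxPotential_zero_zero, laxPotential_zero_one, sgn]
        congr 2
        simp; ring
      · simp only [Fin.mk_one, laxKernel_apply_one, Matrix.mulVec, dotProduct, Fin.sum_univ_two,
          laxPotential_one_zero, laxPotential_one_one, sub_self, mul_zero, Complex.exp_zero]
        ring
  constructor
  · intro h
    have h2 := hb.1 h.bounded
    exact ⟨h.continuousOn, h2, fun y hy => funext fun i => by
      rw [h.eqn y hy i]; exact key h.continuousOn h2 y hy i⟩
  · intro h
    exact ⟨h.continuousOn, hb.2 h.bounded, fun y hy i => by
      rw [key h.continuousOn h.bounded y hy i, h.eqn y hy]⟩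

/-- The bounded continuous solution of the Volterra equation of the second column. -/
abbrev laxColumn (T : EReal) (α β w : ℝ → ℝ) (κ k : ℂ) : ℝ → Fin 2 → ℂ :=
  volterraColumn (laxPotential α β w k) κ (timeInterval T) 1

/-- A single majorant for all parameters in a bounded set, as the uniform estimates in the parameter
require. -/
theorem IsLaxData.exists_kernel (h : IsLaxData T α β w w') (hT : 0 < T) (K L : ℝ) (hK : 0 ≤ K) :
    ∃ m, IsMajorant T m ∧ ∀ κ k : ℂ, ‖k‖ ≤ K → ‖κ‖ ≤ L → (T < ⊤ ∨ 0 ≤ κ.im) →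
      IsVolterraKernel T m (laxKernel α β w κ k) := by
  obtain ⟨c, hc, hexp⟩ := exists_exp_bound hT L
  exact ⟨_, (h.isMajorant hK).const_mul (by positivity), fun κ k hk hκ hT' =>
    h.isVolterraKernel hk hc (hexp κ hκ hT')⟩

theorem IsLaxData.hasUniqueColumn (h : IsLaxData T α β w w') (hT : 0 < T) {κ k : ℂ}
    (hκ : T < ⊤ ∨ 0 ≤ κ.im) :
    HasUniqueColumn (laxPotential α β w k) κ (timeInterval T) 1 := by
  obtain ⟨m, hm, hG⟩ := h.exists_kernel hT ‖k‖ ‖κ‖ (norm_nonneg k)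
  have hG := hG κ k le_rfl le_rfl hκ
  obtain ⟨ψ, hψ⟩ := exists_volterraSol hT hm hG (f := fun _ => unitCol) continuousOn_const
    ⟨_, fun _ _ => le_rfl⟩
  refine ⟨ψ, (isVolterraColumn_iff hT hm hG).2 hψ, fun φ hφ => ?_⟩
  exact ((isVolterraColumn_iff hT hm hG).1 hφ).unique hT hm hG hψ

theorem HasUniqueColumn.spec {V : ℝ → Matrix (Fin 2) (Fin 2) ℂ} {κ : ℂ} {J : Set ℝ} {j : Fin 2}
    (h : HasUniqueColumn V κ J j) : IsVolterraColumn V κ J j (volterraColumn V κ J j) :=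
  Classical.epsilon_spec (let ⟨ψ, hψ, _⟩ := h; ⟨ψ, hψ⟩)

theorem IsLaxData.isVolterraSol (h : IsLaxData T α β w w') (hT : 0 < T) {m : ℝ → ℝ} {κ k : ℂ}
    (hκ : T < ⊤ ∨ 0 ≤ κ.im) (hm : IsMajorant T m)
    (hG : IsVolterraKernel T m (laxKernel α β w κ k)) :
    IsVolterraSol T (laxKernel α β w κ k) (fun _ => unitCol) (laxColumn T α β w κ k) :=
  (isVolterraColumn_iff hT hm hG).1 (h.hasUniqueColumn hT hκ).spec

/-! ### Dependence of the column on the spectral parameter -/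

/-- The explicit form shows that the derivative is jointly continuous in `(y, x)`. -/
theorem hasDerivAt_laxKernel {κ : ℂ → ℂ} {κ' k : ℂ} (hκ : HasDerivAt κ κ' k) (y x : ℝ) :
    HasDerivAt (fun k => laxKernel α β w (κ k) k y x)
      (Complex.exp (2 * Complex.I * κ k * ((x - y : ℝ) : ℂ)) •
          ((Complex.I * α x) • matUnit 0 0 + (-(β x : ℂ)) • matUnit 0 1)
        + (Complex.exp (2 * Complex.I * κ k * ((x - y : ℝ) : ℂ)) *
            (2 * Complex.I * κ' * ((x - y : ℝ) : ℂ))) • rowOp₀ α β w k x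
        + ((β x : ℂ) • matUnit 1 0 + (-(Complex.I * α x)) • matUnit 1 1)) k := by
  have he : HasDerivAt (fun k => Complex.exp (2 * Complex.I * κ k * ((x - y : ℝ) : ℂ)))
      (Complex.exp (2 * Complex.I * κ k * ((x - y : ℝ) : ℂ)) *
            (2 * Complex.I * κ' * ((x - y : ℝ) : ℂ))) k :=
    ((hκ.const_mul (2 * Complex.I)).mul_const _).cexp
  have hl : ∀ c : ℂ, HasDerivAt (fun k : ℂ => c * k) c k := fun c => by
    simpa using (hasDerivAt_id k).const_mul c
  have h0 : HasDerivAt (fun k => rowOp₀ α β w k x)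
      ((Complex.I * α x) • matUnit 0 0 + (-(β x : ℂ)) • matUnit 0 1) k :=
    ((hl (Complex.I * α x)).smul_const (matUnit 0 0)).add
      (((hl (β x)).const_sub (Complex.I * w x)).smul_const (matUnit 0 1))
  have h1 : HasDerivAt (fun k => rowOp₁ α β w k x)
      ((β x : ℂ) • matUnit 1 0 + (-(Complex.I * α x)) • matUnit 1 1) k :=
    (((hl (β x)).const_add (Complex.I * w x)).smul_const (matUnit 1 0)).add
      ((hl (Complex.I * α x)).neg.smul_const (matUnit 1 1))
  exact (he.smul h0).add h1

theorem IsLaxData.differentiableAt_column (h : IsLaxData T α β w w') (hT : 0 < T) {κ : ℂ → ℂ}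
    {U : Set ℂ} (hU : IsOpen U) (hκd : DifferentiableOn ℂ κ U)
    (hκ : ∀ k ∈ U, T < ⊤ ∨ 0 ≤ (κ k).im) {k₀ : ℂ} (hk₀ : k₀ ∈ U) :
    DifferentiableAt ℂ (fun k => laxColumn T α β w (κ k) k 0) k₀ := by
  have hcont : ContinuousAt κ k₀ := (hκd.differentiableAt (hU.mem_nhds hk₀)).continuousAt
  have hev : ∀ᶠ k in 𝓝 k₀, k ∈ U ∧ ‖k‖ < ‖k₀‖ + 1 ∧ ‖κ k‖ < ‖κ k₀‖ + 1 :=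
    (hU.eventually_mem hk₀).and ((continuous_norm.continuousAt.eventually_lt continuousAt_const
      (lt_add_one _)).and (hcont.norm.eventually_lt continuousAt_const (lt_add_one _)))
  obtain ⟨r, hr, hball⟩ := Metric.eventually_nhds_iff_ball.1 hev
  obtain ⟨m, hm, hG⟩ := h.exists_kernel hT (‖k₀‖ + 1) (‖κ k₀‖ + 1) (by positivity)
  have hG' : ∀ k ∈ Metric.ball k₀ r, IsVolterraKernel T m (laxKernel α β w (κ k) k) :=
    fun k hk => hG _ _ (hball k hk).2.1.le (hball k hk).2.2.le (hκ k (hball k hk).1)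
  have hκat : ∀ k ∈ U, HasDerivAt κ (deriv κ k) k := fun k hk =>
    (hκd.differentiableAt (hU.mem_nhds hk)).hasDerivAt
  obtain ⟨hα, hβ, hw⟩ := h.cont_snd
  refine differentiableAt_volterraSol hT hm hr hG' (f := fun _ => unitCol)
    (fun k hk => h.isVolterraSol hT (hκ k (hball k hk).1) hm (hG' k hk)) ?_ ?_
    (zero_mem_timeInterval hT)
  · exact fun y x k hk => ((hasDerivAt_laxKernel (hκat k (hball k hk).1) y
      x).differentiableAt).differentiableWithinAt
  · simp only [(hasDerivAt_laxKernel (hκat k₀ hk₀) _ _).deriv]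
    unfold rowOp₀
    fun_prop

/-- Here `W` may contain points with `Im κ = 0`, around which the column need not exist when `T =
∞`, so holomorphy cannot be used. Dominated convergence supplies the smallness of the kernel
difference in `L¹`. -/
theorem IsLaxData.continuousOn_column (h : IsLaxData T α β w w') (hT : 0 < T) {κ : ℂ → ℂ}
    {W : Set ℂ} (hκc : ContinuousOn κ W) (hκ : ∀ k ∈ W, 0 ≤ (κ k).im) :
    ContinuousOn (fun k => laxColumn T α β w (κ k) k 0) W := by
  intro k₀ hk₀
  rw [← continuousWithinAt_inter (Metric.ball_mem_nhds k₀ one_pos)]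
  set K := ‖k₀‖ + 1
  have hK : 0 ≤ K := by positivity
  have hnorm : ∀ k ∈ W ∩ Metric.ball k₀ 1, ‖k‖ ≤ K := fun k hk => by
    have h1 : ‖k - k₀‖ < 1 := by simpa [dist_eq_norm] using hk.2
    have h2 := norm_add_le (k - k₀) k₀
    rw [sub_add_cancel] at h2
    linarith
  have hre : ∀ k ∈ W, ∀ s : ℝ, 0 ≤ s → (2 * Complex.I * κ k * (s : ℂ)).re ≤ 0 := by
    intro k hk s hs
    have : (2 * Complex.I * κ k * (s : ℂ)).re = -(2 * (κ k).im * s) := by simp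
    rw [this]
    have := mul_nonneg (mul_nonneg zero_le_two (hκ k hk)) hs
    linarith
  have hexp : ∀ k ∈ W, ∀ s : ℝ, 0 ≤ s → ‖Complex.exp (2 * Complex.I * κ k * (s : ℂ))‖ ≤ 1 := by
    intro k hk s hs
    rw [Complex.norm_exp]
    exact Real.exp_le_one_iff.2 (hre k hk s hs)
  have hM := h.isMajorant hK
  have hm := hM.const_mul (c := 2 * 1) (by norm_num)
  have hG : ∀ k ∈ W ∩ Metric.ball k₀ 1, IsVolterraKernel T
      (fun x => 2 * 1 * laxMajorant α β w K x) (laxKernel α β w (κ k) k) := fun k hk =>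
    h.isVolterraKernel (hnorm k hk) le_rfl fun y _ x _ hyx => hexp k hk.1 _ (sub_nonneg.2 hyx)
  have hk₀' : k₀ ∈ W ∩ Metric.ball k₀ 1 := ⟨hk₀, Metric.mem_ball_self one_pos⟩
  have hJ := measurableSet_timeInterval hT
  -- Both exponentials have modulus at most `1` and `0 ≤ x - y ≤ x`, which gives the two entries of
  -- the minimum. The entry `2` keeps `δ k` dominated by an integrable function; the other one gives
  -- convergence to zero for each `x`. The last summand accounts for the linear dependence of the
  -- potential on `k`.
  set δ : ℂ → ℝ → ℝ := fun k x => min 2 (2 * ‖κ k₀ - κ k‖ * x) * laxMajorant α β w K x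
    + 2 * ‖k₀ - k‖ * (|α x| + |β x|)
  have hδ0 : ∀ k, ∀ x ∈ timeInterval T, 0 ≤ δ k x := by
    intro k x hx
    have := hM.nonneg x hx
    have h0 := hx.1
    positivity
  have hn : ContinuousOn (fun x => |α x| + |β x|) (timeInterval T) :=
    h.cont_diag.abs.add h.cont_off.abs
  have hδc : ∀ k, ContinuousOn (δ k) (timeInterval T) := fun k => by
    have := hM.continuousOn
    fun_prop
  have hbi : IntegrableOn (fun x => 2 * laxMajorant α β w K x + 2 * (|α x| + |β x|))
      (timeInterval T) := (hM.integrableOn.const_mul 2).add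
        ((h.int_diag.abs.add h.int_off.abs).const_mul 2)
  have hδb : ∀ k ∈ W ∩ Metric.ball k₀ 1, ∀ x ∈ timeInterval T,
      ‖δ k x‖ ≤ 2 * laxMajorant α β w K x + 2 * (|α x| + |β x|) := by
    intro k hk x hx
    rw [Real.norm_of_nonneg (hδ0 k x hx)]
    have h1 : ‖k₀ - k‖ ≤ 1 := by
      rw [← dist_eq_norm, dist_comm]; exact (Metric.mem_ball.1 hk.2).le
    have h2 := hM.nonneg x hx
    refine add_le_add (mul_le_mul_of_nonneg_right (min_le_left _ _) h2) ?_
    have h3 : 0 ≤ |α x| + |β x| := by positivity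
    nlinarith
  refine continuousWithinAt_volterraSol hT hm hG (f := fun _ => unitCol) (fun k hk =>
    h.isVolterraSol hT (Or.inr (hκ k hk.1)) hm (hG k hk)) hk₀' (δ := δ) ?_
    (fun k _ => hδ0 k) ?_ ?_ (zero_mem_timeInterval hT)
  · intro k hk
    exact Integrable.mono' hbi ((hδc k).aestronglyMeasurable hJ)
      ((ae_restrict_iff' hJ).2 (ae_of_all _ (hδb k hk)))
  · intro k hk y hy x hx hyx
    have hs : 0 ≤ x - y := sub_nonneg.2 hyx
    set e := Complex.exp (2 * Complex.I * κ k * ((x - y : ℝ) : ℂ))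
    set e₀ := Complex.exp (2 * Complex.I * κ k₀ * ((x - y : ℝ) : ℂ))
    have hdec : laxKernel α β w (κ k₀) k₀ y x - laxKernel α β w (κ k) k y x
        = (e₀ - e) • rowOp₀ α β w k₀ x
          + (e • ((Complex.I * α x * (k₀ - k)) • matUnit 0 0 + (-(β x * (k₀ - k))) • matUnit 0 1)
          + ((β x * (k₀ - k)) • matUnit 1 0 + (-(Complex.I * α x * (k₀ - k))) • matUnit 1 1)) := by
      simp only [laxKernel, rowOp₀, rowOp₁, e, e₀]
      module
    have hu : ∀ a b : ℂ, ∀ i l i' l' : Fin 2, ‖a • matUnit i l + b • matUnit i' l'‖ ≤ ‖a‖ + ‖b‖ :=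
      fun a b i l i' l' => (norm_add_le _ _).trans
        (add_le_add (norm_smul_matUnit_le _ _ _) (norm_smul_matUnit_le _ _ _))
    have he : ‖e‖ ≤ 1 := hexp k hk.1 _ hs
    have he₀ : ‖e₀‖ ≤ 1 := hexp k₀ hk₀ _ hs
    have hee : ‖e₀ - e‖ ≤ min 2 (2 * ‖κ k₀ - κ k‖ * x) := by
      refine le_min ((norm_sub_le _ _).trans (by linarith)) ?_
      refine (norm_exp_sub_exp_le (hre k₀ hk₀ _ hs) (hre k hk.1 _ hs)).trans ?_
      have : 2 * Complex.I * κ k₀ * ((x - y : ℝ) : ℂ) - 2 * Complex.I * κ k * ((x - y : ℝ) : ℂ)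
          = 2 * Complex.I * (κ k₀ - κ k) * ((x - y : ℝ) : ℂ) := by ring
      rw [this, norm_mul, norm_mul, norm_mul, Complex.norm_I, Complex.norm_real,
        Real.norm_of_nonneg hs]
      norm_num
      have h1 := hy.1
      gcongr
      linarith
    rw [hdec]
    refine (norm_add_le _ _).trans (add_le_add ?_ ((norm_add_le _ _).trans ?_))
    · rw [norm_smul]
      exact mul_le_mul hee (norm_rowOp₀_le (hnorm k₀ hk₀') x) (norm_nonneg _)
        ((norm_nonneg _).trans hee)
    · have h1 := hu (Complex.I * α x * (k₀ - k)) (-(β x * (k₀ - k))) 0 0 0 1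
      have h2 := hu (β x * (k₀ - k)) (-(Complex.I * α x * (k₀ - k))) 1 0 1 1
      rw [norm_smul]
      have h3 := mul_le_of_le_one_left (norm_nonneg ((Complex.I * α x * (k₀ - k)) • matUnit 0 0 +
        (-(β x * (k₀ - k))) • matUnit 0 1)) he
      simp only [norm_neg, norm_mul, Complex.norm_I, Complex.norm_real, Real.norm_eq_abs,
        one_mul] at h1 h2
      linarith
  · have hlim : ∀ x ∈ timeInterval T,
        Tendsto (fun k => δ k x) (𝓝[W ∩ Metric.ball k₀ 1] k₀) (𝓝 0) := by
      intro x _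
      have hc : ContinuousWithinAt κ (W ∩ Metric.ball k₀ 1) k₀ :=
        (hκc k₀ hk₀).mono inter_subset_left
      have : ContinuousWithinAt (fun k => δ k x) (W ∩ Metric.ball k₀ 1) k₀ := by
        have h1 : ContinuousWithinAt (fun k => ‖κ k₀ - κ k‖) (W ∩ Metric.ball k₀ 1) k₀ :=
          (continuousWithinAt_const.sub hc).norm
        have h2 : ContinuousWithinAt (fun k => ‖k₀ - k‖) (W ∩ Metric.ball k₀ 1) k₀ :=
          (continuousWithinAt_const.sub continuousWithinAt_id).norm
        have h3 : ContinuousWithinAt (fun k => min 2 (2 * ‖κ k₀ - κ k‖ * x))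
            (W ∩ Metric.ball k₀ 1) k₀ :=
          continuousWithinAt_const.min ((h1.const_mul 2).mul_const x)
        exact (h3.mul_const _).add ((h2.const_mul 2).mul_const _)
      have h0 : δ k₀ x = 0 := by simp [δ]
      rw [← h0]
      exact this
    have := tendsto_integral_filter_of_dominated_convergence
      (μ := volume.restrict (timeInterval T)) (l := 𝓝[W ∩ Metric.ball k₀ 1] k₀)
      (F := δ) (f := fun _ => 0) _
      (Eventually.of_forall fun k => (hδc k).aestronglyMeasurable hJ)
      (eventually_nhdsWithin_of_forall fun k hk =>
        (ae_restrict_iff' hJ).2 (ae_of_all _ (hδb k hk))) hbi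
      ((ae_restrict_iff' hJ).2 (ae_of_all _ hlim))
    simpa using this

end

section

variable {T : EReal} {α β w w' : ℝ → ℝ}

/-! ### The differential equation of a column, and its conserved quantity -/

/-- The second row of the kernel has no exponential and does not depend on `y`, which is why the
first argument can be frozen at `0` and `ψ · 1` is a tail of a fixed function. -/
theorem IsVolterraSol.hasDerivWithinAt_one (hT : 0 < T) {m : ℝ → ℝ} {κ k : ℂ}
    (hm : IsMajorant T m) (hG : IsVolterraKernel T m (laxKernel α β w κ k))
    {ψ : ℝ → Fin 2 → ℂ}
    (hψ : IsVolterraSol T (laxKernel α β w κ k) (fun _ => unitCol) ψ)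
    {y : ℝ} (hy : y ∈ timeInterval T) :
    HasDerivWithinAt (fun y => ψ y 1) (laxKernel α β w κ k 0 y (ψ y) 1) (timeInterval T) y := by
  have h0 := zero_mem_timeInterval hT
  have hc : ContinuousOn (fun x => laxKernel α β w κ k 0 x (ψ x) 1) (timeInterval T) :=
    continuousOn_pi.1 ((hG.continuousOn_right h0).clm_apply hψ.continuousOn) 1
  have hi : IntegrableOn (fun x => laxKernel α β w κ k 0 x (ψ x) 1) (timeInterval T) := by
    have := hG.integrableOn hT hm hψ.continuousOn hψ.bounded h0
    rw [timeInterval_inter_Ici_zero] at this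
    exact (ContinuousLinearMap.proj (R := ℂ) (φ := fun _ : Fin 2 => ℂ) 1).integrable_comp this
  have key : ∀ z ∈ timeInterval T, ψ z 1
      = 1 - ∫ x in timeInterval T ∩ Ici z, laxKernel α β w κ k 0 x (ψ x) 1 := by
    intro z hz
    have hint := hG.integrableOn hT hm hψ.continuousOn hψ.bounded hz
    have h1 : (volterraOp T (laxKernel α β w κ k) ψ z) 1
        = ∫ x in timeInterval T ∩ Ici z, laxKernel α β w κ k z x (ψ x) 1 :=
      ((ContinuousLinearMap.proj (R := ℂ) (φ := fun _ : Fin 2 => ℂ) 1).integral_comp_comm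
        hint).symm
    rw [hψ.eqn z hz, Pi.sub_apply, h1]
    simp only [laxKernel_apply_one]
    rfl
  have := (hasDerivWithinAt_tail hT hi hc hy).const_sub 1
  rw [neg_neg] at this
  exact this.congr key (key y hy)

theorem IsVolterraSol.apply_zero_eq {m : ℝ → ℝ} {κ k : ℂ} (hT : 0 < T)
    (hm : IsMajorant T m) (hG : IsVolterraKernel T m (laxKernel α β w κ k))
    {ψ : ℝ → Fin 2 → ℂ}
    (hψ : IsVolterraSol T (laxKernel α β w κ k) (fun _ => unitCol) ψ)
    {y : ℝ} (hy : y ∈ timeInterval T) :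
    ψ y 0 = -∫ x in timeInterval T ∩ Ici y, laxKernel α β w κ k y x (ψ x) 0 := by
  have hint := hG.integrableOn hT hm hψ.continuousOn hψ.bounded hy
  have h1 : (volterraOp T (laxKernel α β w κ k) ψ y) 0
      = ∫ x in timeInterval T ∩ Ici y, laxKernel α β w κ k y x (ψ x) 0 :=
    ((ContinuousLinearMap.proj (R := ℂ) (φ := fun _ : Fin 2 => ℂ) 0).integral_comp_comm
      hint).symm
  rw [hψ.eqn y hy, Pi.sub_apply, h1]
  simp [unitCol]

/-- Here the dependence on `y` is the factor `exp(-2iκy)`, which leaves the integral; the product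
rule then yields the differential equation. -/
theorem IsVolterraSol.hasDerivWithinAt_zero (hT : 0 < T) {m : ℝ → ℝ} {κ k : ℂ}
    (hm : IsMajorant T m) (hG : IsVolterraKernel T m (laxKernel α β w κ k))
    {ψ : ℝ → Fin 2 → ℂ}
    (hψ : IsVolterraSol T (laxKernel α β w κ k) (fun _ => unitCol) ψ)
    {y : ℝ} (hy : y ∈ timeInterval T) :
    HasDerivWithinAt (fun y => ψ y 0) (-(2 * Complex.I * κ) * ψ y 0 +
      (Complex.I * α y * k * ψ y 0 + (Complex.I * w y - β y * k) * ψ y 1)) (timeInterval T) y := by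
  have h0 := zero_mem_timeInterval hT
  have hc : ContinuousOn (fun x => laxKernel α β w κ k 0 x (ψ x) 0) (timeInterval T) :=
    continuousOn_pi.1 ((hG.continuousOn_right h0).clm_apply hψ.continuousOn) 0
  have hi : IntegrableOn (fun x => laxKernel α β w κ k 0 x (ψ x) 0) (timeInterval T) := by
    have := hG.integrableOn hT hm hψ.continuousOn hψ.bounded h0
    rw [timeInterval_inter_Ici_zero] at this
    exact (ContinuousLinearMap.proj (R := ℂ) (φ := fun _ : Fin 2 => ℂ) 0).integrable_comp this
  have key : ∀ z ∈ timeInterval T, ψ z 0 = Complex.exp (-(2 * Complex.I * κ) * z) *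
      -∫ x in timeInterval T ∩ Ici z, laxKernel α β w κ k 0 x (ψ x) 0 := by
    intro z hz
    rw [hψ.apply_zero_eq hT hm hG hz, mul_neg, ← integral_const_mul]
    simp only [laxKernel_apply_zero]
    congr 2
    ext x
    rw [← mul_assoc, ← Complex.exp_add]
    congr 2
    push_cast; ring
  have hz : HasDerivAt (fun z : ℝ => -(2 * Complex.I * κ) * (z : ℂ)) (-(2 * Complex.I * κ)) y := by
    simpa using (Complex.ofRealCLM.hasDerivAt (x := y)).const_mul (-(2 * Complex.I * κ))
  have := (hz.cexp.hasDerivWithinAt (s := timeInterval T)).mul (hasDerivWithinAt_tail hT hi hc hy).neg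
  refine (this.congr key (key y hy)).congr_deriv ?_
  rw [laxKernel_apply_zero, neg_neg]
  simp only [Pi.neg_apply]
  have h1 : Complex.exp (-(2 * Complex.I * κ) * y) *
      Complex.exp (2 * Complex.I * κ * ((y - 0 : ℝ) : ℂ)) = 1 := by
    rw [← Complex.exp_add, ← Complex.exp_zero]; congr 1; push_cast; ring
  linear_combination (Complex.I * α y * k * ψ y 0 + (Complex.I * w y - β y * k) * ψ y 1) * h1
    + 2 * Complex.I * κ * key y hy

theorem IsVolterraSol.norm_sub_unitCol_le (hT : 0 < T) {m : ℝ → ℝ} {κ k : ℂ}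
    (hm : IsMajorant T m) (hG : IsVolterraKernel T m (laxKernel α β w κ k))
    {ψ : ℝ → Fin 2 → ℂ}
    (hψ : IsVolterraSol T (laxKernel α β w κ k) (fun _ => unitCol) ψ)
    {C : ℝ} (hC : ∀ x ∈ timeInterval T, ‖ψ x‖ ≤ C) {y : ℝ} (hy : y ∈ timeInterval T) :
    ‖ψ y 0‖ ≤ (∫ x in timeInterval T ∩ Ici y, m x) * C ∧
      ‖ψ y 1 - 1‖ ≤ (∫ x in timeInterval T ∩ Ici y, m x) * C := by
  have h1 := norm_volterraOp_le hT hm hG hC hy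
  have h2 := hψ.eqn y hy
  have h3 : ‖ψ y - unitCol‖ ≤ (∫ x in timeInterval T ∩ Ici y, m x) * C := by
    rw [h2]; simpa using h1
  have h4 := (norm_le_pi_norm (ψ y - unitCol) 0).trans h3
  have h5 := (norm_le_pi_norm (ψ y - unitCol) 1).trans h3
  simp only [unitCol, Pi.sub_apply, Matrix.cons_val_zero, Matrix.cons_val_one, sub_zero] at h4 h5
  exact ⟨h4, h5⟩

/-- The pairing `Q` is, by the conjugation symmetry, a determinant of two columns of a traceless
system, so its derivative vanishes. Both columns tend to `(0,1)` at the right end, where `Q` is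
therefore `1`. Both `κ` and `conj κ` must be admissible, hence the hypothesis of a real phase when
`T = ∞`. -/
theorem IsLaxData.column_mul_conj (h : IsLaxData T α β w w') (hT : 0 < T) {κ k : ℂ}
    (hκ : T < ⊤ ∨ κ.im = 0) :
    laxColumn T α β w κ k 0 1 * conj (laxColumn T α β w (conj κ) (conj k) 0 1)
      + laxColumn T α β w κ k 0 0 * conj (laxColumn T α β w (conj κ) (conj k) 0 0) = 1 := by
  obtain ⟨m, hm, hG⟩ := h.exists_kernel hT ‖k‖ ‖κ‖ (norm_nonneg k)
  have hκ1 : T < ⊤ ∨ 0 ≤ κ.im := hκ.imp_right fun h => h.ge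
  have hκ2 : T < ⊤ ∨ 0 ≤ (conj κ).im := hκ.imp_right fun h => by simp [h]
  have hG1 := hG κ k le_rfl le_rfl hκ1
  have hG2 := hG (conj κ) (conj k) (RCLike.norm_conj k).le (RCLike.norm_conj κ).le hκ2
  have h1 := h.isVolterraSol hT hκ1 hm hG1
  have h2 := h.isVolterraSol hT hκ2 hm hG2
  set ψ := laxColumn T α β w κ k
  set φ := laxColumn T α β w (conj κ) (conj k)
  set Q : ℝ → ℂ := fun y => ψ y 1 * conj (φ y 1) + ψ y 0 * conj (φ y 0)
  have hQd : ∀ y ∈ timeInterval T, HasDerivWithinAt Q 0 (timeInterval T) y := by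
    intro y hy
    have := ((h1.hasDerivWithinAt_one hT hm hG1 hy).mul
      (h2.hasDerivWithinAt_one hT hm hG2 hy).star).add
      ((h1.hasDerivWithinAt_zero hT hm hG1 hy).mul (h2.hasDerivWithinAt_zero hT hm hG2 hy).star)
    refine this.congr_deriv ?_
    simp only [laxKernel_apply_one, ← starRingEnd_apply, map_sub, map_add, map_mul, map_neg,
      Complex.conj_I, Complex.conj_ofReal, Complex.conj_conj, map_ofNat]
    ring
  have hconst : ∀ z ∈ timeInterval T, Q z = Q 0 := by
    intro z hz
    have := convex_timeInterval.norm_image_sub_le_of_norm_hasDerivWithin_le (C := 0) hQd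
      (fun x _ => by simp) (zero_mem_timeInterval hT) hz
    simpa [sub_eq_zero] using this
  obtain ⟨C₁, hC₁⟩ := h1.bounded
  obtain ⟨C₂, hC₂⟩ := h2.bounded
  set C := max C₁ C₂
  have hC0 : 0 ≤ C := ((norm_nonneg _).trans (hC₁ 0 (zero_mem_timeInterval hT))).trans
    (le_max_left _ _)
  have hz0 : ∀ ε > 0, ε ≤ 1 → ‖Q 0 - 1‖ ≤ 4 * ε := by
    intro ε hε hε1
    obtain ⟨z, hz, -, hzε⟩ := exists_tail_lt hT hm.integrableOn
      (ε := ε / (C + 1)) (by positivity) 0 (zero_mem_timeInterval hT)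
    have htail : (∫ x in timeInterval T ∩ Ici z, m x) * C ≤ ε := by
      rw [lt_div_iff₀ (by positivity)] at hzε
      have : 0 ≤ ∫ x in timeInterval T ∩ Ici z, m x :=
        setIntegral_nonneg ((measurableSet_timeInterval hT).inter measurableSet_Ici)
          fun x hx => hm.nonneg x hx.1
      nlinarith
    obtain ⟨ha, hb⟩ := h1.norm_sub_unitCol_le hT hm hG1
      (fun x hx => (hC₁ x hx).trans (le_max_left C₁ C₂)) hz
    obtain ⟨hc, hd⟩ := h2.norm_sub_unitCol_le hT hm hG2
      (fun x hx => (hC₂ x hx).trans (le_max_right C₁ C₂)) hz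
    rw [← hconst z hz]
    -- Expansion around `(0,1)`: each of the four terms is at most `ε`, the products because `ε ≤
    -- 1`.
    have hdec : Q z - 1 = (ψ z 1 - 1) * conj (φ z 1 - 1) + (ψ z 1 - 1) + conj (φ z 1 - 1)
        + ψ z 0 * conj (φ z 0) := by
      simp only [Q, map_sub, map_one]; ring
    rw [hdec]
    refine (norm_add₄_le).trans ?_
    simp only [norm_mul, RCLike.norm_conj]
    have e1 := ha.trans htail
    have e2 := hb.trans htail
    have e3 := hc.trans htail
    have e4 := hd.trans htail
    have m1 : ‖ψ z 1 - 1‖ * ‖φ z 1 - 1‖ ≤ ε * 1 :=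
      mul_le_mul e2 (e4.trans hε1) (norm_nonneg _) hε.le
    have m2 : ‖ψ z 0‖ * ‖φ z 0‖ ≤ ε * 1 :=
      mul_le_mul e1 (e3.trans hε1) (norm_nonneg _) hε.le
    linarith
  have hle : ‖Q 0 - 1‖ ≤ 0 := by
    refine le_of_forall_pos_le_add fun ε hε => ?_
    have := hz0 (min 1 (ε / 4)) (by positivity) (min_le_left _ _)
    have h4 := min_le_right 1 (ε / 4)
    linarith
  exact sub_eq_zero.1 (norm_le_zero_iff.1 hle)

/-! ### Small spectral parameters -/

theorem exists_bound_of_integrable_deriv (hT : 0 < T) {f f' : ℝ → ℝ}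
    (hi : IntegrableOn f' (timeInterval T))
    (hd : ∀ y ∈ timeInterval T, HasDerivWithinAt f (f' y) (timeInterval T) y) :
    ∃ B, 0 ≤ B ∧ ∀ y ∈ timeInterval T, |f y| ≤ B := by
  have hJ := measurableSet_timeInterval hT
  refine ⟨|f 0| + ∫ x in timeInterval T, |f' x|, ?_, fun y hy => ?_⟩
  · have : 0 ≤ ∫ x in timeInterval T, |f' x| := integral_nonneg fun x => abs_nonneg _
    positivity
  · have h0 := zero_mem_timeInterval hT
    have hsub := Icc_subset_timeInterval h0 hy
    have hint : IntervalIntegrable f' volume 0 y := by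
      rw [intervalIntegrable_iff_integrableOn_Ioc_of_le hy.1]
      exact hi.mono_set (Ioc_subset_Icc_self.trans hsub)
    have heq := intervalIntegral.integral_eq_sub_of_hasDerivAt_of_le hy.1
      (fun x hx => ((hd x (hsub hx)).continuousWithinAt.mono hsub))
      (fun x hx => ((hd x (hsub ⟨hx.1.le, hx.2.le⟩)).mono hsub).hasDerivAt
        (Icc_mem_nhds hx.1 hx.2)) hint
    have hle : |∫ x in (0:ℝ)..y, f' x| ≤ ∫ x in timeInterval T, |f' x| := by
      rw [intervalIntegral.integral_of_le hy.1]
      refine (abs_integral_le_integral_abs).trans ?_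
      exact setIntegral_mono_set hi.abs (ae_of_all _ fun x => abs_nonneg _)
        (LE.le.eventuallyLE (Ioc_subset_Icc_self.trans hsub))
    rw [heq] at hle
    have := abs_sub_abs_le_abs_sub (f y) (f 0)
    linarith

theorem norm_intervalIntegral_le (hT : 0 < T) {f : ℝ → ℂ} {g : ℝ → ℝ}
    (hg : IntegrableOn g (timeInterval T)) (hfg : ∀ x ∈ timeInterval T, 0 ≤ g x)
    {y z : ℝ} (hy : y ∈ timeInterval T) (hz : z ∈ timeInterval T) (hyz : y ≤ z)
    (h : ∀ x ∈ Icc y z, ‖f x‖ ≤ g x) :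
    ‖∫ x in y..z, f x‖ ≤ ∫ x in timeInterval T, g x := by
  have hsub : Ioc y z ⊆ timeInterval T :=
    Ioc_subset_Icc_self.trans (Icc_subset_timeInterval hy hz)
  rw [intervalIntegral.integral_of_le hyz]
  refine (norm_integral_le_of_norm_le (hg.mono_set hsub) ((ae_restrict_iff' measurableSet_Ioc).2
    (ae_of_all _ fun x hx => h x (Ioc_subset_Icc_self hx)))).trans ?_
  exact setIntegral_mono_set hg ((ae_restrict_iff' (measurableSet_timeInterval hT)).2
    (ae_of_all _ hfg)) (LE.le.eventuallyLE hsub)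

theorem norm_exp_le_one_of_im_nonneg {κ : ℂ} (hκ : 0 ≤ κ.im) {s : ℝ} (hs : 0 ≤ s) :
    ‖Complex.exp (2 * Complex.I * κ * (s : ℂ))‖ ≤ 1 := by
  have h1 : (2 * Complex.I * κ * (s : ℂ)).re = -(2 * κ.im * s) := by simp
  rw [Complex.norm_exp, h1]
  have := mul_nonneg (mul_nonneg zero_le_two hκ) hs
  exact Real.exp_le_one_iff.2 (by linarith)

/-- Integration by parts against the oscillating factor. -/
theorem norm_oscillatory_integral_le (hT : 0 < T) {κ : ℂ} (hκ : 0 ≤ κ.im) (hκ0 : κ ≠ 0)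
    {f f' : ℝ → ℂ} (hd : ∀ y ∈ timeInterval T, HasDerivWithinAt f (f' y) (timeInterval T) y)
    (hf' : ContinuousOn f' (timeInterval T)) (hfi : IntegrableOn f (timeInterval T))
    {B : ℝ} (hB : ∀ y ∈ timeInterval T, ‖f y‖ ≤ B) {g : ℝ → ℝ}
    (hg : IntegrableOn g (timeInterval T)) (hfg : ∀ y ∈ timeInterval T, ‖f' y‖ ≤ g y)
    {y : ℝ} (hy : y ∈ timeInterval T) :
    ‖∫ x in timeInterval T ∩ Ici y, Complex.exp (2 * Complex.I * κ * ((x - y : ℝ) : ℂ)) * f x‖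
      ≤ (2 * B + ∫ x in timeInterval T, g x) / ‖κ‖ := by
  have hJ := measurableSet_timeInterval hT
  have hc : ContinuousOn f (timeInterval T) := fun x hx => (hd x hx).continuousWithinAt
  set c : ℂ := 2 * Complex.I * κ with hcdef
  have hc0 : c ≠ 0 := by simp [c, hκ0]
  have hcn : ‖c‖ = 2 * ‖κ‖ := by simp [c]
  have hκn : 0 < ‖κ‖ := norm_pos_iff.2 hκ0
  have hB0 : 0 ≤ B := (norm_nonneg _).trans (hB y hy)
  have hecont : Continuous fun x : ℝ => Complex.exp (c * ((x - y : ℝ) : ℂ)) := by fun_prop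
  have hexp : ∀ x, y ≤ x → ‖Complex.exp (c * ((x - y : ℝ) : ℂ))‖ ≤ 1 := fun x hx =>
    norm_exp_le_one_of_im_nonneg hκ (sub_nonneg.2 hx)
  have hg0 : ∀ x ∈ timeInterval T, 0 ≤ g x := fun x hx => (norm_nonneg _).trans (hfg x hx)
  -- For `x < y` the exponential may exceed `1`; the cut-off gives `|F| ≤ |f|` on the whole
  -- interval.
  set F : ℝ → ℂ := fun x => (Ici y).indicator
    (fun x => Complex.exp (c * ((x - y : ℝ) : ℂ)) * f x) x
  have hFi : IntegrableOn F (timeInterval T) := by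
    refine Integrable.mono' hfi.norm (((hecont.continuousOn.mul hc).aestronglyMeasurable
      hJ).indicator measurableSet_Ici) (ae_of_all _ fun x => ?_)
    by_cases hx : y ≤ x
    · simp only [F, indicator_of_mem (mem_Ici.2 hx), norm_mul]
      exact mul_le_of_le_one_left (norm_nonneg _) (hexp x hx)
    · simp only [F, indicator_of_notMem (by simpa using hx : x ∉ Ici y), norm_zero]
      exact norm_nonneg _
  have hFeq : ∀ x, y ≤ x → F x = Complex.exp (c * ((x - y : ℝ) : ℂ)) * f x := fun x hx =>
    indicator_of_mem (mem_Ici.2 hx) _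
  rw [← setIntegral_congr_fun (hJ.inter measurableSet_Ici) fun x hx => hFeq x hx.2]
  refine norm_setIntegral_tail_le hT hFi hy fun z hz hyz => ?_
  have hsub := Icc_subset_timeInterval hy hz
  have hE : ∀ x : ℝ, HasDerivAt (fun x : ℝ => Complex.exp (c * ((x - y : ℝ) : ℂ)))
      (c * Complex.exp (c * ((x - y : ℝ) : ℂ))) x := by
    intro x
    have h1 : HasDerivAt (fun x : ℝ => c * ((x - y : ℝ) : ℂ)) c x := by
      have := (((hasDerivAt_id x).sub_const y).ofReal_comp).const_mul c
      simpa using this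
    exact h1.cexp.congr_deriv (mul_comm _ _)
  have hP : ∀ x ∈ timeInterval T, HasDerivWithinAt
      (fun x : ℝ => Complex.exp (c * ((x - y : ℝ) : ℂ)) * f x)
      (c * (Complex.exp (c * ((x - y : ℝ) : ℂ)) * f x)
        + Complex.exp (c * ((x - y : ℝ) : ℂ)) * f' x) (timeInterval T) x := fun x hx =>
    ((hE x).hasDerivWithinAt.mul (hd x hx)).congr_deriv (by ring)
  have hi1 : IntervalIntegrable (fun x : ℝ => Complex.exp (c * ((x - y : ℝ) : ℂ)) * f x)
      volume y z :=
    ((hecont.continuousOn.mul hc).mono hsub).intervalIntegrable_of_Icc hyz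
  have hi2 : IntervalIntegrable (fun x : ℝ => Complex.exp (c * ((x - y : ℝ) : ℂ)) * f' x)
      volume y z :=
    ((hecont.continuousOn.mul hf').mono hsub).intervalIntegrable_of_Icc hyz
  have hftc := intervalIntegral.integral_eq_sub_of_hasDerivAt_of_le hyz
    (fun x hx => ((hP x (hsub hx)).continuousWithinAt.mono hsub))
    (fun x hx => ((hP x (hsub ⟨hx.1.le, hx.2.le⟩)).mono hsub).hasDerivAt
      (Icc_mem_nhds hx.1 hx.2)) ((hi1.const_mul c).add hi2)
  rw [intervalIntegral.integral_add (hi1.const_mul c) hi2,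
    intervalIntegral.integral_const_mul] at hftc
  have hFint : ∫ x in y..z, F x
      = ∫ x in y..z, Complex.exp (c * ((x - y : ℝ) : ℂ)) * f x := by
    refine intervalIntegral.integral_congr fun x hx => ?_
    rw [uIcc_of_le hyz] at hx
    exact hFeq x hx.1
  have hb1 : ‖∫ x in y..z, Complex.exp (c * ((x - y : ℝ) : ℂ)) * f' x‖
      ≤ ∫ x in timeInterval T, g x := by
    refine norm_intervalIntegral_le hT hg hg0 hy hz hyz fun x hx => ?_
    rw [norm_mul]
    exact (mul_le_of_le_one_left (norm_nonneg _) (hexp x hx.1)).trans (hfg x (hsub hx))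
  have hb2 : ∀ x ∈ timeInterval T, y ≤ x →
      ‖Complex.exp (c * ((x - y : ℝ) : ℂ)) * f x‖ ≤ B := fun x hx hyx => by
    rw [norm_mul]
    exact (mul_le_of_le_one_left (norm_nonneg _) (hexp x hyx)).trans (hB x hx)
  rw [hFint, le_div_iff₀ hκn]
  set X := ∫ x in y..z, Complex.exp (c * ((x - y : ℝ) : ℂ)) * f x
  have h3 : c * X = Complex.exp (c * ((z - y : ℝ) : ℂ)) * f z
      - Complex.exp (c * ((y - y : ℝ) : ℂ)) * f y
      - ∫ x in y..z, Complex.exp (c * ((x - y : ℝ) : ℂ)) * f' x := by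
    rw [← hftc]; ring
  have h4 : ‖c * X‖ ≤ B + B + ∫ x in timeInterval T, g x := by
    rw [h3]
    exact (norm_sub_le _ _).trans (add_le_add ((norm_sub_le _ _).trans
      (add_le_add (hb2 z hz hyz) (hb2 y hy le_rfl))) hb1)
  -- Since `|c| = 2|κ|`, a factor `2` is given away.
  rw [norm_mul, hcn] at h4
  have := mul_nonneg hκn.le (norm_nonneg X)
  linarith

/-- In the first component, `w ψ₁` is the only term without a factor `k`. The component `ψ₁`
satisfies an equation free of `κ`, so the derivative of `w ψ₁` is integrable uniformly in `k`, and
integration by parts costs `1/|κ| ≤ 16|k|`. This gives `ψ₀ = O(k)` uniformly in `y`. In the equation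
of `ψ₁ - 1` every term then contains `ψ₀` or `k`. -/
theorem IsLaxData.exists_small_bound (h : IsLaxData T α β w w') (hT : 0 < T) {κ : ℂ → ℂ}
    (hκ1 : ∀ k : ℂ, k ≠ 0 → ‖k‖ ≤ 1 / 4 → 1 ≤ 16 * ‖k‖ * ‖κ k‖) :
    ∃ C : ℝ, ∀ k : ℂ, k ≠ 0 → ‖k‖ ≤ 1 / 4 → 0 ≤ (κ k).im →
      ‖laxColumn T α β w (κ k) k 0 1 - 1‖ ≤ C * ‖k‖ ∧
      ‖laxColumn T α β w (κ k) k 0 0‖ ≤ C * ‖k‖ := by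
  have hJ := measurableSet_timeInterval hT
  have h0 := zero_mem_timeInterval hT
  set μ := laxMajorant α β w 1
  have hμ : IsMajorant T μ := h.isMajorant zero_le_one
  have hm := hμ.const_mul (c := 2 * 1) (by norm_num)
  set M := ∫ x in timeInterval T, 2 * 1 * μ x
  set C₁ := 2 * 1 * Real.exp (2 * M)
  have hC₁ : 0 ≤ C₁ := by positivity
  obtain ⟨B, hB0, hB⟩ := exists_bound_of_integrable_deriv hT h.int_deriv h.hasDeriv
  set n : ℝ → ℝ := fun x => |α x| + |β x|
  have hni : IntegrableOn n (timeInterval T) := h.int_diag.abs.add h.int_off.abs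
  set N := ∫ x in timeInterval T, n x
  have hN : 0 ≤ N := integral_nonneg fun x => by positivity
  set g : ℝ → ℝ := fun x => |w' x| * C₁ + B * (2 * 1 * μ x * C₁)
  have hgi : IntegrableOn g (timeInterval T) :=
    (h.int_deriv.abs.mul_const C₁).add ((hm.integrableOn.mul_const C₁).const_mul B)
  set D := 2 * (B * C₁) + ∫ x in timeInterval T, g x
  set W := ∫ x in timeInterval T, |w x|
  have hW : 0 ≤ W := integral_nonneg fun x => abs_nonneg _
  have hD : 0 ≤ D := by
    have : 0 ≤ ∫ x in timeInterval T, g x := setIntegral_nonneg hJ fun x hx => by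
      have := hμ.nonneg x hx
      positivity
    positivity
  -- `N * C₁` comes from the coefficients proportional to `k`, and `16 * D` from the integration by
  -- parts.
  set C₀ := N * C₁ + 16 * D
  have hC₀ : 0 ≤ C₀ := by positivity
  set C' := (W + N) * C₀ + N * C₁
  refine ⟨max C₀ C', fun k hk0 hk hκ => ?_⟩
  have hk1 : ‖k‖ ≤ 1 := hk.trans (by norm_num)
  have hκ0 : κ k ≠ 0 := by
    intro h0; have := hκ1 k hk0 hk; simp [h0] at this; linarith
  have hexp : ∀ y x : ℝ, y ≤ x →
      ‖Complex.exp (2 * Complex.I * κ k * ((x - y : ℝ) : ℂ))‖ ≤ 1 := fun y x hyx =>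
    norm_exp_le_one_of_im_nonneg hκ (sub_nonneg.2 hyx)
  have hG := h.isVolterraKernel (κ := κ k) hk1 le_rfl fun y _ x _ hyx => hexp y x hyx
  have hψ := h.isVolterraSol hT (Or.inr hκ) hm hG
  set ψ := laxColumn T α β w (κ k) k
  have hψb : ∀ y ∈ timeInterval T, ‖ψ y‖ ≤ C₁ :=
    hψ.norm_le hT hm hG (fun _ _ => norm_unitCol_le)
  have hψ0 : ∀ y ∈ timeInterval T, ‖ψ y 0‖ ≤ C₁ := fun y hy =>
    (norm_le_pi_norm _ 0).trans (hψb y hy)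
  have hψ1 : ∀ y ∈ timeInterval T, ‖ψ y 1‖ ≤ C₁ := fun y hy =>
    (norm_le_pi_norm _ 1).trans (hψb y hy)
  have hc0 : ContinuousOn (fun y => ψ y 0) (timeInterval T) := continuousOn_pi.1 hψ.continuousOn 0
  have hc1 : ContinuousOn (fun y => ψ y 1) (timeInterval T) := continuousOn_pi.1 hψ.continuousOn 1
  have hofR : ∀ {g : ℝ → ℝ}, ContinuousOn g (timeInterval T) →
      ContinuousOn (fun y => (g y : ℂ)) (timeInterval T) := fun hg =>
    Complex.continuous_ofReal.comp_continuousOn hg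
  have hcα := hofR h.cont_diag
  have hcβ := hofR h.cont_off
  have hcw := hofR h.cont_free
  have hcw' := hofR h.cont_deriv
  -- the smooth part of the first component
  have hd : ∀ y ∈ timeInterval T, HasDerivWithinAt (fun y => (w y : ℂ) * ψ y 1)
      ((w' y : ℂ) * ψ y 1 + w y * laxKernel α β w (κ k) k 0 y (ψ y) 1) (timeInterval T) y :=
    fun y hy => (h.hasDeriv y hy).ofReal_comp.mul (hψ.hasDerivWithinAt_one hT hm hG hy)
  have hker : ∀ y ∈ timeInterval T, ‖laxKernel α β w (κ k) k 0 y (ψ y) 1‖ ≤ 2 * 1 * μ y * C₁ :=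
    fun y hy => (norm_le_pi_norm _ 1).trans (norm_apply_le_of_bound hG hψb h0 hy hy.1)
  have hwb : ∀ y ∈ timeInterval T, ‖(w y : ℂ)‖ ≤ B := fun y hy => by
    rw [Complex.norm_real]; exact hB y hy
  have hosc : ∀ y ∈ timeInterval T, ‖∫ x in timeInterval T ∩ Ici y,
      Complex.exp (2 * Complex.I * κ k * ((x - y : ℝ) : ℂ)) * (w x * ψ x 1)‖
      ≤ D / ‖κ k‖ := by
    intro y hy
    refine norm_oscillatory_integral_le hT hκ hκ0 hd ?_ ?_ (B := B * C₁) ?_ hgi ?_ hy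
    · simp only [laxKernel_apply_one]
      fun_prop
    · refine Integrable.mono' (h.int_free.abs.mul_const C₁)
        ((hcw.mul hc1).aestronglyMeasurable hJ)
        ((ae_restrict_iff' hJ).2 (ae_of_all _ fun x hx => ?_))
      rw [norm_mul, Complex.norm_real]
      exact mul_le_mul_of_nonneg_left (hψ1 x hx) (abs_nonneg _)
    · intro x hx
      rw [norm_mul]
      exact mul_le_mul (hwb x hx) (hψ1 x hx) (norm_nonneg _) hB0
    · intro x hx
      refine (norm_add_le _ _).trans (add_le_add ?_ ?_)
      · rw [norm_mul, Complex.norm_real]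
        exact mul_le_mul_of_nonneg_left (hψ1 x hx) (abs_nonneg _)
      · rw [norm_mul]
        exact mul_le_mul (hwb x hx) (hker x hx) (norm_nonneg _) hB0
  have hnb : ∀ x ∈ timeInterval T, ∀ v : Fin 2 → ℂ, ‖v 0‖ ≤ C₁ → ‖v 1‖ ≤ C₁ →
      ‖Complex.I * α x * k * v 0 - β x * k * v 1‖ ≤ ‖k‖ * (n x * C₁) := by
    intro x _ v h1 h2
    refine (norm_sub_le _ _).trans ?_
    simp only [norm_mul, Complex.norm_I, Complex.norm_real, Real.norm_eq_abs, one_mul, n]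
    have e1 := mul_le_mul_of_nonneg_left h1 (mul_nonneg (abs_nonneg (α x)) (norm_nonneg k))
    have e2 := mul_le_mul_of_nonneg_left h2 (mul_nonneg (abs_nonneg (β x)) (norm_nonneg k))
    linarith
  have htailn : ∀ y, ∫ x in timeInterval T ∩ Ici y, n x ≤ N := fun y =>
    setIntegral_mono_set hni (ae_of_all _ fun x => by positivity)
      (LE.le.eventuallyLE inter_subset_left)
  have hkey0 : ∀ y ∈ timeInterval T, ‖ψ y 0‖ ≤ C₀ * ‖k‖ := by
    intro y hy
    have hmeas := hJ.inter (measurableSet_Ici (a := y))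
    set e : ℝ → ℂ := fun x => Complex.exp (2 * Complex.I * κ k * ((x - y : ℝ) : ℂ))
    have hec : Continuous e := by fun_prop
    have hi1 : IntegrableOn (fun x => e x * (w x * ψ x 1)) (timeInterval T ∩ Ici y) := by
      refine Integrable.mono' (((h.int_free.mono_set inter_subset_left).abs).mul_const C₁)
        (((hec.continuousOn.mul (hcw.mul hc1)).mono inter_subset_left).aestronglyMeasurable hmeas)
        ((ae_restrict_iff' hmeas).2 (ae_of_all _ fun x hx => ?_))
      rw [norm_mul, norm_mul, Complex.norm_real]
      refine (mul_le_of_le_one_left (by positivity) (hexp y x hx.2)).trans ?_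
      exact mul_le_mul_of_nonneg_left (hψ1 x hx.1) (abs_nonneg _)
    have hbound2 : ∀ x ∈ timeInterval T, y ≤ x →
        ‖e x * (Complex.I * α x * k * ψ x 0 - β x * k * ψ x 1)‖ ≤ ‖k‖ * (n x * C₁) := by
      intro x hx hyx
      rw [norm_mul]
      exact (mul_le_of_le_one_left (norm_nonneg _) (hexp y x hyx)).trans
        (hnb x hx (ψ x) (hψ0 x hx) (hψ1 x hx))
    have hi2 : IntegrableOn (fun x => e x * (Complex.I * α x * k * ψ x 0 - β x * k * ψ x 1))
        (timeInterval T ∩ Ici y) := by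
      refine Integrable.mono' (((hni.mono_set inter_subset_left).mul_const C₁).const_mul ‖k‖) ?_
        ((ae_restrict_iff' hmeas).2 (ae_of_all _ fun x hx => hbound2 x hx.1 hx.2))
      refine ContinuousOn.aestronglyMeasurable ?_ hmeas
      refine ContinuousOn.mono (s := timeInterval T) ?_ inter_subset_left
      fun_prop
    have hsplit : ψ y 0 = -(Complex.I * (∫ x in timeInterval T ∩ Ici y, e x * (w x * ψ x 1))
        + ∫ x in timeInterval T ∩ Ici y,
          e x * (Complex.I * α x * k * ψ x 0 - β x * k * ψ x 1)) := by
      rw [hψ.apply_zero_eq hT hm hG hy, ← integral_const_mul, ← integral_add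
        (hi1.const_mul _) hi2]
      congr 2
      ext x
      rw [laxKernel_apply_zero]
      simp only [e]; ring
    rw [hsplit, norm_neg]
    have hb1 : ‖Complex.I * ∫ x in timeInterval T ∩ Ici y, e x * (w x * ψ x 1)‖
        ≤ 16 * D * ‖k‖ := by
      rw [norm_mul, Complex.norm_I, one_mul]
      refine (hosc y hy).trans ?_
      rw [div_le_iff₀ (norm_pos_iff.2 hκ0)]
      have := mul_le_mul_of_nonneg_left (hκ1 k hk0 hk) hD
      linarith
    have hb2 : ‖∫ x in timeInterval T ∩ Ici y,
        e x * (Complex.I * α x * k * ψ x 0 - β x * k * ψ x 1)‖ ≤ ‖k‖ * (N * C₁) := by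
      refine (norm_setIntegral_inter_le hT ((hni.mul_const C₁).const_mul ‖k‖) hbound2).trans ?_
      rw [integral_const_mul, integral_mul_const]
      exact mul_le_mul_of_nonneg_left (mul_le_mul_of_nonneg_right (htailn y) hC₁) (norm_nonneg _)
    refine (norm_add_le _ _).trans ((add_le_add hb1 hb2).trans_eq ?_)
    simp only [C₀]; ring
  have hkey1 : ‖ψ 0 1 - 1‖ ≤ C' * ‖k‖ := by
    have heq := congrFun (hψ.eqn 0 h0) 1
    have hint := hG.integrableOn hT hm hψ.continuousOn hψ.bounded h0
    have h1 : (volterraOp T (laxKernel α β w (κ k) k) ψ 0) 1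
        = ∫ x in timeInterval T ∩ Ici 0, laxKernel α β w (κ k) k 0 x (ψ x) 1 :=
      ((ContinuousLinearMap.proj (R := ℂ) (φ := fun _ : Fin 2 => ℂ) 1).integral_comp_comm
        hint).symm
    rw [Pi.sub_apply, h1] at heq
    have h2 : ψ 0 1 - 1
        = -∫ x in timeInterval T ∩ Ici 0, laxKernel α β w (κ k) k 0 x (ψ x) 1 := by
      rw [heq]; simp [unitCol]
    rw [h2, norm_neg]
    have hgi' : IntegrableOn (fun x => (|w x| + n x) * (C₀ * ‖k‖) + n x * (C₁ * ‖k‖))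
        (timeInterval T) :=
      ((h.int_free.abs.add hni).mul_const _).add (hni.mul_const _)
    have hle : ∀ x ∈ timeInterval T, (0:ℝ) ≤ x → ‖laxKernel α β w (κ k) k 0 x (ψ x) 1‖
        ≤ (|w x| + n x) * (C₀ * ‖k‖) + n x * (C₁ * ‖k‖) := by
      intro x hx _
      rw [laxKernel_apply_one]
      refine (norm_sub_le _ _).trans (add_le_add ?_ ?_)
      · rw [norm_mul]
        refine mul_le_mul ?_ (hkey0 x hx) (norm_nonneg _) (by positivity)
        refine (norm_add_le _ _).trans ?_
        simp only [norm_mul, Complex.norm_I, Complex.norm_real, Real.norm_eq_abs, one_mul, n]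
        have := mul_le_of_le_one_right (abs_nonneg (β x)) hk1
        have := abs_nonneg (α x)
        linarith
      · simp only [norm_mul, Complex.norm_I, Complex.norm_real, Real.norm_eq_abs, one_mul, n]
        have e1 := mul_le_mul_of_nonneg_left (hψ1 x hx)
          (mul_nonneg (abs_nonneg (α x)) (norm_nonneg k))
        have e2 : 0 ≤ |β x| * (C₁ * ‖k‖) := by positivity
        linarith
    refine (norm_setIntegral_inter_le hT hgi' hle).trans ?_
    have hwn : IntegrableOn (fun x => |w x| + n x) (timeInterval T) := h.int_free.abs.add hni
    rw [timeInterval_inter_Ici_zero, integral_add (hwn.mul_const _) (hni.mul_const _),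
      integral_mul_const, integral_mul_const]
    have hadd : ∫ x in timeInterval T, |w x| + n x = W + N := integral_add h.int_free.abs hni
    rw [hadd]
    simp only [C']
    apply le_of_eq; ring
  exact ⟨hkey1.trans (mul_le_mul_of_nonneg_right (le_max_right _ _) (norm_nonneg _)),
    (hkey0 0 h0).trans (mul_le_mul_of_nonneg_right (le_max_left _ _) (norm_nonneg _))⟩

/-! ### The symmetry between the two columns -/

/-- The potential satisfies `σ₂ conj(V(conj k)) σ₂ = V(k)`, because `α`, `β`, `w` are real;
conjugation followed by this rotation exchanges the two columns. -/
theorem IsVolterraColumn.conj_one {κ k : ℂ} {J : Set ℝ} {ψ : ℝ → Fin 2 → ℂ}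
    (h : IsVolterraColumn (laxPotential α β w (conj k)) (conj κ) J 1 ψ) :
    IsVolterraColumn (laxPotential α β w k) κ J 0 fun y => ![conj (ψ y 1), -conj (ψ y 0)] := by
  refine ⟨?_, ?_, fun y hy i => ?_⟩
  · have h0 := continuousOn_pi.1 h.continuousOn
    refine continuousOn_pi.2 fun i => ?_
    fin_cases i
    · exact Complex.continuous_conj.comp_continuousOn (h0 1)
    · exact (Complex.continuous_conj.comp_continuousOn (h0 0)).neg
  · obtain ⟨C, hC⟩ := h.bounded
    refine ⟨C, fun y hy i => ?_⟩
    fin_cases i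
    · simpa using hC y hy 1
    · simpa using hC y hy 0
  · fin_cases i
    · have h1 := congrArg conj (h.eqn y hy 1)
      rw [map_sub, ← integral_conj] at h1
      simp only [Fin.zero_eta, Matrix.cons_val_zero]
      rw [h1]
      simp [Matrix.mulVec, dotProduct, Fin.sum_univ_two, sgn]
      exact congrArg₂ (· - ·) (Matrix.one_apply_eq _).symm (by congr 1; ext x; ring)
    · have h1 := congrArg conj (h.eqn y hy 0)
      rw [map_sub, ← integral_conj] at h1
      simp only [Fin.mk_one, Matrix.cons_val_one]
      rw [h1]
      simp [Matrix.mulVec, dotProduct, Fin.sum_univ_two, sgn, ← Complex.exp_conj]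
      rw [← integral_neg]
      congr 1; ext x; ring_nf

theorem IsVolterraColumn.conj_zero {κ k : ℂ} {J : Set ℝ} {φ : ℝ → Fin 2 → ℂ}
    (h : IsVolterraColumn (laxPotential α β w k) κ J 0 φ) :
    IsVolterraColumn (laxPotential α β w (conj k)) (conj κ) J 1
      fun y => ![-conj (φ y 1), conj (φ y 0)] := by
  refine ⟨?_, ?_, fun y hy i => ?_⟩
  · have h0 := continuousOn_pi.1 h.continuousOn
    refine continuousOn_pi.2 fun i => ?_
    fin_cases i
    · exact (Complex.continuous_conj.comp_continuousOn (h0 1)).neg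
    · exact Complex.continuous_conj.comp_continuousOn (h0 0)
  · obtain ⟨C, hC⟩ := h.bounded
    refine ⟨C, fun y hy i => ?_⟩
    fin_cases i
    · simpa using hC y hy 1
    · simpa using hC y hy 0
  · fin_cases i
    · have h1 := congrArg conj (h.eqn y hy 1)
      rw [map_sub, ← integral_conj] at h1
      simp only [Fin.zero_eta, Matrix.cons_val_zero]
      rw [h1]
      simp [Matrix.mulVec, dotProduct, Fin.sum_univ_two, sgn, ← Complex.exp_conj]
      rw [← integral_neg]
      congr 1; ext x; ring_nf
    · have h1 := congrArg conj (h.eqn y hy 0)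
      rw [map_sub, ← integral_conj] at h1
      simp only [Fin.mk_one, Matrix.cons_val_one]
      rw [h1]
      simp [Matrix.mulVec, dotProduct, Fin.sum_univ_two, sgn]
      exact congrArg₂ (· - ·) (Matrix.one_apply_eq _).symm (by congr 1; ext x; ring)

/-- The maps of `conj_one` and `conj_zero` are mutually inverse, so existence and uniqueness pass
from the second column to the first. -/
theorem IsLaxData.hasUniqueColumn_zero (h : IsLaxData T α β w w') (hT : 0 < T) {κ k : ℂ}
    (hκ : T < ⊤ ∨ κ.im ≤ 0) :
    HasUniqueColumn (laxPotential α β w k) κ (timeInterval T) 0 := by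
  have hκ' : T < ⊤ ∨ 0 ≤ (conj κ).im := hκ.imp_right fun h => by simpa using h
  obtain ⟨ψ, hψ, huniq⟩ := h.hasUniqueColumn hT (k := conj k) hκ'
  refine ⟨_, hψ.conj_one, fun φ hφ y hy => ?_⟩
  have := huniq _ hφ.conj_zero hy
  ext i
  simp only [← this]
  fin_cases i <;> simp

theorem IsLaxData.column_zero_eq (h : IsLaxData T α β w w') (hT : 0 < T) {κ k : ℂ}
    (hκ : T < ⊤ ∨ κ.im ≤ 0) :
    volterraColumn (laxPotential α β w k) κ (timeInterval T) 0 0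
      = ![conj (laxColumn T α β w (conj κ) (conj k) 0 1),
        -conj (laxColumn T α β w (conj κ) (conj k) 0 0)] := by
  have hκ' : T < ⊤ ∨ 0 ≤ (conj κ).im := hκ.imp_right fun h => by simpa using h
  have h1 := (h.hasUniqueColumn_zero hT (k := k) hκ)
  have h2 := (h.hasUniqueColumn hT (k := conj k) hκ').spec.conj_one
  obtain ⟨φ, hφ, hu⟩ := h1
  have h3 := (HasUniqueColumn.spec ⟨φ, hφ, hu⟩)
  have h0 := zero_mem_timeInterval hT
  rw [hu _ h3 h0, ← hu _ h2 h0]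

end

section

variable {T : EReal}

/-! ### The coefficients of the potentials of the Lax pair -/

/-- The coefficient of `σ₁` in both potentials, up to the factor `∓ i / 4`. -/
def freeCoeff (u ux ut : ℝ) : ℝ :=
  Real.sin u - ut * (1 - Real.cos u) + ux * (1 + Real.cos u)

def diagCoeff₁ (u ux ut : ℝ) : ℝ :=
  Real.sin (u / 2) ^ 2 * (Real.cos u - (ut + ux) * Real.sin u)

def offCoeff₁ (u ux ut : ℝ) : ℝ :=
  Real.sin (u / 2) ^ 2 * ((ut + ux) * Real.cos u + Real.sin u)

def diagCoeff₂ (u ux ut : ℝ) : ℝ :=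
  (-3 + 2 * Real.cos u + Real.cos (2 * u)
    - (ut + ux) * (2 * Real.sin u + Real.sin (2 * u))) / 4

def offCoeff₂ (u ux ut : ℝ) : ℝ :=
  Real.cos (u / 2) ^ 2 * ((ut + ux) * Real.cos u + Real.sin u)

theorem V1_eq_laxPotential (u ux ut : ℝ → ℝ) (k : ℂ) (y : ℝ) :
    V1 (u y) (ux y) (ut y) k = laxPotential (fun y => diagCoeff₁ (u y) (ux y) (ut y))
      (fun y => offCoeff₁ (u y) (ux y) (ut y)) (fun y => -(freeCoeff (u y) (ux y) (ut y) / 4)) k y := by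
  unfold V1 laxPotential
  rw [sub_eq_add_neg _ (_ • sigma1), ← neg_smul]
  congr 2
  simp only [freeCoeff]
  push_cast; ring

theorem V2_eq_laxPotential (u ux ut : ℝ → ℝ) (k : ℂ) (y : ℝ) :
    V2 (u y) (ux y) (ut y) k = laxPotential (fun y => diagCoeff₂ (u y) (ux y) (ut y))
      (fun y => offCoeff₂ (u y) (ux y) (ut y)) (fun y => freeCoeff (u y) (ux y) (ut y) / 4) k y := by
  unfold V2 laxPotential
  congr 2
  · congr 2
    simp only [diagCoeff₂]
    push_cast; ring
  · simp only [freeCoeff]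
    push_cast; ring

/-- This bound and the next one let integrability of `u - 2πn` control the terms that do not contain
`u_x` or `u_t`. -/
theorem abs_sin_le_dist (u : ℝ) (n : ℤ) : |Real.sin u| ≤ |u - 2 * Real.pi * n| := by
  rw [← Real.sin_sub_int_mul_two_pi u n, show (n : ℝ) * (2 * Real.pi) = 2 * Real.pi * n by ring]
  exact Real.abs_sin_le_abs

theorem one_sub_cos_le_dist (u : ℝ) (n : ℤ) : 1 - Real.cos u ≤ |u - 2 * Real.pi * n| := by
  rw [← Real.cos_sub_int_mul_two_pi u n, show (n : ℝ) * (2 * Real.pi) = 2 * Real.pi * n by ring]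
  have := Real.abs_cos_sub_cos_le (u - 2 * Real.pi * n) 0
  rw [Real.cos_zero, sub_zero, abs_sub_comm] at this
  exact (le_abs_self _).trans this

/-! ### Pointwise bounds of the coefficients by `|u_t| + |u_x| + |u - 2πn|`. -/

section Bounds

variable (u ux ut : ℝ) (n : ℤ)

theorem abs_mul_le_of_abs_le {a b c : ℝ} (hb : |b| ≤ c) : |a * b| ≤ |a| * c := by
  rw [abs_mul]; exact mul_le_mul_of_nonneg_left hb (abs_nonneg a)

theorem abs_offFactor_le :
    |(ut + ux) * Real.cos u + Real.sin u| ≤ |ut| + |ux| + |u - 2 * Real.pi * n| := by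
  have h1 := abs_mul_le_of_abs_le (a := ut + ux) (Real.abs_cos_le_one u)
  have h2 := abs_sin_le_dist u n
  have h3 := abs_add_le ut ux
  have h4 := abs_add_le ((ut + ux) * Real.cos u) (Real.sin u)
  linarith

theorem abs_offCoeff₁_le : |offCoeff₁ u ux ut| ≤ |ut| + |ux| + |u - 2 * Real.pi * n| := by
  rw [offCoeff₁, abs_mul, abs_of_nonneg (sq_nonneg _)]
  exact (mul_le_of_le_one_left (abs_nonneg _) (Real.sin_sq_le_one _)).trans
    (abs_offFactor_le u ux ut n)

theorem abs_offCoeff₂_le : |offCoeff₂ u ux ut| ≤ |ut| + |ux| + |u - 2 * Real.pi * n| := by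
  rw [offCoeff₂, abs_mul, abs_of_nonneg (sq_nonneg _)]
  exact (mul_le_of_le_one_left (abs_nonneg _) (Real.cos_sq_le_one _)).trans
    (abs_offFactor_le u ux ut n)

theorem abs_diagCoeff₁_le : |diagCoeff₁ u ux ut| ≤ |ut| + |ux| + |u - 2 * Real.pi * n| := by
  have h0 : Real.sin (u / 2) ^ 2 = (1 - Real.cos u) / 2 := by
    rw [Real.sin_sq_eq_half_sub, mul_div_cancel₀ u two_ne_zero]; ring
  have h1 := one_sub_cos_le_dist u n
  have h2 := Real.sin_sq_le_one (u / 2)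
  have h3 : |Real.cos u - (ut + ux) * Real.sin u| ≤ 1 + (|ut| + |ux|) := by
    have e1 := abs_mul_le_of_abs_le (a := ut + ux) (Real.abs_sin_le_one u)
    have e2 := abs_sub (Real.cos u) ((ut + ux) * Real.sin u)
    have e3 := abs_add_le ut ux
    have e4 := Real.abs_cos_le_one u
    linarith
  rw [diagCoeff₁, abs_mul, abs_of_nonneg (sq_nonneg _)]
  have h4 := mul_le_mul_of_nonneg_left h3 (sq_nonneg (Real.sin (u / 2)))
  have h5 := mul_le_of_le_one_left (add_nonneg (abs_nonneg ut) (abs_nonneg ux)) h2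
  have h6 := sq_nonneg (Real.sin (u / 2))
  linarith

theorem abs_diagCoeff₂_le :
    |diagCoeff₂ u ux ut| ≤ 2 * (|ut| + |ux| + |u - 2 * Real.pi * n|) := by
  have h1 := one_sub_cos_le_dist u n
  -- The factorization makes visible that the part free of derivatives vanishes where `cos u = 1`.
  have h2 : diagCoeff₂ u ux ut = -((Real.cos u + 2) * (1 - Real.cos u)) / 2
      - (ut + ux) * (Real.sin u * (1 + Real.cos u)) / 2 := by
    rw [diagCoeff₂, Real.cos_two_mul, Real.sin_two_mul]; ring
  have hc := abs_le.1 (Real.abs_cos_le_one u)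
  have h3 : |(Real.cos u + 2) * (1 - Real.cos u)| ≤ 3 * |u - 2 * Real.pi * n| := by
    rw [abs_of_nonneg (mul_nonneg (by linarith) (by linarith))]
    exact mul_le_mul (by linarith) h1 (by linarith) (by norm_num)
  have h4 : |Real.sin u * (1 + Real.cos u)| ≤ 1 * 2 := by
    rw [abs_mul]
    refine mul_le_mul (Real.abs_sin_le_one u) ?_ (abs_nonneg _) zero_le_one
    rw [abs_le]; constructor <;> linarith
  have h5 := abs_mul_le_of_abs_le (a := ut + ux) h4
  have h6 := abs_add_le ut ux
  rw [h2]
  refine (abs_sub _ _).trans ?_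
  rw [abs_div, abs_neg, abs_div, abs_two]
  linarith [abs_nonneg (u - 2 * Real.pi * n), abs_nonneg ut, abs_nonneg ux]

theorem abs_freeCoeff_le : |freeCoeff u ux ut| ≤ 2 * (|ut| + |ux| + |u - 2 * Real.pi * n|) := by
  have hc := abs_le.1 (Real.abs_cos_le_one u)
  have h1 := abs_sin_le_dist u n
  have h2 := abs_mul_le_of_abs_le (a := ut) (b := 1 - Real.cos u) (c := 2)
    (by rw [abs_le]; constructor <;> linarith)
  have h3 := abs_mul_le_of_abs_le (a := ux) (b := 1 + Real.cos u) (c := 2)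
    (by rw [abs_le]; constructor <;> linarith)
  have h4 := abs_add_le (Real.sin u - ut * (1 - Real.cos u)) (ux * (1 + Real.cos u))
  have h5 := abs_sub (Real.sin u) (ut * (1 - Real.cos u))
  rw [freeCoeff]
  linarith [abs_nonneg (u - 2 * Real.pi * n)]

end Bounds

/-- The values `u`, `p = u_x`, `r = u_t` along an axis, with their derivatives along that axis. -/
structure IsBoundaryJet (T : EReal) (u p r u' p' r' : ℝ → ℝ) : Prop where
  decay : ∃ n : ℤ, IntegrableOn (fun y => u y - 2 * Real.pi * n) (timeInterval T)
  int_p : IntegrableOn p (timeInterval T)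
  int_r : IntegrableOn r (timeInterval T)
  int_u' : IntegrableOn u' (timeInterval T)
  int_p' : IntegrableOn p' (timeInterval T)
  int_r' : IntegrableOn r' (timeInterval T)
  cont_u' : ContinuousOn u' (timeInterval T)
  cont_p' : ContinuousOn p' (timeInterval T)
  cont_r' : ContinuousOn r' (timeInterval T)
  deriv_u : ∀ y ∈ timeInterval T, HasDerivWithinAt u (u' y) (timeInterval T) y
  deriv_p : ∀ y ∈ timeInterval T, HasDerivWithinAt p (p' y) (timeInterval T) y
  deriv_r : ∀ y ∈ timeInterval T, HasDerivWithinAt r (r' y) (timeInterval T) y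

variable {u p r u' p' r' : ℝ → ℝ}

/-- The derivative of `freeCoeff` along a boundary jet. -/
def freeCoeffDeriv (u p r u' p' r' : ℝ) : ℝ :=
  Real.cos u * u' - (r' * (1 - Real.cos u) + r * (Real.sin u * u'))
    + (p' * (1 + Real.cos u) - p * (Real.sin u * u'))

theorem IsBoundaryJet.hasDeriv_freeCoeff (h : IsBoundaryJet T u p r u' p' r') {y : ℝ}
    (hy : y ∈ timeInterval T) :
    HasDerivWithinAt (fun y => freeCoeff (u y) (p y) (r y))
      (freeCoeffDeriv (u y) (p y) (r y) (u' y) (p' y) (r' y)) (timeInterval T) y := by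
  have hu := h.deriv_u y hy
  have := (hu.sin.sub ((h.deriv_r y hy).mul (hu.cos.const_sub 1))).add
    ((h.deriv_p y hy).mul (hu.cos.const_add 1))
  exact this.congr_deriv (by rw [freeCoeffDeriv]; ring)

theorem IsBoundaryJet.integrableOn_of_bound (h : IsBoundaryJet T u p r u' p' r') (hT : 0 < T)
    {g : ℝ → ℝ} (hg : ContinuousOn g (timeInterval T))
    (hb : ∀ (n : ℤ) y, |g y| ≤ 2 * (|r y| + |p y| + |u y - 2 * Real.pi * n|)) :
    IntegrableOn g (timeInterval T) := by
  obtain ⟨n, hn⟩ := h.decay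
  exact Integrable.mono' (((h.int_r.abs.add h.int_p.abs).add hn.abs).const_mul 2)
    (hg.aestronglyMeasurable (measurableSet_timeInterval hT)) (ae_of_all _ fun y => hb n y)

theorem IsBoundaryJet.continuousOn (h : IsBoundaryJet T u p r u' p' r') :
    ContinuousOn u (timeInterval T) ∧ ContinuousOn p (timeInterval T) ∧
      ContinuousOn r (timeInterval T) :=
  ⟨fun y hy => (h.deriv_u y hy).continuousWithinAt,
    fun y hy => (h.deriv_p y hy).continuousWithinAt,
    fun y hy => (h.deriv_r y hy).continuousWithinAt⟩

/-- The products `p u'` and `r u'` are integrable because `p` and `r`, having integrable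
derivatives, are bounded. -/
theorem IsBoundaryJet.integrableOn_freeCoeffDeriv (h : IsBoundaryJet T u p r u' p' r')
    (hT : 0 < T) :
    IntegrableOn (fun y => freeCoeffDeriv (u y) (p y) (r y) (u' y) (p' y) (r' y))
      (timeInterval T) := by
  obtain ⟨hu, hp, hr⟩ := h.continuousOn
  have hu' := h.cont_u'
  have hp' := h.cont_p'
  have hr' := h.cont_r'
  have hJ := measurableSet_timeInterval hT
  obtain ⟨B₁, hB₁, hpB⟩ := exists_bound_of_integrable_deriv hT h.int_p' h.deriv_p
  obtain ⟨B₂, hB₂, hrB⟩ := exists_bound_of_integrable_deriv hT h.int_r' h.deriv_r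
  refine Integrable.mono' ((h.int_u'.abs.const_mul (1 + B₁ + B₂)).add
    ((h.int_r'.abs.const_mul 2).add (h.int_p'.abs.const_mul 2))) ?_
    ((ae_restrict_iff' hJ).2 (ae_of_all _ fun y hy => ?_))
  · refine ContinuousOn.aestronglyMeasurable ?_ hJ
    unfold freeCoeffDeriv
    fun_prop
  · have hc := abs_le.1 (Real.abs_cos_le_one (u y))
    have e1 : |Real.cos (u y) * u' y| ≤ |u' y| := by
      rw [abs_mul]; exact mul_le_of_le_one_left (abs_nonneg _) (Real.abs_cos_le_one _)
    have e2 : |Real.sin (u y) * u' y| ≤ |u' y| := by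
      rw [abs_mul]; exact mul_le_of_le_one_left (abs_nonneg _) (Real.abs_sin_le_one _)
    have e3 := abs_mul_le_of_abs_le (a := r' y) (b := 1 - Real.cos (u y)) (c := 2)
      (by rw [abs_le]; constructor <;> linarith)
    have e4 := abs_mul_le_of_abs_le (a := p' y) (b := 1 + Real.cos (u y)) (c := 2)
      (by rw [abs_le]; constructor <;> linarith)
    have e5 : |r y * (Real.sin (u y) * u' y)| ≤ B₂ * |u' y| := by
      rw [abs_mul]; exact mul_le_mul (hrB y hy) e2 (abs_nonneg _) hB₂
    have e6 : |p y * (Real.sin (u y) * u' y)| ≤ B₁ * |u' y| := by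
      rw [abs_mul]; exact mul_le_mul (hpB y hy) e2 (abs_nonneg _) hB₁
    have f1 := abs_add_le (Real.cos (u y) * u' y - (r' y * (1 - Real.cos (u y))
      + r y * (Real.sin (u y) * u' y)))
      (p' y * (1 + Real.cos (u y)) - p y * (Real.sin (u y) * u' y))
    have f2 := abs_sub (Real.cos (u y) * u' y) (r' y * (1 - Real.cos (u y))
      + r y * (Real.sin (u y) * u' y))
    have f3 := abs_add_le (r' y * (1 - Real.cos (u y))) (r y * (Real.sin (u y) * u' y))
    have f4 := abs_sub (p' y * (1 + Real.cos (u y))) (p y * (Real.sin (u y) * u' y))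
    rw [Real.norm_eq_abs, freeCoeffDeriv]
    simp only [Pi.add_apply]
    linarith

theorem IsBoundaryJet.isLaxData₁ (h : IsBoundaryJet T u p r u' p' r') (hT : 0 < T) :
    IsLaxData T (fun y => diagCoeff₁ (u y) (p y) (r y)) (fun y => offCoeff₁ (u y) (p y) (r y))
      (fun y => -(freeCoeff (u y) (p y) (r y) / 4))
      (fun y => -(freeCoeffDeriv (u y) (p y) (r y) (u' y) (p' y) (r' y) / 4)) := by
  obtain ⟨hu, hp, hr⟩ := h.continuousOn
  have hu' := h.cont_u'
  have hp' := h.cont_p'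
  have hr' := h.cont_r'
  have c1 : ContinuousOn (fun y => diagCoeff₁ (u y) (p y) (r y)) (timeInterval T) := by
    unfold diagCoeff₁; fun_prop
  have c2 : ContinuousOn (fun y => offCoeff₁ (u y) (p y) (r y)) (timeInterval T) := by
    unfold offCoeff₁; fun_prop
  have c3 : ContinuousOn (fun y => freeCoeff (u y) (p y) (r y)) (timeInterval T) := by
    unfold freeCoeff; fun_prop
  refine ⟨c1, c2, (c3.div_const 4).neg, ?_, ?_, ?_, ?_, ?_, ?_⟩
  · unfold freeCoeffDeriv; fun_prop
  · exact h.integrableOn_of_bound hT c1 fun n y => (abs_diagCoeff₁_le _ _ _ n).trans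
      (le_mul_of_one_le_left (by positivity) one_le_two)
  · exact h.integrableOn_of_bound hT c2 fun n y => (abs_offCoeff₁_le _ _ _ n).trans
      (le_mul_of_one_le_left (by positivity) one_le_two)
  · exact ((h.integrableOn_of_bound hT c3 fun n y => abs_freeCoeff_le _ _ _ n).div_const 4).neg
  · exact ((h.integrableOn_freeCoeffDeriv hT).div_const 4).neg
  · exact fun y hy => ((h.hasDeriv_freeCoeff hy).div_const 4).neg

theorem IsBoundaryJet.isLaxData₂ (h : IsBoundaryJet T u p r u' p' r') (hT : 0 < T) :
    IsLaxData T (fun y => diagCoeff₂ (u y) (p y) (r y)) (fun y => offCoeff₂ (u y) (p y) (r y))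
      (fun y => freeCoeff (u y) (p y) (r y) / 4)
      (fun y => freeCoeffDeriv (u y) (p y) (r y) (u' y) (p' y) (r' y) / 4) := by
  obtain ⟨hu, hp, hr⟩ := h.continuousOn
  have hu' := h.cont_u'
  have hp' := h.cont_p'
  have hr' := h.cont_r'
  have c1 : ContinuousOn (fun y => diagCoeff₂ (u y) (p y) (r y)) (timeInterval T) := by
    unfold diagCoeff₂; fun_prop
  have c2 : ContinuousOn (fun y => offCoeff₂ (u y) (p y) (r y)) (timeInterval T) := by
    unfold offCoeff₂; fun_prop
  have c3 : ContinuousOn (fun y => freeCoeff (u y) (p y) (r y)) (timeInterval T) := by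
    unfold freeCoeff; fun_prop
  refine ⟨c1, c2, c3.div_const 4, ?_, ?_, ?_, ?_, ?_, ?_⟩
  · unfold freeCoeffDeriv; fun_prop
  · exact h.integrableOn_of_bound hT c1 fun n y => abs_diagCoeff₂_le _ _ _ n
  · exact h.integrableOn_of_bound hT c2 fun n y => (abs_offCoeff₂_le _ _ _ n).trans
      (le_mul_of_one_le_left (by positivity) one_le_two)
  · exact (h.integrableOn_of_bound hT c3 fun n y => abs_freeCoeff_le _ _ _ n).div_const 4
  · exact (h.integrableOn_freeCoeffDeriv hT).div_const 4
  · exact fun y hy => (h.hasDeriv_freeCoeff hy).div_const 4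

/-! ### Jets of admissible data, and finiteness of the supremum defining `R`. -/

section Admissible

variable {f g : ℝ → ℝ}

theorem AdmissibleData.hasDeriv (h : AdmissibleData (timeInterval T) f g) {y : ℝ}
    (hy : y ∈ timeInterval T) :
    HasDerivWithinAt f (derivWithin f (timeInterval T) y) (timeInterval T) y :=
  (h.smooth_value.differentiableOn (by norm_num) y hy).hasDerivWithinAt

theorem AdmissibleData.contDiffOn_derivWithin (h : AdmissibleData (timeInterval T) f g)
    (hT : 0 < T) :
    ContDiffOn ℝ 1 (derivWithin f (timeInterval T)) (timeInterval T) :=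
  h.smooth_value.derivWithin (uniqueDiffOn_timeInterval hT) (by norm_num)

theorem AdmissibleData.isBoundaryJet_initial (h : AdmissibleData (timeInterval T) f g)
    (hT : 0 < T) :
    IsBoundaryJet T f (derivWithin f (timeInterval T)) g (derivWithin f (timeInterval T))
      (derivWithin (derivWithin f (timeInterval T)) (timeInterval T))
      (derivWithin g (timeInterval T)) :=
  have hs := uniqueDiffOn_timeInterval hT
  have h1 := h.contDiffOn_derivWithin hT
  { decay := h.decay_value
    int_p := h.decay_deriv
    int_r := h.decay_normal
    int_u' := h.decay_deriv
    int_p' := h.decay_deriv2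
    int_r' := h.decay_normal_deriv
    cont_u' := h1.continuousOn
    cont_p' := h1.continuousOn_derivWithin hs le_rfl
    cont_r' := h.smooth_normal.continuousOn_derivWithin hs le_rfl
    deriv_u := fun _ hy => h.hasDeriv hy
    deriv_p := fun y hy => (h1.differentiableOn (by norm_num) y hy).hasDerivWithinAt
    deriv_r := fun y hy => (h.smooth_normal.differentiableOn (by norm_num) y hy).hasDerivWithinAt }

/-- On the `t`-axis the tangential derivative is `u_t` and the normal one is `u_x`, so `p` and `r`
change places. -/
theorem AdmissibleData.isBoundaryJet_boundary (h : AdmissibleData (timeInterval T) f g)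
    (hT : 0 < T) :
    IsBoundaryJet T f g (derivWithin f (timeInterval T)) (derivWithin f (timeInterval T))
      (derivWithin g (timeInterval T))
      (derivWithin (derivWithin f (timeInterval T)) (timeInterval T)) :=
  have h' := h.isBoundaryJet_initial hT
  { decay := h'.decay
    int_p := h'.int_r
    int_r := h'.int_p
    int_u' := h'.int_u'
    int_p' := h'.int_r'
    int_r' := h'.int_p'
    cont_u' := h'.cont_u'
    cont_p' := h'.cont_r'
    cont_r' := h'.cont_p'
    deriv_u := h'.deriv_u
    deriv_p := h'.deriv_r
    deriv_r := h'.deriv_p }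

/-- On a compact interval the minimum is positive. If `T = ∞`, then `f - 2πn` tends to zero, being
integrable with an integrable derivative; as soon as it is smaller than `1` in modulus, `1 + cos f ≥
1`. -/
theorem AdmissibleData.exists_pos_le_one_add_cos (h : AdmissibleData (timeInterval T) f g)
    (hT : 0 < T) (hcos : ∀ t ∈ timeInterval T, Real.cos (f t) ≠ -1) :
    ∃ c : ℝ, 0 < c ∧ ∀ t ∈ timeInterval T, c ≤ 1 + Real.cos (f t) := by
  have hf : ContinuousOn f (timeInterval T) := h.smooth_value.continuousOn
  have hpos : ∀ t ∈ timeInterval T, 0 < 1 + Real.cos (f t) := fun t ht => by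
    have h1 := (Real.neg_one_le_cos (f t)).lt_of_ne (hcos t ht).symm
    linarith
  have hcpt : ∀ b : ℝ, b ∈ timeInterval T →
      ∃ c : ℝ, 0 < c ∧ ∀ t ∈ Icc 0 b, c ≤ 1 + Real.cos (f t) := by
    intro b hb
    have hsub := Icc_subset_timeInterval (zero_mem_timeInterval hT) hb
    have hfb := hf.mono hsub
    obtain ⟨x, hx, hmin⟩ := isCompact_Icc.exists_isMinOn (nonempty_Icc.2 hb.1)
      (show ContinuousOn (fun t => 1 + Real.cos (f t)) (Icc 0 b) by fun_prop)
    exact ⟨_, hpos x (hsub hx), fun t ht => hmin ht⟩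
  rcases timeInterval_cases hT with ⟨-, hJ⟩ | ⟨b, hb, -, hJ⟩
  · obtain ⟨n, hn⟩ := h.decay_value
    have hlim : Tendsto (fun t => f t - 2 * Real.pi * n) atTop (𝓝 0) := by
      refine tendsto_zero_of_hasDerivAt_of_integrableOn_Ioi (a := 0)
        (f' := derivWithin f (timeInterval T)) (fun x hx => ?_) ?_ ?_
      · exact ((h.hasDeriv (by rw [hJ]; exact (mem_Ioi.1 hx).le)).sub_const _).hasDerivAt
          (by rw [hJ]; exact Ici_mem_nhds hx)
      · exact h.decay_deriv.mono_set (by rw [hJ]; exact Ioi_subset_Ici_self)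
      · exact hn.mono_set (by rw [hJ]; exact Ioi_subset_Ici_self)
    have hev : ∀ᶠ t in atTop, |f t - 2 * Real.pi * n| < 1 := by
      have := hlim.abs
      rw [abs_zero] at this
      exact this.eventually (gt_mem_nhds one_pos)
    obtain ⟨b, hb⟩ := eventually_atTop.1 hev
    obtain ⟨c, hc, hcb⟩ := hcpt (max 0 b) (by rw [hJ]; exact mem_Ici.2 (le_max_left _ _))
    refine ⟨min c 1, by positivity, fun t ht => ?_⟩
    rcases le_total t (max 0 b) with h1 | h1
    · exact (min_le_left _ _).trans (hcb t ⟨ht.1, h1⟩)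
    · have h2 := hb t ((le_max_right _ _).trans h1)
      have h3 := one_sub_cos_le_dist (f t) n
      exact (min_le_right _ _).trans (by linarith)
  · rw [hJ]
    exact hcpt b (by rw [hJ]; exact ⟨hb.le, le_rfl⟩)

/-- The square root is at least `1`, so a lower bound `c` of `1 + cos f` bounds every quotient by
`1/(4c)`. -/
theorem bddAbove_ratioSet (h : AdmissibleData (timeInterval T) f g)
    (hT : 0 < T) (hcos : ∀ t ∈ timeInterval T, Real.cos (f t) ≠ -1) :
    BddAbove (ratioSet T f g) := by
  obtain ⟨c, hc, hcle⟩ := h.exists_pos_le_one_add_cos hT hcos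
  refine ⟨1 / (4 * c), ?_⟩
  rintro _ ⟨t', ht', t, ht, hlt, rfl⟩
  have hsub := Icc_subset_timeInterval ht' ht
  have hf := h.smooth_value.continuousOn.mono hsub
  have hg := h.smooth_normal.continuousOn.mono hsub
  have hd := (h.contDiffOn_derivWithin hT).continuousOn.mono hsub
  have hle : c * (t - t') ≤ ∫ τ in t'..t, (1 + Real.cos (f τ)) *
      Real.sqrt (1 + (g τ + derivWithin f (timeInterval T) τ) ^ 2) := by
    have h1 : ∫ _ in t'..t, c = c * (t - t') := by
      rw [intervalIntegral.integral_const, smul_eq_mul, mul_comm]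
    rw [← h1]
    refine intervalIntegral.integral_mono_on hlt.le (by simp) ?_ fun x hx => ?_
    · exact ContinuousOn.intervalIntegrable_of_Icc hlt.le (by fun_prop)
    · have h2 := hcle x (hsub hx)
      refine h2.trans (le_mul_of_one_le_right (hc.le.trans h2) ?_)
      exact Real.one_le_sqrt.2 (by nlinarith [sq_nonneg (g x + derivWithin f (timeInterval T) x)])
  have hpos : 0 < c * (t - t') := mul_pos hc (sub_pos.2 hlt)
  rw [div_le_div_iff₀ (by linarith) (by positivity)]
  linarith

end Admissible

end

section

variable {T : EReal} {α β w w' : ℝ → ℝ}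

/-! ### The spectral functions of a column -/

/-- The second column of the spectral matrix, with the value `(0, 1)` at `k = 0`. -/
def spectralColumn (T : EReal) (α β w : ℝ → ℝ) (κ : ℂ → ℂ) (k : ℂ) : Fin 2 → ℂ :=
  if k = 0 then unitCol else laxColumn T α β w (κ k) k 0

theorem spectralColumn_zero (κ : ℂ → ℂ) : spectralColumn T α β w κ 0 = unitCol := if_pos rfl

theorem spectralColumn_of_ne {κ : ℂ → ℂ} {k : ℂ} (hk : k ≠ 0) :
    spectralColumn T α β w κ k = laxColumn T α β w (κ k) k 0 := if_neg hk

theorem IsLaxData.analyticOnNhd_spectralColumn (h : IsLaxData T α β w w') (hT : 0 < T)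
    {κ : ℂ → ℂ} {U : Set ℂ} (hU : IsOpen U) (hU0 : ∀ k ∈ U, k ≠ 0)
    (hκd : DifferentiableOn ℂ κ {0}ᶜ) (hκ : ∀ k ∈ U, T < ⊤ ∨ 0 ≤ (κ k).im) (i : Fin 2) :
    AnalyticOnNhd ℂ (fun k => spectralColumn T α β w κ k i) U := by
  refine DifferentiableOn.analyticOnNhd (fun k hk => ?_) hU
  have h1 := differentiableAt_pi.1
    (h.differentiableAt_column hT hU (hκd.mono fun k hk => hU0 k hk) hκ hk) i
  refine (h1.congr_of_eventuallyEq ?_).differentiableWithinAt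
  filter_upwards [hU.mem_nhds hk] with z hz
  rw [spectralColumn_of_ne (hU0 z hz)]

theorem IsLaxData.exists_spectralColumn_bound (h : IsLaxData T α β w w') (hT : 0 < T) {κ : ℂ → ℂ}
    (hκ1 : ∀ k : ℂ, k ≠ 0 → ‖k‖ ≤ 1 / 4 → 1 ≤ 16 * ‖k‖ * ‖κ k‖) :
    ∃ C : ℝ, ∀ k : ℂ, (k ≠ 0 → 0 ≤ (κ k).im) → ‖k‖ ≤ 1 / 4 → ∀ i,
      ‖spectralColumn T α β w κ k i - unitCol i‖ ≤ C * ‖k‖ := by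
  obtain ⟨C, hC⟩ := h.exists_small_bound hT hκ1
  refine ⟨C, fun k hk hk4 i => ?_⟩
  rcases eq_or_ne k 0 with rfl | hk0
  · simp [spectralColumn_zero]
  · obtain ⟨h1, h0⟩ := hC k hk0 hk4 (hk hk0)
    rw [spectralColumn_of_ne hk0]
    fin_cases i
    · simpa [unitCol] using h0
    · simpa [unitCol] using h1

theorem IsLaxData.isBigO_spectralColumn (h : IsLaxData T α β w w') (hT : 0 < T) {κ : ℂ → ℂ}
    (hκ1 : ∀ k : ℂ, k ≠ 0 → ‖k‖ ≤ 1 / 4 → 1 ≤ 16 * ‖k‖ * ‖κ k‖) {Z : Set ℂ}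
    (hZ : ∀ k ∈ Z, k ≠ 0 → 0 ≤ (κ k).im) (i : Fin 2) :
    (fun k => spectralColumn T α β w κ k i - unitCol i) =O[𝓝[Z] 0] fun k : ℂ => k := by
  obtain ⟨C, hC⟩ := h.exists_spectralColumn_bound hT hκ1
  refine IsBigO.of_bound C ?_
  filter_upwards [self_mem_nhdsWithin, mem_nhdsWithin_of_mem_nhds
    (Metric.closedBall_mem_nhds (0 : ℂ) (by norm_num : (0 : ℝ) < 1 / 4))] with k hk hk4
  exact hC k (hZ k hk) (by simpa using hk4) i

/-- At `0`, where the phase is singular, continuity is the `O(k)` estimate together with the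
assigned value. -/
theorem IsLaxData.continuousOn_spectralColumn (h : IsLaxData T α β w w') (hT : 0 < T) {κ : ℂ → ℂ}
    (hκd : DifferentiableOn ℂ κ {0}ᶜ)
    (hκ1 : ∀ k : ℂ, k ≠ 0 → ‖k‖ ≤ 1 / 4 → 1 ≤ 16 * ‖k‖ * ‖κ k‖) {Z : Set ℂ}
    (hZ : ∀ k ∈ Z, k ≠ 0 → 0 ≤ (κ k).im) (i : Fin 2) :
    ContinuousOn (fun k => spectralColumn T α β w κ k i) Z := by
  intro k₀ hk₀
  rcases eq_or_ne k₀ 0 with rfl | hne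
  · rw [ContinuousWithinAt, spectralColumn_zero, ← tendsto_sub_nhds_zero_iff]
    exact (h.isBigO_spectralColumn hT hκ1 hZ i).trans_tendsto
      (tendsto_nhdsWithin_of_tendsto_nhds tendsto_id)
  · have h1 : ContinuousOn (fun k => laxColumn T α β w (κ k) k 0) (Z ∩ {0}ᶜ) :=
      h.continuousOn_column hT (hκd.continuousOn.mono inter_subset_right)
        fun k hk => hZ k hk.1 hk.2
    have h2 : ContinuousOn (fun k => spectralColumn T α β w κ k i) (Z ∩ {0}ᶜ) :=
      (continuousOn_pi.1 h1 i).congr fun k hk => by simp only [spectralColumn_of_ne hk.2]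
    exact (continuousWithinAt_inter (isOpen_compl_singleton.mem_nhds hne)).1 (h2 k₀ ⟨hk₀, hne⟩)

theorem IsLaxData.spectralColumn_mul_conj (h : IsLaxData T α β w w') (hT : 0 < T) {κ : ℂ → ℂ}
    (hκc : ∀ k, κ (conj k) = conj (κ k)) {k : ℂ} (hκ : k = 0 ∨ T < ⊤ ∨ (κ k).im = 0) :
    spectralColumn T α β w κ k 1 * conj (spectralColumn T α β w κ (conj k) 1)
      + spectralColumn T α β w κ k 0 * conj (spectralColumn T α β w κ (conj k) 0) = 1 := by
  rcases eq_or_ne k 0 with rfl | hk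
  · simp [spectralColumn_zero, unitCol]
  · rw [spectralColumn_of_ne hk, spectralColumn_of_ne ((map_ne_zero _).2 hk), hκc]
    exact h.column_mul_conj hT (hκ.resolve_left hk)

/-! ### The phases and the domains -/

theorem im_one_div (k : ℂ) : (1 / (8 * k)).im = -k.im / (8 * ‖k‖ ^ 2) := by
  have h8 : Complex.normSq 8 = 64 := by
    rw [show (8 : ℂ) = ((8 : ℝ) : ℂ) by norm_num, Complex.normSq_ofReal]; norm_num
  have him : (8 * k).im = 8 * k.im := by simp
  rw [one_div, Complex.inv_im, Complex.normSq_mul, ← Complex.normSq_eq_norm_sq, h8, him]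
  rcases eq_or_ne (Complex.normSq k) 0 with h | h
  · simp [h]
  · field_simp; ring

/-- The sign of `Im(k + 1/(8k))` is that of `Im k · (|k|² - 1/8)`; all domains are read off from
this. -/
theorem im_add_one_div {k : ℂ} (hk : k ≠ 0) :
    (k + 1 / (8 * k)).im * ‖k‖ ^ 2 = k.im * (‖k‖ ^ 2 - 1 / 8) := by
  have : ‖k‖ ≠ 0 := norm_ne_zero_iff.2 hk
  rw [Complex.add_im, im_one_div]
  field_simp
  ring

theorem normSq_pos_of_ne {k : ℂ} (hk : k ≠ 0) : 0 < ‖k‖ ^ 2 := by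
  have := norm_pos_iff.2 hk
  positivity

theorem xPhase_im_nonneg {k : ℂ} (h : k.im ≤ 0) : 0 ≤ (xPhase k).im := by
  rw [xPhase, im_one_div]
  exact div_nonneg (by linarith) (by positivity)

theorem xPhase_im_nonpos {k : ℂ} (h : 0 ≤ k.im) : (xPhase k).im ≤ 0 := by
  rw [xPhase, im_one_div]
  exact div_nonpos_of_nonpos_of_nonneg (by linarith) (by positivity)

theorem tPhase_im (k : ℂ) : (tPhase k).im = -(k + 1 / (8 * k)).im := by
  rw [tPhase, Complex.neg_im]

theorem xPhase_conj (k : ℂ) : xPhase (conj k) = conj (xPhase k) := by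
  simp [xPhase, Complex.conj_ofNat]

theorem tPhase_conj (k : ℂ) : tPhase (conj k) = conj (tPhase k) := by
  simp [tPhase, Complex.conj_ofNat]

theorem differentiableOn_xPhase : DifferentiableOn ℂ xPhase {0}ᶜ := fun k hk =>
  ((differentiableAt_const 1).div (differentiableAt_id.const_mul 8)
    (mul_ne_zero (by norm_num) hk)).differentiableWithinAt

theorem differentiableOn_tPhase : DifferentiableOn ℂ tPhase {0}ᶜ :=
  (differentiableOn_id.add differentiableOn_xPhase).neg

theorem norm_mul_norm_xPhase {k : ℂ} (hk : k ≠ 0) : ‖k‖ * ‖xPhase k‖ = 1 / 8 := by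
  have : ‖k‖ ≠ 0 := norm_ne_zero_iff.2 hk
  rw [xPhase, norm_div, norm_mul, norm_one, Complex.norm_ofNat]
  field_simp

theorem one_le_norm_xPhase {k : ℂ} (hk : k ≠ 0) : 1 ≤ 16 * ‖k‖ * ‖xPhase k‖ := by
  have := norm_mul_norm_xPhase hk
  linarith

/-- Here `|k| |tPhase k| ≥ 1/8 - |k|² ≥ 1/16`; this is the source of the constants `1/4` and `16`.
-/
theorem one_le_norm_tPhase {k : ℂ} (hk : k ≠ 0) (hk4 : ‖k‖ ≤ 1 / 4) :
    1 ≤ 16 * ‖k‖ * ‖tPhase k‖ := by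
  have h1 := norm_mul_norm_xPhase hk
  have h2 : ‖xPhase k‖ ≤ ‖tPhase k‖ + ‖k‖ := by
    have : xPhase k = -(tPhase k + k) := by rw [tPhase, xPhase]; ring
    rw [this, norm_neg]
    exact norm_add_le _ _
  nlinarith [norm_nonneg k]

theorem im_neg_of_mem_D1_union_D2 {k : ℂ} (hk : k ∈ D1 ∪ D2) : k ≠ 0 ∧ k.im < 0 := by
  have h : k ≠ 0 ∧ 0 < (1 / (8 * k)).im := by
    rcases hk with hk | hk <;> exact ⟨hk.1, hk.2.1⟩
  refine ⟨h.1, not_le.1 fun hc => ?_⟩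
  exact not_lt.2 (xPhase_im_nonpos hc) h.2

theorem im_pos_of_mem_D3 {k : ℂ} (hk : k ∈ D3) : 0 < k.im :=
  not_le.1 fun hc => not_lt.2 (xPhase_im_nonneg hc) hk.2.1

/-- A point of `D1` with `|k| > R` would lie in `D6`. The three inequalities are closed conditions,
so they survive in the closure. -/
theorem closure_D1'_subset (T : EReal) (g₀ g₁ : ℝ → ℝ) :
    closure (D1' T g₀ g₁) ⊆ {k | k.im ≤ 0 ∧ 1 / 8 ≤ ‖k‖ ^ 2 ∧ ‖k‖ ≤ R T g₀ g₁} := by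
  refine closure_minimal (fun k hk => ?_) ?_
  · obtain ⟨hk0, him⟩ := im_neg_of_mem_D1_union_D2 (Or.inl hk.1)
    have h1 := im_add_one_div hk0
    have h4 := mul_neg_of_neg_of_pos hk.1.2.2 (normSq_pos_of_ne hk0)
    refine ⟨him.le, ?_, ?_⟩
    · by_contra hc
      have h5 := mul_pos_of_neg_of_neg him (by linarith : ‖k‖ ^ 2 - 1 / 8 < 0)
      linarith
    · by_contra hc
      exact hk.2 (subset_closure ⟨him, not_le.1 hc⟩)
  · exact (isClosed_le Complex.continuous_im continuous_const).inter
      ((isClosed_le continuous_const (continuous_norm.pow 2)).inter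
        (isClosed_le continuous_norm continuous_const))

theorem closure_D2_subset : closure D2 ⊆ {k | k.im ≤ 0 ∧ ‖k‖ ^ 2 ≤ 1 / 8} := by
  refine closure_minimal (fun k hk => ?_) ?_
  · obtain ⟨hk0, him⟩ := im_neg_of_mem_D1_union_D2 (Or.inr hk)
    have h1 := im_add_one_div hk0
    have h4 := mul_pos hk.2.2 (normSq_pos_of_ne hk0)
    refine ⟨him.le, ?_⟩
    by_contra hc
    have h5 := mul_neg_of_neg_of_pos him (by linarith : 0 < ‖k‖ ^ 2 - 1 / 8)
    linarith
  · exact (isClosed_le Complex.continuous_im continuous_const).inter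
      (isClosed_le (continuous_norm.pow 2) continuous_const)

theorem closure_D3_subset : closure D3 ⊆ {k | 0 ≤ k.im ∧ ‖k‖ ^ 2 ≤ 1 / 8} := by
  refine closure_minimal (fun k hk => ?_) ?_
  · have him := im_pos_of_mem_D3 hk
    have h1 := im_add_one_div hk.1
    have h4 := mul_neg_of_neg_of_pos hk.2.2 (normSq_pos_of_ne hk.1)
    refine ⟨him.le, ?_⟩
    by_contra hc
    have h5 := mul_pos him (by linarith : 0 < ‖k‖ ^ 2 - 1 / 8)
    linarith
  · exact (isClosed_le continuous_const Complex.continuous_im).inter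
      (isClosed_le (continuous_norm.pow 2) continuous_const)

theorem im_nonpos_of_mem_closure {g₀ g₁ : ℝ → ℝ} {k : ℂ}
    (hk : k ∈ closure (D1' T g₀ g₁) ∪ closure D2) : k.im ≤ 0 := by
  rcases hk with hk | hk
  exacts [(closure_D1'_subset _ _ _ hk).1, (closure_D2_subset hk).1]

theorem tPhase_im_nonneg_of_mem_closure {g₀ g₁ : ℝ → ℝ} {k : ℂ}
    (hk : k ∈ closure (D1' T g₀ g₁) ∪ closure D3) (hk0 : k ≠ 0) : 0 ≤ (tPhase k).im := by
  have h1 := im_add_one_div hk0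
  have h2 : k.im * (‖k‖ ^ 2 - 1 / 8) ≤ 0 := by
    rcases hk with hk | hk
    · obtain ⟨e1, e2, -⟩ := closure_D1'_subset _ _ _ hk
      exact mul_nonpos_of_nonpos_of_nonneg e1 (by linarith)
    · obtain ⟨e1, e2⟩ := closure_D3_subset hk
      exact mul_nonpos_of_nonneg_of_nonpos e1 (by linarith)
  rw [tPhase_im, neg_nonneg]
  by_contra hc
  have := mul_pos (not_le.1 hc) (normSq_pos_of_ne hk0)
  linarith

theorem isCompact_closure_union {g₀ g₁ : ℝ → ℝ} {D : Set ℂ}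
    (hD : ∀ k ∈ closure D, ‖k‖ ^ 2 ≤ 1 / 8) :
    IsCompact (closure (D1' T g₀ g₁) ∪ closure D) := by
  refine Metric.isCompact_of_isClosed_isBounded (isClosed_closure.union isClosed_closure)
    (isBounded_iff_forall_norm_le.2 ⟨max (R T g₀ g₁) 1, ?_⟩)
  rintro k (hk | hk)
  · exact (closure_D1'_subset _ _ _ hk).2.2.trans (le_max_left _ _)
  · have : ‖k‖ ≤ 1 := by nlinarith [hD k hk, norm_nonneg k]
    exact this.trans (le_max_right _ _)

theorem exists_bound_pair {K : Set ℂ} (hK : IsCompact K) {f g : ℂ → ℂ} (hf : ContinuousOn f K)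
    (hg : ContinuousOn g K) : ∃ C : ℝ, ∀ k ∈ K, ‖f k‖ ≤ C ∧ ‖g k‖ ≤ C := by
  obtain ⟨C₁, h₁⟩ := hK.exists_bound_of_continuousOn hf
  obtain ⟨C₂, h₂⟩ := hK.exists_bound_of_continuousOn hg
  exact ⟨max C₁ C₂, fun k hk => ⟨(h₁ k hk).trans (le_max_left _ _),
    (h₂ k hk).trans (le_max_right _ _)⟩⟩

theorem tPhase_im_nonneg_iff {k : ℂ} : 0 ≤ (tPhase k).im ↔ (k + 1 / (8 * k)).im ≤ 0 := by
  rw [tPhase_im, neg_nonneg]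

theorem tPhase_im_nonpos_iff {k : ℂ} : (tPhase k).im ≤ 0 ↔ 0 ≤ (k + 1 / (8 * k)).im := by
  rw [tPhase_im, neg_nonpos]

theorem isOpen_im_tPhase_pos : IsOpen {k : ℂ | k ≠ 0 ∧ 0 < (tPhase k).im} := by
  have h1 : ContinuousOn (fun k => (tPhase k).im) {0}ᶜ :=
    Complex.continuous_im.comp_continuousOn differentiableOn_tPhase.continuousOn
  exact h1.isOpen_inter_preimage isOpen_compl_singleton isOpen_Ioi

end

section

variable {T : EReal} {α β w w' u₀ u₁ g₀ g₁ : ℝ → ℝ}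

/-! ### The spectral functions of the initial and the boundary data -/

theorem AdmissibleData.exists_initial (h : AdmissibleData (Ici 0) u₀ u₁) :
    ∃ α β w w', IsLaxData ⊤ α β w w' ∧ ∀ k, initialPotential u₀ u₁ k = laxPotential α β w k := by
  rw [← timeInterval_top] at h
  refine ⟨_, _, _, _, (h.isBoundaryJet_initial EReal.zero_lt_top).isLaxData₁ EReal.zero_lt_top,
    fun k => funext fun y => ?_⟩
  rw [timeInterval_top]
  exact V1_eq_laxPotential u₀ (derivWithin u₀ (Ici 0)) u₁ k y

theorem AdmissibleData.exists_boundary (hT : 0 < T) (h : AdmissibleData (timeInterval T) g₀ g₁) :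
    ∃ α β w w', IsLaxData T α β w w' ∧
      ∀ k, boundaryPotential T g₀ g₁ k = laxPotential α β w k :=
  ⟨_, _, _, _, (h.isBoundaryJet_boundary hT).isLaxData₂ hT, fun k => funext fun y =>
    V2_eq_laxPotential g₀ g₁ (derivWithin g₀ (timeInterval T)) k y⟩

theorem unitCol_apply (i : Fin 2) : unitCol i = (1 : Matrix (Fin 2) (Fin 2) ℂ) i 1 := by
  fin_cases i
  · simp [unitCol]
  · exact (Matrix.one_apply_eq _).symm

theorem s_apply_one (hV : ∀ k, initialPotential u₀ u₁ k = laxPotential α β w k) (k : ℂ)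
    (i : Fin 2) : s u₀ u₁ k i 1 = spectralColumn ⊤ α β w xPhase k i := by
  unfold s spectralColumn
  split_ifs with hk
  · exact (unitCol_apply i).symm
  · rw [mu3, Matrix.of_apply, hV, ← timeInterval_top]

theorem S_apply_one (hV : ∀ k, boundaryPotential T g₀ g₁ k = laxPotential α β w k) (k : ℂ)
    (i : Fin 2) : S T g₀ g₁ k i 1 = spectralColumn T α β w tPhase k i := by
  unfold S spectralColumn
  split_ifs with hk
  · exact (unitCol_apply i).symm
  · rw [mu1, Matrix.of_apply, hV]

/-- The first column of the spectral matrix is determined by the second one. -/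
theorem IsLaxData.column_zero_eq_spectralColumn (h : IsLaxData T α β w w') (hT : 0 < T)
    {κ : ℂ → ℂ} (hκc : ∀ k, κ (conj k) = conj (κ k)) {k : ℂ} (hk : k ≠ 0)
    (hκ : T < ⊤ ∨ (κ k).im ≤ 0) :
    volterraColumn (laxPotential α β w k) (κ k) (timeInterval T) 0 0
      = ![conj (spectralColumn T α β w κ (conj k) 1),
        -conj (spectralColumn T α β w κ (conj k) 0)] := by
  rw [h.column_zero_eq hT hκ, spectralColumn_of_ne ((map_ne_zero _).2 hk), hκc]

theorem s_apply_zero (h : IsLaxData ⊤ α β w w')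
    (hV : ∀ k, initialPotential u₀ u₁ k = laxPotential α β w k) {k : ℂ} (hk : 0 ≤ k.im) :
    s u₀ u₁ k 0 0 = conj (a u₀ u₁ (conj k)) ∧ s u₀ u₁ k 1 0 = -conj (b u₀ u₁ (conj k)) := by
  rw [a, b, s_apply_one hV, s_apply_one hV]
  rcases eq_or_ne k 0 with rfl | hk0
  · simp [s, spectralColumn_zero, unitCol]
  · have := h.column_zero_eq_spectralColumn EReal.zero_lt_top xPhase_conj hk0
      (Or.inr (xPhase_im_nonpos hk))
    rw [s, if_neg hk0, mu3, Matrix.of_apply, Matrix.of_apply, hV, ← timeInterval_top, this]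
    exact ⟨rfl, rfl⟩

theorem S_apply_zero (hT : 0 < T) (h : IsLaxData T α β w w')
    (hV : ∀ k, boundaryPotential T g₀ g₁ k = laxPotential α β w k) {k : ℂ}
    (hk : T < ⊤ ∨ 0 ≤ (k + 1 / (8 * k)).im) :
    S T g₀ g₁ k 0 0 = conj (A T g₀ g₁ (conj k)) ∧
      S T g₀ g₁ k 1 0 = -conj (B T g₀ g₁ (conj k)) := by
  rw [A, B, S_apply_one hV, S_apply_one hV]
  rcases eq_or_ne k 0 with rfl | hk0
  · simp [S, spectralColumn_zero, unitCol]
  · have := h.column_zero_eq_spectralColumn hT tPhase_conj hk0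
      (hk.imp_right tPhase_im_nonpos_iff.2)
    rw [S, if_neg hk0, mu1, Matrix.of_apply, Matrix.of_apply, hV, this]
    exact ⟨rfl, rfl⟩

/-- The real axis and the circle `|k|² = 1/8` are where the phase is real, so that both `k` and
`conj k` are admissible. -/
theorem tPhase_im_eq_zero {k : ℂ} (hk : k.im = 0 ∨ ‖k‖ ^ 2 = 1 / 8) :
    k = 0 ∨ (tPhase k).im = 0 := by
  refine or_iff_not_imp_left.2 fun hk0 => ?_
  have h1 := im_add_one_div hk0
  have h2 : k.im * (‖k‖ ^ 2 - 1 / 8) = 0 := by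
    rcases hk with hk | hk <;> simp [hk]
  rw [h2] at h1
  rw [tPhase_im, (mul_eq_zero.1 h1).resolve_right (normSq_pos_of_ne hk0).ne', neg_zero]

end

end GSG

end

/-! ### The spectral functions: `s` with phase `xPhase` on the half-line, `S` with phase `tPhase` on
`timeInterval T`. -/

theorem proposition3p1 (T : EReal) (hT : 0 < T) (u₀ u₁ g₀ g₁ : ℝ → ℝ)
    (hinit : GSG.AdmissibleData (Ici 0) u₀ u₁)
    (hbdry : GSG.AdmissibleData (GSG.timeInterval T) g₀ g₁)
    (hcos : ∀ t ∈ GSG.timeInterval T, Real.cos (g₀ t) ≠ -1) :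
    -- `R` is a finite supremum
    BddAbove (GSG.ratioSet T g₀ g₁) ∧
    -- `s` is well defined, and has the form that defines `a` and `b`
    ((∀ k : ℂ, k ≠ 0 → k.im ≤ 0 → GSG.HasUniqueColumn
        (GSG.initialPotential u₀ u₁ k) (GSG.xPhase k) (Ici 0) 1) ∧
      (∀ k : ℂ, k ≠ 0 → 0 ≤ k.im → GSG.HasUniqueColumn
        (GSG.initialPotential u₀ u₁ k) (GSG.xPhase k) (Ici 0) 0) ∧
      (∀ k : ℂ, 0 ≤ k.im →
        GSG.s u₀ u₁ k 0 0 = conj (GSG.a u₀ u₁ (conj k)) ∧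
        GSG.s u₀ u₁ k 1 0 = -conj (GSG.b u₀ u₁ (conj k)))) ∧
    -- (i) for `a`, `b`
    (AnalyticOnNhd ℂ (GSG.a u₀ u₁) (GSG.D1 ∪ GSG.D2) ∧
      AnalyticOnNhd ℂ (GSG.b u₀ u₁) (GSG.D1 ∪ GSG.D2) ∧
      ContinuousOn (GSG.a u₀ u₁) (closure (GSG.D1' T g₀ g₁) ∪ closure GSG.D2) ∧
      ContinuousOn (GSG.b u₀ u₁) (closure (GSG.D1' T g₀ g₁) ∪ closure GSG.D2) ∧
      ∃ C : ℝ, ∀ k ∈ closure (GSG.D1' T g₀ g₁) ∪ closure GSG.D2,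
        ‖GSG.a u₀ u₁ k‖ ≤ C ∧ ‖GSG.b u₀ u₁ k‖ ≤ C) ∧
    -- (ii) for `a`, `b`
    ((fun k => GSG.a u₀ u₁ k - 1) =O[𝓝[GSG.D2] 0] (fun k : ℂ => k) ∧
      GSG.b u₀ u₁ =O[𝓝[GSG.D2] 0] (fun k : ℂ => k)) ∧
    -- (iii) for `a`, `b`
    (∀ r : ℝ, ‖GSG.a u₀ u₁ r‖ ^ 2 + ‖GSG.b u₀ u₁ r‖ ^ 2 = 1) ∧
    -- `S` is well defined, and has the form that defines `A` and `B`
    ((∀ k : ℂ, k ≠ 0 → (T < ⊤ ∨ (k + 1 / (8 * k)).im ≤ 0) → GSG.HasUniqueColumn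
        (GSG.boundaryPotential T g₀ g₁ k) (GSG.tPhase k) (GSG.timeInterval T) 1) ∧
      (∀ k : ℂ, k ≠ 0 → (T < ⊤ ∨ 0 ≤ (k + 1 / (8 * k)).im) → GSG.HasUniqueColumn
        (GSG.boundaryPotential T g₀ g₁ k) (GSG.tPhase k) (GSG.timeInterval T) 0) ∧
      (∀ k : ℂ, (T < ⊤ ∨ 0 ≤ (k + 1 / (8 * k)).im) →
        GSG.S T g₀ g₁ k 0 0 = conj (GSG.A T g₀ g₁ (conj k)) ∧
        GSG.S T g₀ g₁ k 1 0 = -conj (GSG.B T g₀ g₁ (conj k)))) ∧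
    -- (i) for `A`, `B`
    (AnalyticOnNhd ℂ (GSG.A T g₀ g₁) (GSG.D1 ∪ GSG.D3) ∧
      AnalyticOnNhd ℂ (GSG.B T g₀ g₁) (GSG.D1 ∪ GSG.D3) ∧
      ContinuousOn (GSG.A T g₀ g₁) (closure (GSG.D1' T g₀ g₁) ∪ closure GSG.D3) ∧
      ContinuousOn (GSG.B T g₀ g₁) (closure (GSG.D1' T g₀ g₁) ∪ closure GSG.D3) ∧
      (∃ C : ℝ, ∀ k ∈ closure (GSG.D1' T g₀ g₁) ∪ closure GSG.D3,
        ‖GSG.A T g₀ g₁ k‖ ≤ C ∧ ‖GSG.B T g₀ g₁ k‖ ≤ C) ∧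
      (T < ⊤ → AnalyticOnNhd ℂ (GSG.A T g₀ g₁) {0}ᶜ ∧
        AnalyticOnNhd ℂ (GSG.B T g₀ g₁) {0}ᶜ)) ∧
    -- (ii) for `A`, `B`
    ((fun k => GSG.A T g₀ g₁ k - 1) =O[𝓝[GSG.D1 ∪ GSG.D3] 0] (fun k : ℂ => k) ∧
      GSG.B T g₀ g₁ =O[𝓝[GSG.D1 ∪ GSG.D3] 0] (fun k : ℂ => k)) ∧
    -- (iii) for `A`, `B`
    (∀ k : ℂ, (k.im = 0 ∨ ‖k‖ ^ 2 = 1 / 8 ∨ T < ⊤) →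
      GSG.A T g₀ g₁ k * conj (GSG.A T g₀ g₁ (conj k)) +
        GSG.B T g₀ g₁ k * conj (GSG.B T g₀ g₁ (conj k)) = 1) := by
  obtain ⟨α, β, w, w', hx, hVx⟩ := hinit.exists_initial
  obtain ⟨α', β', v, v', ht, hVt⟩ := hbdry.exists_boundary hT
  have htop := EReal.zero_lt_top
  have ha : GSG.a u₀ u₁ = fun k => GSG.spectralColumn ⊤ α β w GSG.xPhase k 1 :=
    funext fun k => GSG.s_apply_one hVx k 1
  have hb : GSG.b u₀ u₁ = fun k => GSG.spectralColumn ⊤ α β w GSG.xPhase k 0 :=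
    funext fun k => GSG.s_apply_one hVx k 0
  have hA : GSG.A T g₀ g₁ = fun k => GSG.spectralColumn T α' β' v GSG.tPhase k 1 :=
    funext fun k => GSG.S_apply_one hVt k 1
  have hB : GSG.B T g₀ g₁ = fun k => GSG.spectralColumn T α' β' v GSG.tPhase k 0 :=
    funext fun k => GSG.S_apply_one hVt k 0
  have hx1 : ∀ k : ℂ, k ≠ 0 → ‖k‖ ≤ 1 / 4 → 1 ≤ 16 * ‖k‖ * ‖GSG.xPhase k‖ :=
    fun k hk _ => GSG.one_le_norm_xPhase hk
  have ht1 : ∀ k : ℂ, k ≠ 0 → ‖k‖ ≤ 1 / 4 → 1 ≤ 16 * ‖k‖ * ‖GSG.tPhase k‖ :=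
    fun k hk hk4 => GSG.one_le_norm_tPhase hk hk4
  -- Analyticity holds on the whole open lower half-plane, which contains `D1 ∪ D2`.
  have hxan : ∀ i, AnalyticOnNhd ℂ (fun k => GSG.spectralColumn ⊤ α β w GSG.xPhase k i)
      (GSG.D1 ∪ GSG.D2) := fun i =>
    (hx.analyticOnNhd_spectralColumn htop (U := {k : ℂ | k.im < 0})
      (isOpen_lt Complex.continuous_im continuous_const)
      (fun k hk h0 => by simp [h0] at hk) GSG.differentiableOn_xPhase
      (fun k hk => Or.inr (GSG.xPhase_im_nonneg (le_of_lt hk))) i).mono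
      fun k hk => (GSG.im_neg_of_mem_D1_union_D2 hk).2
  have hxc : ∀ i, ContinuousOn (fun k => GSG.spectralColumn ⊤ α β w GSG.xPhase k i)
      (closure (GSG.D1' T g₀ g₁) ∪ closure GSG.D2) := fun i =>
    hx.continuousOn_spectralColumn htop GSG.differentiableOn_xPhase hx1
      (fun k hk _ => GSG.xPhase_im_nonneg (GSG.im_nonpos_of_mem_closure hk)) i
  have hxO : ∀ i, (fun k => GSG.spectralColumn ⊤ α β w GSG.xPhase k i - GSG.unitCol i)
      =O[𝓝[GSG.D2] 0] fun k : ℂ => k := fun i =>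
    hx.isBigO_spectralColumn htop hx1 (fun k hk _ => GSG.xPhase_im_nonneg
      (GSG.im_neg_of_mem_D1_union_D2 (Or.inr hk)).2.le) i
  have htan : ∀ i, AnalyticOnNhd ℂ (fun k => GSG.spectralColumn T α' β' v GSG.tPhase k i)
      (GSG.D1 ∪ GSG.D3) := fun i =>
    (ht.analyticOnNhd_spectralColumn hT GSG.isOpen_im_tPhase_pos (fun k hk => hk.1)
      GSG.differentiableOn_tPhase (fun k hk => Or.inr hk.2.le) i).mono
      fun k hk => by
        have h : k ≠ 0 ∧ (k + 1 / (8 * k)).im < 0 := by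
          rcases hk with hk | hk <;> exact ⟨hk.1, hk.2.2⟩
        exact ⟨h.1, by rw [GSG.tPhase_im]; linarith [h.2]⟩
  have htc : ∀ i, ContinuousOn (fun k => GSG.spectralColumn T α' β' v GSG.tPhase k i)
      (closure (GSG.D1' T g₀ g₁) ∪ closure GSG.D3) := fun i =>
    ht.continuousOn_spectralColumn hT GSG.differentiableOn_tPhase ht1
      (fun k hk hk0 => GSG.tPhase_im_nonneg_of_mem_closure hk hk0) i
  have htO : ∀ i, (fun k => GSG.spectralColumn T α' β' v GSG.tPhase k i - GSG.unitCol i)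
      =O[𝓝[GSG.D1 ∪ GSG.D3] 0] fun k : ℂ => k := fun i =>
    ht.isBigO_spectralColumn hT ht1 (fun k hk _ => by
      rw [GSG.tPhase_im_nonneg_iff]
      rcases hk with hk | hk <;> exact hk.2.2.le) i
  refine ⟨GSG.bddAbove_ratioSet hbdry hT hcos, ⟨?_, ?_, fun k hk => GSG.s_apply_zero hx hVx hk⟩,
    ?_, ?_, ?_, ⟨?_, ?_, fun k hk => GSG.S_apply_zero hT ht hVt hk⟩, ?_, ?_, ?_⟩
  · intro k _ hk
    rw [hVx, ← GSG.timeInterval_top]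
    exact hx.hasUniqueColumn htop (Or.inr (GSG.xPhase_im_nonneg hk))
  · intro k _ hk
    rw [hVx, ← GSG.timeInterval_top]
    exact hx.hasUniqueColumn_zero htop (Or.inr (GSG.xPhase_im_nonpos hk))
  · rw [ha, hb]
    exact ⟨hxan 1, hxan 0, hxc 1, hxc 0, GSG.exists_bound_pair
      (GSG.isCompact_closure_union fun k hk => (GSG.closure_D2_subset hk).2) (hxc 1) (hxc 0)⟩
  · rw [ha, hb]
    exact ⟨by simpa [GSG.unitCol] using hxO 1, by simpa [GSG.unitCol] using hxO 0⟩
  · intro r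
    -- The phase is real for every real `r`, including `r = 0`, where division by zero gives `xPhase
    -- 0 = 0`.
    have h := hx.spectralColumn_mul_conj htop GSG.xPhase_conj (k := r)
      (Or.inr (Or.inr (by simp [GSG.xPhase, ← Complex.ofReal_ofNat, ← Complex.ofReal_inv,
        ← Complex.ofReal_mul])))
    rw [Complex.conj_ofReal, Complex.mul_conj, Complex.mul_conj, Complex.normSq_eq_norm_sq,
      Complex.normSq_eq_norm_sq] at h
    rw [ha, hb]
    exact_mod_cast h
  · intro k _ hk
    rw [hVt]
    exact ht.hasUniqueColumn hT (hk.imp_right GSG.tPhase_im_nonneg_iff.2)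
  · intro k _ hk
    rw [hVt]
    exact ht.hasUniqueColumn_zero hT (hk.imp_right GSG.tPhase_im_nonpos_iff.2)
  · rw [hA, hB]
    refine ⟨htan 1, htan 0, htc 1, htc 0, GSG.exists_bound_pair
      (GSG.isCompact_closure_union fun k hk => (GSG.closure_D3_subset hk).2) (htc 1) (htc 0),
      fun hfin => ?_⟩
    have := fun i => ht.analyticOnNhd_spectralColumn hT isOpen_compl_singleton
      (fun k hk => hk) GSG.differentiableOn_tPhase (fun k _ => Or.inl hfin) i
    exact ⟨this 1, this 0⟩
  · rw [hA, hB]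
    exact ⟨by simpa [GSG.unitCol] using htO 1, by simpa [GSG.unitCol] using htO 0⟩
  · intro k hk
    rw [hA, hB]
    refine ht.spectralColumn_mul_conj hT GSG.tPhase_conj ?_
    rcases hk with hk | hk | hk
    · exact (GSG.tPhase_im_eq_zero (Or.inl hk)).imp_right Or.inr
    · exact (GSG.tPhase_im_eq_zero (Or.inr hk)).imp_right Or.inr
    · exact Or.inr (Or.inl hk)
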